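/- **Setting.** Let $1\le d\le 3$ and let $\Omega\subset\mathbb R^d$ be a bounded open set (for instance a bounded polytopal Lipschitz domain) with a mesh $\mathcal T$: finitely many pairwise disjoint open convex polytopes $K\subset\Omega$ (for instance simplices, or quadrilaterals/hexahedra with planar facets) with $\overline\Omega=\bigcup_K\overline K$. Put $h_K=\operatorname{diam}K$. Call $\mathcal T$ $\kappa$-shape-regular if every $K$ contains a ball of radius $r_K>0$ with $h_K\le\kappa r_K$, and $h_K\le\kappa h_{K'}$ whenever $K,K'$ share a facet; every mesh is $\kappa$-shape-regular for some $\kappa$. The interior facet shared by $K_1\ne K_2$ is $e=\overline K_1\cap\overline K_2\cap\Omega$ (facets of zero surface measure play no role), $\mathcal E_{\rm int}$ is the union of the interior facets, and $n=n_{K_1}=-n_{K_2}$ is the unit normal of $e$ pointing from $K_1$ to $K_2$. On $e$ put $[\![w]\!]=w|_{K_1}n_{K_1}+w|_{K_2}n_{K_2}$, $[\![w]\!]_u=w|_{K_1}-w|_{K_2}$, $\{w\}=\frac12(w|_{K_1}+w|_{K_2})$; exchanging $K_1$ and $K_2$ (in particular, labelling the upwind element $K_1$) does not change any integrand below. The value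 of $h$ on $e$ is any fixed number between $h_{K_1}$ and $h_{K_2}$. Let $V_p$ be the space of functions that are polynomials of total degree at most $p$ on each $K$ and have vanishing trace on $\partial\Omega$. For $\psi\in W^{2,\infty}(\Omega)$ and $\sigma,\mu,\tau>0$ let $$a_h(w,v)=\sum_K\int_K\nabla w\cdot\nabla v-\int_{\mathcal E_{\rm int}}\Big([\![w]\!]\cdot\{\nabla v\}+[\![v]\!]\cdot\{\nabla w\}-\tfrac{\sigma}{h}[\![w]\!]\cdot[\![v]\!]\Big)ds,$$ $$b_h(w,v)=\sum_K\int_K w\nabla\psi\cdot\nabla v-\int_{\mathcal E_{\rm int}}\Big((\nabla\psi\cdot n)\{w\}[\![v]\!]_u-\tfrac\mu2|\nabla\psi\cdot n|[\![w]\!]_u[\![v]\!]_u\Big)ds,$$ $$\mathcal A_h(w,v)=(w,v)_{L^2(\Omega)}+\tau\big(a_h(w,v)+b_h(w,v)\big),\qquad \|w\|_{\rm sip}^2=\sum_K\|\nabla w\|_{L^2(K)}^2+\int_{\mathcal E_{\rm int}}\tfrac\sigma h|[\![w]\!]|^2\,ds .$$ Let $0\le u_0\in L^\infty(\Omega)$,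 let $\mathcal L_K\subset\overline K$ be finite sets of (Lagrange) nodes at which the values of a polynomial of total degree at most $p$ determine it, and let $$V_p^+=\{w\in V_p:\ 0\le w|_K(z)\le\|u_0\|_{L^\infty(\Omega)}\ \ \forall z\in\mathcal L_K,\ \forall K\in\mathcal T\}.$$ The constrained scheme: given a discrete initial value $(u_h^0)^+\in V_p$ (for instance the $L^2$ projection of $u_0$, or an approximation of it in $V_p^+$), for $n=1,\dots,N$ the function $(u_h^n)^+\in V_p^+$ satisfies $$\mathcal A_h\big((u_h^n)^+,v-(u_h^n)^+\big)\ \ge\ \big((u_h^{n-1})^+,v-(u_h^n)^+\big)_{L^2(\Omega)}\qquad\forall v\in V_p^+ .$$ **Lemma (Discrete stability, constrained scheme).** For all $1\le d\le3$, $p\ge0$ and $\kappa$ there are constants $\widehat\sigma>0$ and $C_{\rm sip}>0$, depending only on $d,p,\kappa$, such that for every such $\Omega$ with a $\kappa$-shape-regular mesh, every choice of the facet values of $h$ as above, and every $\sigma\ge\widehat\sigma$: (i) $a_h(w,w)\ge C_{\rm sip}\|w\|_{\rm sip}^2$ for all $w\in V_p$; (ii) for all $\mu,\tau>0$, $\psi\in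 W^{2,\infty}(\Omega)$, $0\le u_0\in L^\infty(\Omega)$, all nodes $\mathcal L_K$ as above and every solution $\big((u_h^n)^+\big)_{0\le n\le N}$ of the constrained scheme, for $n=1,\dots,N$, $$\tfrac12\|(u_h^n)^+\|_{L^2(\Omega)}^2\le\tfrac12\|(u_h^{n-1})^+\|_{L^2(\Omega)}^2-\tau C_{\rm sip}\|(u_h^n)^+\|_{\rm sip}^2-\tfrac{\tau\mu}2\big\||\nabla\psi\cdot n|^{1/2}[\![(u_h^n)^+]\!]_u\big\|_{L^2(\mathcal E_{\rm int})}^2-\tau\sum_K\Big(-\tfrac12\int_K\big((u_h^n)^+\big)^2\Delta\psi\,dx\Big);$$ moreover, if $\Delta\psi\le0$ almost everywhere in $\Omega$, then $\|(u_h^n)^+\|_{L^2(\Omega)}^2$ is non-increasing in $n\in\{0,\dots,N\}$. -/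

import Mathlib

open MeasureTheory Set
open scoped ContDiff

namespace DriftDiffusion

noncomputable section

/-- The Euclidean space `ℝ^d`. -/
abbrev Space (d : ℕ) : Type := EuclideanSpace ℝ (Fin d)

/-! ### Weak derivatives and the space `W^{2,∞}(Ω)` -/

/-- The classical partial derivative `∂ᵢ f`. -/
def pd {d : ℕ} (i : Fin d) (f : Space d → ℝ) (x : Space d) : ℝ :=
  fderiv ℝ f x (EuclideanSpace.single i 1)

/-- Test functions: `φ ∈ C_c^∞(Ω)`. -/
def IsTestFunction {d : ℕ} (Ω : Set (Space d)) (φ : Space d → ℝ) : Prop :=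
  ContDiff ℝ ∞ φ ∧ HasCompactSupport φ ∧ tsupport φ ⊆ Ω

/-- `g` is the weak partial derivative `∂ᵢ u` in `Ω`. -/
def HasWeakPartial {d : ℕ} (Ω : Set (Space d)) (i : Fin d) (u g : Space d → ℝ) : Prop :=
  ∀ φ, IsTestFunction Ω φ → ∫ x in Ω, u x * pd i φ x = -∫ x in Ω, g x * φ x

/-- `u ∈ L^∞(Ω)`. -/
def MemLInf {d : ℕ} (Ω : Set (Space d)) (u : Space d → ℝ) : Prop :=
  MemLp u ⊤ (volume.restrict Ω)

/-- `‖u‖_{L^∞(Ω)}`. -/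
def normLInf {d : ℕ} (Ω : Set (Space d)) (u : Space d → ℝ) : ℝ :=
  (eLpNorm u ⊤ (volume.restrict Ω)).toReal

/-- `u ∈ W^{2,∞}(Ω)`: `u` and its weak derivatives up to order two lie in `L^∞(Ω)`. -/
def MemW2Inf {d : ℕ} (Ω : Set (Space d)) (u : Space d → ℝ) : Prop :=
  MemLInf Ω u ∧ ∃ (g : Fin d → Space d → ℝ) (H : Fin d → Fin d → Space d → ℝ),
    (∀ i, MemLInf Ω (g i) ∧ HasWeakPartial Ω i u (g i)) ∧
    (∀ i j, MemLInf Ω (H i j) ∧ HasWeakPartial Ω j (g i) (H i j))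

/-- `G` is a representative of the weak gradient of `u` in `Ω` that is continuous on `Ω`. -/
def IsContinuousWeakGradient {d : ℕ} (Ω : Set (Space d)) (u : Space d → ℝ)
    (G : Space d → Space d) : Prop :=
  ContinuousOn G Ω ∧ ∀ i, HasWeakPartial Ω i u (fun x => G x i)

open Classical in
/-- `∇u` for `u ∈ W^{2,∞}(Ω)`: the continuous representative of the weak gradient, which is
unique on the open set `Ω`. Its point values give the traces of `∇u` on facets. -/
def weakGradient {d : ℕ} (Ω : Set (Space d)) (u : Space d → ℝ) : Space d → Space d :=
  if h : ∃ G, IsContinuousWeakGradient Ω u G then h.choose else 0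

/-- `L` is the weak (distributional) Laplacian of `u` in `Ω`. -/
def IsWeakLaplacian {d : ℕ} (Ω : Set (Space d)) (u L : Space d → ℝ) : Prop :=
  LocallyIntegrableOn L Ω ∧
    ∀ φ, IsTestFunction Ω φ → ∫ x in Ω, L x * φ x = ∫ x in Ω, u x * ∑ i, pd i (pd i φ) x

open Classical in
/-- `Δu`, the weak Laplacian (unique almost everywhere in the open set `Ω`). -/
def weakLaplacian {d : ℕ} (Ω : Set (Space d)) (u : Space d → ℝ) : Space d → ℝ :=
  if h : ∃ L, IsWeakLaplacian Ω u L then h.choose else 0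

/-! ### Meshes -/

/-- Open convex polytopes: nonempty bounded finite intersections of open half-spaces. Open
simplices, parallelepipeds, convex quadrilaterals and convex hexahedra with planar faces are
examples. -/
def IsOpenPolytope {d : ℕ} (K : Set (Space d)) : Prop :=
  K.Nonempty ∧ Bornology.IsBounded K ∧
    ∃ (k : ℕ) (a : Fin k → Space d) (b : Fin k → ℝ), K = {x | ∀ l, inner ℝ (a l) x < b l}

/-- A subdivision of `Ω` into `m` disjoint polytopic elements `T.K 0, …, T.K (m - 1)`. -/
structure Mesh (d : ℕ) (Ω : Set (Space d)) (m : ℕ) where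
  K : Fin m → Set (Space d)
  polytope : ∀ i, IsOpenPolytope (K i)
  subset : ∀ i, K i ⊆ Ω
  disjoint : ∀ i j, i ≠ j → Disjoint (K i) (K j)
  cover : closure Ω = ⋃ i, closure (K i)

/-- The `(d-1)`-dimensional surface measure (normalised Hausdorff measure; the counting measure
when `d = 1`). -/
def surf (d : ℕ) : Measure (Space d) := Measure.euclideanHausdorffMeasure (d - 1)

namespace Mesh

variable {d : ℕ} {Ω : Set (Space d)} {m : ℕ}

/-- `h_K = diam K`. -/
def h (T : Mesh d Ω m) (i : Fin m) : ℝ := Metric.diam (T.K i)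

/-- The interior facet shared by two distinct elements (a set of surface measure zero if the
elements do not share a facet). -/
def facet (T : Mesh d Ω m) (i j : Fin m) : Set (Space d) :=
  closure (T.K i) ∩ closure (T.K j) ∩ Ω

/-- Each unordered pair of distinct elements, listed once. The order fixes an orientation of the
facet; every integrand below is unchanged if the roles of the two elements are exchanged, so it
does not matter which of them is the upwind one. -/
def pairs (m : ℕ) : Finset (Fin m × Fin m) := Finset.univ.filter fun e => e.1 < e.2

open Classical in
/-- The unit normal of the facet shared by `K i` and `K j`, pointing from `K i` to `K j`: the unit
vector of a hyperplane separating the two elements, which is unique if they share a facet. -/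
def normal (T : Mesh d Ω m) (i j : Fin m) : Space d :=
  if hn : ∃ n : Space d, ‖n‖ = 1 ∧ ∀ x ∈ T.K i, ∀ y ∈ T.K j, inner ℝ n x < inner ℝ n y
  then hn.choose else 0

/-- `κ`-shape-regularity: each element contains a ball of radius comparable to its diameter, and
elements that share a facet have comparable diameters. -/
def ShapeRegular (T : Mesh d Ω m) (κ : ℝ) : Prop :=
  (∀ i, ∃ (c : Space d) (r : ℝ), 0 < r ∧ Metric.ball c r ⊆ T.K i ∧ T.h i ≤ κ * r) ∧
  ∀ i j, i ≠ j → 0 < surf d (T.facet i j) → T.h i ≤ κ * T.h j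

/-- Admissible values on the interior facets of the meshsize function `h`, which takes the two
values `h_{K i}` and `h_{K j}` on the two sides of a facet: anything between these two (such as
their minimum, maximum or average). -/
def IsFacetSize (T : Mesh d Ω m) (hE : Fin m → Fin m → ℝ) : Prop :=
  ∀ i j, hE i j ∈ uIcc (T.h i) (T.h j)

end Mesh

/-! ### Discontinuous finite element functions -/

/-- Piecewise polynomial functions on a mesh with `m` elements, given by one polynomial for each
element. The trace on a facet from inside the element `i` is then `eval x (w i)`. -/
abbrev PwPoly (d m : ℕ) : Type := Fin m → MvPolynomial (Fin d) ℝ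

/-- Value of a polynomial at a point. -/
def pval {d : ℕ} (q : MvPolynomial (Fin d) ℝ) (x : Space d) : ℝ :=
  MvPolynomial.eval (fun i => x i) q

/-- Gradient of a polynomial at a point. -/
def pgrad {d : ℕ} (q : MvPolynomial (Fin d) ℝ) (x : Space d) : Space d :=
  WithLp.toLp 2 fun i => pval (MvPolynomial.pderiv i q) x

section Discrete

variable {d : ℕ} {Ω : Set (Space d)} {m : ℕ}

/-- The function on `Ω` (defined off the mesh skeleton) given by a piecewise polynomial. -/
def toFun (T : Mesh d Ω m) (w : PwPoly d m) (x : Space d) : ℝ :=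
  ∑ i, (T.K i).indicator (pval (w i)) x

/-- The space `V_p`: polynomials of total degree at most `p` on each element, with vanishing trace
on the boundary of `Ω`. -/
def dgSpace (T : Mesh d Ω m) (p : ℕ) : Set (PwPoly d m) :=
  {w | ∀ i, (w i).totalDegree ≤ p ∧
    ∀ᵐ x ∂(surf d).restrict (frontier (T.K i) ∩ frontier Ω), pval (w i) x = 0}

/-- A choice of nodes for `P^p` on each element: finitely many points of the closed element such
that a polynomial of total degree at most `p` is determined by its values there. -/
def IsNodeFamily (T : Mesh d Ω m) (p : ℕ) (nodes : Fin m → Finset (Space d)) : Prop :=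
  ∀ i, (nodes i : Set (Space d)) ⊆ closure (T.K i) ∧
    ∀ q : MvPolynomial (Fin d) ℝ, q.totalDegree ≤ p → (∀ z ∈ nodes i, pval q z = 0) → q = 0

/-- The convex set `V_p^+` of functions in `V_p` whose nodal values lie in `[0, M]`. -/
def dgSpacePos (T : Mesh d Ω m) (p : ℕ) (nodes : Fin m → Finset (Space d)) (M : ℝ) :
    Set (PwPoly d m) :=
  {w | w ∈ dgSpace T p ∧ ∀ i, ∀ z ∈ nodes i, 0 ≤ pval (w i) z ∧ pval (w i) z ≤ M}

/-- The `L²(Ω)` inner product. -/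
def ip (T : Mesh d Ω m) (w v : PwPoly d m) : ℝ := ∫ x in Ω, toFun T w x * toFun T v x

/-- `‖w‖²` in `L²(Ω)`. -/
def normSq (T : Mesh d Ω m) (w : PwPoly d m) : ℝ := ∫ x in Ω, toFun T w x ^ 2

/-- Integral over the union of the interior facets of an integrand that may depend on the facet. -/
def intFacets (T : Mesh d Ω m) (F : Fin m × Fin m → Space d → ℝ) : ℝ :=
  ∑ e ∈ Mesh.pairs m, ∫ x in T.facet e.1 e.2, F e x ∂(surf d)

/-- The vector jump `⟦w⟧ = w|_{K₁} n_{K₁} + w|_{K₂} n_{K₂}`. -/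
def jump (T : Mesh d Ω m) (w : PwPoly d m) (e : Fin m × Fin m) (x : Space d) : Space d :=
  pval (w e.1) x • T.normal e.1 e.2 + pval (w e.2) x • (-T.normal e.1 e.2)

/-- The scalar jump `w|_{K₁} - w|_{K₂}`. -/
def ujump (w : PwPoly d m) (e : Fin m × Fin m) (x : Space d) : ℝ :=
  pval (w e.1) x - pval (w e.2) x

/-- The average `{w}`. -/
def avg (w : PwPoly d m) (e : Fin m × Fin m) (x : Space d) : ℝ :=
  (1 / 2) * (pval (w e.1) x + pval (w e.2) x)

/-- The average `{∇w}`. -/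
def avgGrad (w : PwPoly d m) (e : Fin m × Fin m) (x : Space d) : Space d :=
  (1 / 2 : ℝ) • (pgrad (w e.1) x + pgrad (w e.2) x)

/-- The symmetric interior penalty form `a_h`. -/
def aForm (T : Mesh d Ω m) (hE : Fin m → Fin m → ℝ) (σ : ℝ) (w v : PwPoly d m) : ℝ :=
  (∑ i, ∫ x in T.K i, inner ℝ (pgrad (w i) x) (pgrad (v i) x)) -
    intFacets T fun e x =>
      inner ℝ (jump T w e x) (avgGrad v e x) + inner ℝ (jump T v e x) (avgGrad w e x) -
        σ / hE e.1 e.2 * inner ℝ (jump T w e x) (jump T v e x)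

/-- The normal derivative `∇ψ · n` on an interior facet. -/
def gradNormal (T : Mesh d Ω m) (ψ : Space d → ℝ) (e : Fin m × Fin m) (x : Space d) : ℝ :=
  inner ℝ (weakGradient Ω ψ x) (T.normal e.1 e.2)

/-- The upwind form `b_h`. -/
def bForm (T : Mesh d Ω m) (μ : ℝ) (ψ : Space d → ℝ) (w v : PwPoly d m) : ℝ :=
  (∑ i, ∫ x in T.K i, inner ℝ (pval (w i) x • weakGradient Ω ψ x) (pgrad (v i) x)) -
    intFacets T fun e x =>
      gradNormal T ψ e x * avg w e x * ujump v e x -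
        μ / 2 * |gradNormal T ψ e x| * ujump w e x * ujump v e x

/-- The form `A_h = (·,·) + τ (a_h + b_h)`. -/
def AForm (T : Mesh d Ω m) (hE : Fin m → Fin m → ℝ) (σ μ τ : ℝ) (ψ : Space d → ℝ)
    (w v : PwPoly d m) : ℝ :=
  ip T w v + τ * (aForm T hE σ w v + bForm T μ ψ w v)

/-- `‖w‖_sip²`. -/
def sipNormSq (T : Mesh d Ω m) (hE : Fin m → Fin m → ℝ) (σ : ℝ) (w : PwPoly d m) : ℝ :=
  (∑ i, ∫ x in T.K i, ‖pgrad (w i) x‖ ^ 2) +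
    intFacets T fun e x => σ / hE e.1 e.2 * ‖jump T w e x‖ ^ 2

/-- The squared `L²` norm over the interior facets of `|∇ψ · n|^{1/2}` times the scalar jump. -/
def upwindNormSq (T : Mesh d Ω m) (ψ : Space d → ℝ) (w : PwPoly d m) : ℝ :=
  intFacets T fun e x => (Real.sqrt |gradNormal T ψ e x| * ujump w e x) ^ 2

/-- `u 0, …, u N` solves the constrained scheme with nodal bounds `0` and `M`: from a discrete
initial value `u 0 ∈ V_p`, a variational inequality over `V_p^+` is solved at each time step. -/
def IsConstrainedSolution (T : Mesh d Ω m) (p : ℕ) (hE : Fin m → Fin m → ℝ) (σ μ τ : ℝ)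
    (ψ : Space d → ℝ) (nodes : Fin m → Finset (Space d)) (M : ℝ) (N : ℕ)
    (u : ℕ → PwPoly d m) : Prop :=
  u 0 ∈ dgSpace T p ∧ ∀ n, 1 ≤ n → n ≤ N →
    u n ∈ dgSpacePos T p nodes M ∧
      ∀ v ∈ dgSpacePos T p nodes M,
        AForm T hE σ μ τ ψ (u n) (v - u n) ≥ ip T (u (n - 1)) (v - u n)

end Discrete

end

end DriftDiffusion

/-! The energy estimate comes from testing the variational inequality with `v = 0`, which is
admissible because the upper nodal bound is nonnegative. It gives A_h(u^n, u^n) ≤ (u^{n-1}, u^n),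
and Young's inequality bounds the right side by half the sum of the two squared norms. What remains
is a lower bound for a_h(w, w) and an exact formula for b_h(w, w).

For a_h (`exists_coercivity`), Young's inequality absorbs half of the penalty and leaves h/σ times
squared traces of gradients. The trace inequality `exists_trace_inequality_grad` turns these into
A²C/σ times the volume term, which is at most one half of it for large σ; hence the constant 1/2.
Elements are arbitrary convex polytopes, so no reference element is available. Instead, the supremum
of a polynomial on K is bounded by its mean square on the inscribed ball (equivalence of norms in
finite dimension, and scaling), and the surface area of K is at most d|K|/r, by the divergence
theorem for x - c.

For b_h (`bForm_self`), w∇w = ∇(w²/2), so the divergence theorem on each element produces -½∫w²Δψ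
and facet terms. The two sides of a facet together give the jump of w²/2 times ∇ψ·n, and this jump
is {w}⟦w⟧_u: it cancels the centred flux and only the upwind penalty survives. Boundary terms on ∂Ω
vanish with the trace of w.

The analytic core is therefore a divergence theorem (`integral_cell_divergence`) for a field that is
continuous only in the open set Ω, bounded, and has a bounded weak divergence. The weak identity is
tested with f times a smooth cut-off that is a product of ramps in the distances to the bounding
hyperplanes. As the layer width tends to 0, the derivative of each ramp concentrates on its face.
The rest is geometry: up to sets of surface measure zero, the part of ∂K inside Ω is the disjoint
union of the interior facets of K. -/

namespace DriftDiffusion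

open Module Filter Topology

/-! ### Hyperplanes, surface measure and slicing -/

/-- The hyperplane `{x | ⟪a, x⟫ = b}`, for `p = (a, b)`. -/
def hyperplane {d : ℕ} (p : Space d × ℝ) : Set (Space d) := {x | inner ℝ p.1 x = p.2}

/-- The open half-space `{x | ⟪a, x⟫ < b}`, for `p = (a, b)`. -/
def halfspace {d : ℕ} (p : Space d × ℝ) : Set (Space d) := {x | inner ℝ p.1 x < p.2}

theorem isClosed_hyperplane {d : ℕ} (p : Space d × ℝ) : IsClosed (hyperplane p) :=
  isClosed_eq (by fun_prop) continuous_const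

theorem isOpen_halfspace {d : ℕ} (p : Space d × ℝ) : IsOpen (halfspace p) :=
  isOpen_lt (by fun_prop) continuous_const

/-- Parametrisation of the hyperplane `p` by the orthogonal complement of its normal. -/
noncomputable def hyperplaneMap {d : ℕ} (p : Space d × ℝ) (y : (ℝ ∙ p.1)ᗮ) : Space d :=
  p.2 • p.1 + y

theorem isometry_hyperplaneMap {d : ℕ} (p : Space d × ℝ) : Isometry (hyperplaneMap p) := by
  refine Isometry.of_dist_eq fun x y => ?_
  simp [hyperplaneMap, Subtype.dist_eq]

theorem inner_orthogonal_span {d : ℕ} {a : Space d} (y : (ℝ ∙ a)ᗮ) : inner ℝ a (y : Space d) = 0 :=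
  Submodule.mem_orthogonal_singleton_iff_inner_right.1 y.2

theorem inner_smul_add_orthogonal {d : ℕ} {a : Space d} (ha : ‖a‖ = 1) (t : ℝ) (y : (ℝ ∙ a)ᗮ) :
    inner ℝ a (t • a + (y : Space d)) = t := by
  rw [inner_add_right, inner_smul_right, inner_orthogonal_span, real_inner_self_eq_norm_sq, ha]
  ring

theorem range_hyperplaneMap {d : ℕ} {p : Space d × ℝ} (hp : ‖p.1‖ = 1) :
    range (hyperplaneMap p) = hyperplane p := by
  ext x
  constructor
  · rintro ⟨y, rfl⟩
    exact inner_smul_add_orthogonal hp _ y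
  · intro hx
    refine ⟨⟨x - p.2 • p.1, ?_⟩, by simp [hyperplaneMap]⟩
    rw [Submodule.mem_orthogonal_singleton_iff_inner_right, inner_sub_right, inner_smul_right,
      real_inner_self_eq_norm_sq, hp, show inner ℝ p.1 x = p.2 from hx]
    ring

theorem finrank_orthogonal_span {d : ℕ} {a : Space d} (ha : ‖a‖ = 1) :
    finrank ℝ (ℝ ∙ a)ᗮ = d - 1 := by
  have h := (ℝ ∙ a).finrank_add_finrank_orthogonal
  rw [finrank_span_singleton (by rintro rfl; simp at ha), finrank_euclideanSpace_fin] at h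
  omega

/-- Isometries preserve Hausdorff measure, and on the (d-1)-dimensional space of parameters the
normalised Hausdorff measure is Lebesgue measure. Surface integrals over hyperplanes thus become
ordinary integrals. -/
theorem map_hyperplaneMap {d : ℕ} {p : Space d × ℝ} (hp : ‖p.1‖ = 1) :
    (volume : Measure (ℝ ∙ p.1)ᗮ).map (hyperplaneMap p) = (surf d).restrict (hyperplane p) := by
  rw [← InnerProductSpace.euclideanHausdorffMeasure_eq_volume, finrank_orthogonal_span hp,
    (isometry_hyperplaneMap p).map_euclideanHausdorffMeasure, range_hyperplaneMap hp, surf]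

theorem measurableEmbedding_hyperplaneMap {d : ℕ} (p : Space d × ℝ) :
    MeasurableEmbedding (hyperplaneMap p) :=
  (isometry_hyperplaneMap p).isClosedEmbedding.measurableEmbedding

theorem setIntegral_hyperplane {d : ℕ} {p : Space d × ℝ} (hp : ‖p.1‖ = 1) (f : Space d → ℝ) :
    ∫ x in hyperplane p, f x ∂(surf d) = ∫ y, f (hyperplaneMap p y) := by
  rw [← map_hyperplaneMap hp, (measurableEmbedding_hyperplaneMap p).integral_map]

theorem surf_inter_hyperplane {d : ℕ} {p : Space d × ℝ} (hp : ‖p.1‖ = 1) {s : Set (Space d)}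
    (hs : MeasurableSet s) :
    surf d (s ∩ hyperplane p) = volume (hyperplaneMap p ⁻¹' s) := by
  rw [← Measure.restrict_apply hs, ← map_hyperplaneMap hp,
    Measure.map_apply (isometry_hyperplaneMap p).continuous.measurable hs]

theorem surf_lt_top_of_subset_hyperplane {d : ℕ} {p : Space d × ℝ} (hp : ‖p.1‖ = 1)
    {s : Set (Space d)} (hs : s ⊆ hyperplane p) (hb : Bornology.IsBounded s) :
    surf d s < ⊤ := by
  have h1 : surf d (closure s ∩ hyperplane p) < ⊤ := by
    rw [surf_inter_hyperplane hp isClosed_closure.measurableSet]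
    have hb' : Bornology.IsBounded (hyperplaneMap p ⁻¹' closure s) :=
      (isometry_hyperplaneMap p).antilipschitz.isBounded_preimage hb.closure
    exact hb'.measure_lt_top
  exact (measure_mono (subset_inter subset_closure hs)).trans_lt h1

/-- Two distinct hyperplanes meet in a set of surface measure zero. -/
theorem surf_hyperplane_inter_eq_zero {d : ℕ} {p q : Space d × ℝ} (hp : ‖p.1‖ = 1)
    (hq : ‖q.1‖ = 1) (h1 : q ≠ p) (h2 : q ≠ -p) :
    surf d (hyperplane q ∩ hyperplane p) = 0 := by
  rw [surf_inter_hyperplane hp (isClosed_hyperplane q).measurableSet]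
  by_cases hne : (hyperplaneMap p ⁻¹' hyperplane q).Nonempty
  swap
  · rw [not_nonempty_iff_eq_empty.1 hne, measure_empty]
  obtain ⟨y₀, hy₀⟩ := hne
  -- In the parameters of `p`, the intersection is an affine subspace with direction `S`, hence null
  -- unless `S` is everything. In that case `q.1` annihilates the complement of `p.1`, so it is
  -- `±p.1`, and the common point `y₀` fixes the offset.
  let S : Submodule ℝ (ℝ ∙ p.1)ᗮ :=
    LinearMap.ker ((innerSL ℝ q.1).toLinearMap ∘ₗ (ℝ ∙ p.1)ᗮ.subtype)
  have hS : hyperplaneMap p ⁻¹' hyperplane q =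
      (AffineSubspace.mk' y₀ S : Set (ℝ ∙ p.1)ᗮ) := by
    ext y
    have hy₀' : inner ℝ q.1 (p.2 • p.1 + (y₀ : Space d)) = q.2 := hy₀
    simp only [mem_preimage, hyperplane, mem_ofPred_eq, hyperplaneMap, SetLike.mem_coe,
      AffineSubspace.mem_mk', S, LinearMap.mem_ker, vsub_eq_sub]
    rw [← hy₀']
    simp [inner_add_right, inner_sub_right, sub_eq_zero]
  rw [hS]
  refine Measure.addHaar_affineSubspace _ _ fun htop => ?_
  have hStop : S = ⊤ := by
    have := congrArg AffineSubspace.direction htop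
    simpa using this
  have horth : ∀ y : Space d, inner ℝ p.1 y = 0 → inner ℝ q.1 y = 0 := by
    intro y hy
    have : (⟨y, Submodule.mem_orthogonal_singleton_iff_inner_right.2 hy⟩ : (ℝ ∙ p.1)ᗮ) ∈ S := by
      rw [hStop]; trivial
    simpa [S] using this
  set c := inner ℝ p.1 q.1 with hc
  have hz : inner ℝ q.1 (q.1 - c • p.1) = 0 := by
    apply horth
    rw [inner_sub_right, inner_smul_right, real_inner_self_eq_norm_sq, hp]
    simp [hc]
  have hz' : inner ℝ p.1 (q.1 - c • p.1) = 0 := by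
    rw [inner_sub_right, inner_smul_right, real_inner_self_eq_norm_sq, hp]
    simp [hc]
  have hqp : q.1 = c • p.1 := by
    rw [← sub_eq_zero, ← inner_self_eq_zero (𝕜 := ℝ)]
    rw [inner_sub_left, inner_smul_left, hz, hz']
    simp
  have hcabs : |c| = 1 := by
    have := congrArg norm hqp
    rw [norm_smul, hp, hq, Real.norm_eq_abs, mul_one] at this
    exact this.symm
  have hb : q.2 = c * p.2 := by
    have : inner ℝ q.1 (p.2 • p.1 + (y₀ : Space d)) = q.2 := hy₀
    rw [← this, hqp, inner_smul_left, inner_smul_add_orthogonal hp]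
    simp
  rcases (abs_eq zero_le_one).1 hcabs with h | h
  · exact h1 (Prod.ext (by rw [hqp, h, one_smul]) (by rw [hb, h, one_mul]))
  · exact h2 (Prod.ext (by rw [hqp, h]; simp) (by rw [hb, h]; simp))

/-- Orthogonal coordinates along and across the unit vector `a`. -/
theorem measurePreserving_smul_add_orthogonal {d : ℕ} {a : Space d} (ha : ‖a‖ = 1) :
    MeasurePreserving (fun z : ℝ × (ℝ ∙ a)ᗮ => z.1 • a + (z.2 : Space d)) := by
  have h1 : MeasurePreserving (Prod.map (LinearIsometryEquiv.toSpanUnitSingleton (𝕜 := ℝ) a ha)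
      (id : (ℝ ∙ a)ᗮ → (ℝ ∙ a)ᗮ)) :=
    (LinearIsometryEquiv.measurePreserving _).prod (MeasurePreserving.id _)
  have h2 := ((ℝ ∙ a).measurePreserving_measurableEquivProd (0 : Space d)).symm
  rw [InnerProductSpace.euclideanHausdorffMeasure_eq_volume] at h2
  have h3 := h2.comp h1
  convert h3 using 1
  ext z : 1
  simp [Submodule.measurableEquivProd]

theorem measurableEmbedding_smul_add_orthogonal {d : ℕ} {a : Space d} (ha : ‖a‖ = 1) :
    MeasurableEmbedding (fun z : ℝ × (ℝ ∙ a)ᗮ => z.1 • a + (z.2 : Space d)) := by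
  refine Continuous.measurableEmbedding (by fun_prop) fun z w h => ?_
  have h' : z.1 • a + (z.2 : Space d) = w.1 • a + (w.2 : Space d) := h
  have h1 : z.1 = w.1 := by
    rw [← inner_smul_add_orthogonal ha z.1 z.2, h', inner_smul_add_orthogonal ha]
  refine Prod.ext h1 (Subtype.ext ?_)
  rw [h1] at h'
  exact add_left_cancel h'

/-- Integration in layers parallel to a hyperplane, in rescaled distance from it. -/
theorem integral_eq_slices {d : ℕ} {p : Space d × ℝ} (hp : ‖p.1‖ = 1) {ε : ℝ} (hε : 0 < ε)
    (f : Space d → ℝ) :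
    ∫ x, f x = ε * ∫ z : ℝ × (ℝ ∙ p.1)ᗮ, f (hyperplaneMap p z.2 - (ε * z.1) • p.1) := by
  have h1 := (measurePreserving_smul_add_orthogonal hp).integral_comp
    (measurableEmbedding_smul_add_orthogonal hp) f
  -- The layer variable `s` is the signed distance from the hyperplane, measured against its normal
  -- in units of `ε`.
  have hmap : (volume : Measure ℝ).map (fun s : ℝ => p.2 - ε * s) = ENNReal.ofReal ε⁻¹ • volume := by
    have : (fun s : ℝ => p.2 - ε * s) = (fun s => p.2 + s) ∘ fun s => (-ε) * s := by
      ext s; simp; ring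
    rw [this, ← Measure.map_map (by fun_prop) (by fun_prop), Real.map_volume_mul_left (by simpa using hε.ne'),
      Measure.map_smul, map_add_left_eq_self]
    rw [inv_neg, abs_neg, abs_of_pos (inv_pos.2 hε)]
  have hmap2 : (volume : Measure (ℝ × (ℝ ∙ p.1)ᗮ)).map (Prod.map (fun s : ℝ => p.2 - ε * s) id) =
      ENNReal.ofReal ε⁻¹ • volume := by
    rw [Measure.volume_eq_prod, ← Measure.map_prod_map _ _ (by fun_prop) (by fun_prop), hmap,
      Measure.map_id, Measure.prod_smul_left]
  have hemb : MeasurableEmbedding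
      (Prod.map (fun s : ℝ => p.2 - ε * s) (id : (ℝ ∙ p.1)ᗮ → (ℝ ∙ p.1)ᗮ)) := by
    refine Continuous.measurableEmbedding (by fun_prop) ?_
    refine Function.Injective.prodMap (fun s t h => ?_) Function.injective_id
    have : ε * s = ε * t := by simpa using h
    exact mul_left_cancel₀ hε.ne' this
  have h2 := hemb.integral_map (μ := volume)
    (fun z : ℝ × (ℝ ∙ p.1)ᗮ => f (z.1 • p.1 + (z.2 : Space d)))
  rw [hmap2, integral_smul_measure, h1, ENNReal.toReal_ofReal (inv_pos.2 hε).le] at h2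
  have h3 : ∫ x, f x = ε * (ε⁻¹ • ∫ x, f x) := by
    rw [smul_eq_mul, mul_inv_cancel_left₀ hε.ne']
  rw [h3, h2]
  congr 2
  ext z
  congr 1
  simp only [Prod.map_fst, Prod.map_snd, id, hyperplaneMap, sub_smul]
  abel

/-! ### The divergence theorem on a polyhedron by smooth cut-offs -/

/-- The open polyhedron cut out by finitely many open half-spaces. -/
def cell {d : ℕ} (s : Finset (Space d × ℝ)) : Set (Space d) := {x | ∀ p ∈ s, inner ℝ p.1 x < p.2}

theorem isOpen_cell {d : ℕ} (s : Finset (Space d × ℝ)) : IsOpen (cell s) := by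
  have : cell s = ⋂ p ∈ s, halfspace p := by ext; simp [cell, halfspace]
  rw [this]
  exact isOpen_biInter_finset fun p _ => isOpen_halfspace p

theorem convex_cell {d : ℕ} (s : Finset (Space d × ℝ)) : Convex ℝ (cell s) := by
  have : cell s = ⋂ p ∈ s, halfspace p := by ext; simp [cell, halfspace]
  rw [this]
  exact convex_iInter₂ fun p _ => convex_halfSpace_lt (innerSL ℝ p.1).isLinear p.2

theorem inner_le_of_mem_closure_cell {d : ℕ} {s : Finset (Space d × ℝ)} {x : Space d}
    (hx : x ∈ closure (cell s)) {p : Space d × ℝ} (hp : p ∈ s) : inner ℝ p.1 x ≤ p.2 := by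
  have hc : IsClosed {x : Space d | inner ℝ p.1 x ≤ p.2} :=
    isClosed_le (by fun_prop) continuous_const
  exact closure_minimal (fun y hy => (hy p hp).le) hc hx

/-- A smooth ramp from `0` on `(-∞, 1]` to `1` on `[2, ∞)`. -/
noncomputable def ramp (t : ℝ) : ℝ := Real.smoothTransition (t - 1)

theorem contDiff_ramp : ContDiff ℝ ∞ ramp :=
  Real.smoothTransition.contDiff.comp (contDiff_id.sub contDiff_const)

theorem ramp_of_le {t : ℝ} (h : t ≤ 1) : ramp t = 0 :=
  Real.smoothTransition.zero_of_nonpos (by linarith)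

theorem ramp_of_ge {t : ℝ} (h : 2 ≤ t) : ramp t = 1 :=
  Real.smoothTransition.one_of_one_le (by linarith)

theorem ramp_nonneg (t : ℝ) : 0 ≤ ramp t := Real.smoothTransition.nonneg _

theorem ramp_le_one (t : ℝ) : ramp t ≤ 1 := Real.smoothTransition.le_one _

theorem continuous_deriv_ramp : Continuous (deriv ramp) :=
  contDiff_ramp.continuous_deriv (by simp)

theorem deriv_ramp_of_notMem {t : ℝ} (h : t ∉ Icc (1 : ℝ) 2) : deriv ramp t = 0 := by
  rcases lt_or_ge t 1 with h1 | h1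
  · have : ramp =ᶠ[𝓝 t] fun _ => 0 := by
      filter_upwards [Iio_mem_nhds h1] with u hu using ramp_of_le (le_of_lt hu)
    rw [this.deriv_eq]; simp
  · have h2 : 2 < t := by
      by_contra h2
      exact h ⟨h1, not_lt.1 h2⟩
    have : ramp =ᶠ[𝓝 t] fun _ => 1 := by
      filter_upwards [Ioi_mem_nhds h2] with u hu using ramp_of_ge (le_of_lt hu)
    rw [this.deriv_eq]; simp

theorem integrable_deriv_ramp : Integrable (deriv ramp) :=
  continuous_deriv_ramp.integrable_of_hasCompactSupport
    (HasCompactSupport.of_support_subset_isCompact isCompact_Icc fun _ ht => by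
      by_contra h
      exact ht (deriv_ramp_of_notMem h))

theorem integral_deriv_ramp : ∫ t, deriv ramp t = 1 := by
  have h := integral_of_hasDerivAt_of_tendsto (f := ramp) (f' := deriv ramp) (m := 0) (n := 1)
    (fun t => (contDiff_ramp.differentiable (by simp) t).hasDerivAt) integrable_deriv_ramp
    (tendsto_const_nhds.congr' (by
      filter_upwards [eventually_le_atBot (1 : ℝ)] with t ht using (ramp_of_le ht).symm))
    (tendsto_const_nhds.congr' (by
      filter_upwards [eventually_ge_atTop (2 : ℝ)] with t ht using (ramp_of_ge ht).symm))
  simpa using h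

/-- A smooth cut-off function for the polyhedron `cell s`, equal to `1` at distance `2 ε` from all
the bounding hyperplanes and vanishing at distance `ε` from any of them. -/
noncomputable def cutoff {d : ℕ} (s : Finset (Space d × ℝ)) (ε : ℝ) (x : Space d) : ℝ :=
  ∏ p ∈ s, ramp ((p.2 - inner ℝ p.1 x) / ε)

theorem contDiff_cutoff {d : ℕ} (s : Finset (Space d × ℝ)) (ε : ℝ) : ContDiff ℝ ∞ (cutoff s ε) := by
  refine contDiff_prod fun p _ => contDiff_ramp.comp ?_
  exact (contDiff_const.sub (innerSL ℝ p.1).contDiff).div_const _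

theorem cutoff_nonneg {d : ℕ} (s : Finset (Space d × ℝ)) (ε : ℝ) (x : Space d) : 0 ≤ cutoff s ε x :=
  Finset.prod_nonneg fun _ _ => ramp_nonneg _

theorem cutoff_le_one {d : ℕ} (s : Finset (Space d × ℝ)) (ε : ℝ) (x : Space d) : cutoff s ε x ≤ 1 :=
  Finset.prod_le_one (fun _ _ => ramp_nonneg _) fun _ _ => ramp_le_one _

/-- Because the ramp stays zero up to 1 rather than 0, the support keeps a margin `ε` from every
hyperplane, so even the closed support lies in the open cell. -/
theorem tsupport_cutoff_subset {d : ℕ} (s : Finset (Space d × ℝ)) {ε : ℝ} (hε : 0 < ε) :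
    tsupport (cutoff s ε) ⊆ cell s := by
  have hc : IsClosed {x : Space d | ∀ p ∈ s, inner ℝ p.1 x ≤ p.2 - ε} := by
    simp only [ofPred_forall]
    exact isClosed_biInter fun p _ => isClosed_le (by fun_prop) continuous_const
  refine (closure_minimal (fun x hx p hp => ?_) hc).trans fun x hx p hp => ?_
  · by_contra h
    refine hx (Finset.prod_eq_zero hp (ramp_of_le ?_))
    rw [div_le_one hε]
    linarith [not_le.1 h]
  · linarith [hx p hp]

/-- The product rule splits the derivative into one boundary layer per bounding hyperplane, each
scaled by `ε⁻¹`; the minus sign is there because the ramps grow inwards while the normals point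
outwards. -/
theorem fderiv_cutoff {d : ℕ} (s : Finset (Space d × ℝ)) (ε : ℝ) (x v : Space d) :
    fderiv ℝ (cutoff s ε) x v = -∑ p ∈ s, ε⁻¹ * (deriv ramp ((p.2 - inner ℝ p.1 x) / ε) *
      (∏ q ∈ s.erase p, ramp ((q.2 - inner ℝ q.1 x) / ε)) * inner ℝ p.1 v) := by
  have h1 : ∀ p ∈ s, HasFDerivAt (fun x : Space d => ramp ((p.2 - inner ℝ p.1 x) / ε))
      (deriv ramp ((p.2 - inner ℝ p.1 x) / ε) • (ε⁻¹ • (-(innerSL ℝ p.1)))) x := by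
    intro p _
    have hr := (contDiff_ramp.differentiable (by simp) ((p.2 - inner ℝ p.1 x) / ε)).hasDerivAt
    refine HasDerivAt.comp_hasFDerivAt (h₂ := ramp) x hr ?_
    have := ((innerSL ℝ p.1).hasFDerivAt (x := x)).const_sub p.2
    simpa [div_eq_inv_mul] using this.const_mul ε⁻¹
  have h2 : HasFDerivAt (cutoff s ε) _ x := HasFDerivAt.finsetProd h1
  rw [h2.fderiv, ← Finset.sum_neg_distrib]
  simp only [_root_.sum_apply, _root_.smul_apply,
    _root_.neg_apply, innerSL_apply_apply, smul_eq_mul]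
  refine Finset.sum_congr rfl fun p _ => ?_
  ring

theorem isTestFunction_mul_cutoff {d : ℕ} {s : Finset (Space d × ℝ)}
    (hb : Bornology.IsBounded (cell s)) {f : Space d → ℝ} (hf : ContDiff ℝ ∞ f) {ε : ℝ}
    (hε : 0 < ε) : IsTestFunction (cell s) (fun x => f x * cutoff s ε x) := by
  have hs : tsupport (fun x => f x * cutoff s ε x) ⊆ tsupport (cutoff s ε) :=
    closure_mono (fun x hx h => hx (by simp [h]))
  refine ⟨hf.mul (contDiff_cutoff s ε), ?_, hs.trans (tsupport_cutoff_subset s hε)⟩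
  exact Metric.isCompact_of_isClosed_isBounded (isClosed_tsupport _)
    (hb.subset (hs.trans (tsupport_cutoff_subset s hε)))

theorem tendsto_cutoff {d : ℕ} {s : Finset (Space d × ℝ)} {x : Space d} (hx : x ∈ cell s) :
    Tendsto (fun ε => cutoff s ε x) (𝓝[>] 0) (𝓝 1) := by
  have : Tendsto (fun ε => cutoff s ε x) (𝓝[>] 0) (𝓝 (∏ p ∈ s, 1)) := by
    refine tendsto_finsetProd _ fun p hp => tendsto_const_nhds.congr' ?_
    have hpos : 0 < (p.2 - inner ℝ p.1 x) / 2 := by linarith [hx p hp]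
    filter_upwards [Ioo_mem_nhdsGT hpos] with ε hε
    refine (ramp_of_ge ?_).symm
    rw [le_div_iff₀ hε.1]
    linarith [hε.2]
  simpa using this

/-- Along the inner normal direction of a bounding hyperplane, the integrand of the boundary layer
converges to the integrand of the boundary integral. -/
theorem tendsto_boundary_layer {d : ℕ} {s : Finset (Space d × ℝ)} (hs : ∀ p ∈ s, ‖p.1‖ = 1)
    {Ω : Set (Space d)} (hΩ : IsOpen Ω) {G : Space d → Space d} (hG : ContinuousOn G Ω) {M : ℝ}
    (hM : ∀ x ∈ cell s, ‖G x‖ ≤ M) {f : Space d → ℝ} (hf : Continuous f) {p : Space d × ℝ}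
    (hp : p ∈ s) {z : Space d} (hz : z ∈ hyperplane p)
    (hz' : ∀ q ∈ s, q ≠ p → z ∉ hyperplane q) (hfz : z ∈ closure (cell s) → z ∉ Ω → f z = 0)
    {t : ℝ} (ht : 0 < t) :
    Tendsto (fun ε => (∏ q ∈ s.erase p, ramp ((q.2 - inner ℝ q.1 (z - (ε * t) • p.1)) / ε)) *
      (cell s).indicator (fun x => f x * inner ℝ p.1 (G x)) (z - (ε * t) • p.1)) (𝓝[>] 0)
      (𝓝 ((closure (cell s) ∩ hyperplane p ∩ Ω).indicator (fun x => f x * inner ℝ p.1 (G x)) z)) := by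
  have hlim : Tendsto (fun ε : ℝ => z - (ε * t) • p.1) (𝓝[>] 0) (𝓝 z) := by
    have : Continuous (fun ε : ℝ => z - (ε * t) • p.1) := by fun_prop
    have h := (this.tendsto 0).mono_left (nhdsWithin_le_nhds (s := Ioi 0))
    simpa using h
  -- As `z` is on no other bounding hyperplane, it is either in the relative interior of the face or
  -- strictly outside some other half-space. In the second case the layer integrand is eventually
  -- zero.
  by_cases hin : ∀ q ∈ s, q ≠ p → inner ℝ q.1 z < q.2
  · have hcell : ∀ᶠ ε in 𝓝[>] (0 : ℝ), z - (ε * t) • p.1 ∈ cell s := by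
      have h1 : ∀ᶠ ε in 𝓝[>] (0 : ℝ), ∀ q ∈ s.erase p,
          inner ℝ q.1 (z - (ε * t) • p.1) < q.2 := by
        rw [Filter.eventually_all_finset]
        intro q hq
        exact hlim.eventually ((isOpen_halfspace q).mem_nhds
          (hin q (Finset.mem_of_mem_erase hq) (Finset.ne_of_mem_erase hq)))
      filter_upwards [h1, self_mem_nhdsWithin] with ε h1 hε q hq
      by_cases hqp : q = p
      · subst hqp
        rw [inner_sub_right, inner_smul_right, real_inner_self_eq_norm_sq, hs q hq,
          show inner ℝ q.1 z = q.2 from hz]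
        have : 0 < ε * t := mul_pos hε ht
        linarith
      · exact h1 q (Finset.mem_erase.2 ⟨hqp, hq⟩)
    have hzc : z ∈ closure (cell s) := mem_closure_of_tendsto hlim hcell
    have hprod : Tendsto (fun ε => ∏ q ∈ s.erase p,
        ramp ((q.2 - inner ℝ q.1 (z - (ε * t) • p.1)) / ε)) (𝓝[>] 0) (𝓝 1) := by
      have : Tendsto (fun ε => ∏ q ∈ s.erase p,
          ramp ((q.2 - inner ℝ q.1 (z - (ε * t) • p.1)) / ε)) (𝓝[>] 0)
          (𝓝 (∏ q ∈ s.erase p, 1)) := by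
        refine tendsto_finsetProd _ fun q hq => tendsto_const_nhds.congr' ?_
        have hq' := hin q (Finset.mem_of_mem_erase hq) (Finset.ne_of_mem_erase hq)
        -- Near `z` at least half of the gap to `q` remains, and `ε` below a quarter of the gap puts
        -- the argument of the ramp beyond 2.
        have hpos : 0 < (q.2 - inner ℝ q.1 z) / 4 := by linarith
        have hop : IsOpen {x : Space d | inner ℝ q.1 x < (q.2 + inner ℝ q.1 z) / 2} :=
          isOpen_lt (by fun_prop) continuous_const
        filter_upwards [Ioo_mem_nhdsGT hpos, hlim.eventually (hop.mem_nhds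
          (show inner ℝ q.1 z < (q.2 + inner ℝ q.1 z) / 2 by linarith))] with ε hε h2
        have h2' : inner ℝ q.1 (z - (ε * t) • p.1) < (q.2 + inner ℝ q.1 z) / 2 := h2
        refine (ramp_of_ge ?_).symm
        rw [le_div_iff₀ hε.1]
        linarith [hε.2]
      simpa using this
    have hind : Tendsto (fun ε => (cell s).indicator (fun x => f x * inner ℝ p.1 (G x))
        (z - (ε * t) • p.1)) (𝓝[>] 0) (𝓝 ((closure (cell s) ∩ hyperplane p ∩ Ω).indicator
          (fun x => f x * inner ℝ p.1 (G x)) z)) := by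
      have heq : (fun ε => f (z - (ε * t) • p.1) * inner ℝ p.1 (G (z - (ε * t) • p.1)))
          =ᶠ[𝓝[>] 0] (fun ε => (cell s).indicator (fun x => f x * inner ℝ p.1 (G x))
            (z - (ε * t) • p.1)) := by
        filter_upwards [hcell] with ε hε
        rw [indicator_of_mem hε]
      refine Tendsto.congr' heq ?_
      -- Outside `Ω` the field has no limit at `z`; the bound `M` and the vanishing of `f` at `z`
      -- replace continuity.
      by_cases hzΩ : z ∈ Ω
      · rw [indicator_of_mem (show z ∈ closure (cell s) ∩ hyperplane p ∩ Ω from ⟨⟨hzc, hz⟩, hzΩ⟩)]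
        have hGz : ContinuousAt G z := hG.continuousAt (hΩ.mem_nhds hzΩ)
        have : ContinuousAt (fun x => f x * inner ℝ p.1 (G x)) z :=
          hf.continuousAt.mul (continuousAt_const.inner hGz)
        exact this.tendsto.comp hlim
      · rw [indicator_of_notMem (fun h => hzΩ h.2)]
        have hf0 : Tendsto (fun ε => |f (z - (ε * t) • p.1)| * M) (𝓝[>] 0) (𝓝 0) := by
          have := ((hf.abs.tendsto z).comp hlim).mul_const M
          simpa [hfz hzc hzΩ] using this
        refine squeeze_zero_norm' ?_ hf0
        filter_upwards [hcell] with ε hε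
        rw [norm_mul, Real.norm_eq_abs]
        refine mul_le_mul_of_nonneg_left ?_ (abs_nonneg _)
        refine (norm_inner_le_norm _ _).trans ?_
        rw [hs p hp, one_mul]
        exact hM _ hε
    simpa using hprod.mul hind
  · push Not at hin
    obtain ⟨q, hq, hqp, hqz⟩ := hin
    have hlt : q.2 < inner ℝ q.1 z :=
      lt_of_le_of_ne hqz (fun h => hz' q hq hqp h.symm)
    rw [indicator_of_notMem (fun h =>
      absurd (inner_le_of_mem_closure_cell h.1.1 hq) (not_le.2 hlt))]
    refine tendsto_const_nhds.congr' ?_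
    have hop : IsOpen {x : Space d | q.2 < inner ℝ q.1 x} :=
      isOpen_lt continuous_const (by fun_prop)
    filter_upwards [hlim.eventually (hop.mem_nhds hlt)] with ε hε
    rw [indicator_of_notMem, mul_zero]
    exact fun h => absurd (h q hq) (not_lt.2 (le_of_lt hε))

/-- Nothing is known about the field outside `Ω`; extension by zero makes the layer integrand
measurable on the whole space. -/
theorem measurable_indicator_of_continuousOn {d : ℕ} {K : Set (Space d)} (hK : IsOpen K)
    {g : Space d → ℝ} (hg : ContinuousOn g K) : Measurable (K.indicator g) := by
  classical
  have := hg.measurable_piecewise (g := 0) continuousOn_const hK.measurableSet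
  rwa [piecewise_eq_indicator] at this

/-- The boundary layer at the hyperplane `p` concentrates on the corresponding facet. -/
theorem tendsto_integral_boundary_layer {d : ℕ} {s : Finset (Space d × ℝ)}
    (hs : ∀ p ∈ s, ‖p.1‖ = 1) (hb : Bornology.IsBounded (cell s)) (hne : (cell s).Nonempty)
    {Ω : Set (Space d)} (hΩ : IsOpen Ω) (hK : cell s ⊆ Ω) {G : Space d → Space d}
    (hG : ContinuousOn G Ω) {M : ℝ} (hM : ∀ x ∈ cell s, ‖G x‖ ≤ M) {f : Space d → ℝ}
    (hf : Continuous f) {p : Space d × ℝ} (hp : p ∈ s)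
    (h0 : ∀ᵐ x ∂(surf d).restrict ((closure (cell s) ∩ hyperplane p) \ Ω), f x = 0) :
    Tendsto (fun ε => ∫ x in cell s, f x * (ε⁻¹ * (deriv ramp ((p.2 - inner ℝ p.1 x) / ε) *
        (∏ q ∈ s.erase p, ramp ((q.2 - inner ℝ q.1 x) / ε)) * inner ℝ p.1 (G x)))) (𝓝[>] 0)
      (𝓝 (∫ x in closure (cell s) ∩ hyperplane p ∩ Ω, f x * inner ℝ p.1 (G x) ∂(surf d))) := by
  have hp1 := hs p hp
  set g : Space d → ℝ := (cell s).indicator fun x => f x * inner ℝ p.1 (G x) with hg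
  set g₀ : Space d → ℝ := (closure (cell s) ∩ hyperplane p ∩ Ω).indicator
    fun x => f x * inner ℝ p.1 (G x) with hg₀
  have hgmeas : Measurable g := measurable_indicator_of_continuousOn (isOpen_cell s)
    (hf.continuousOn.mul (continuousOn_const.inner (hG.mono hK)))
  obtain ⟨Cf, hCf⟩ : ∃ C, ∀ x ∈ closure (cell s), ‖f x‖ ≤ C :=
    (Metric.isCompact_of_isClosed_isBounded isClosed_closure hb.closure).exists_bound_of_continuousOn
      hf.continuousOn
  obtain ⟨R, hR⟩ := hb.exists_norm_le
  have hgb : ∀ x, |g x| ≤ Cf * M := by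
    intro x
    by_cases hx : x ∈ cell s
    · rw [hg, indicator_of_mem hx, abs_mul]
      refine mul_le_mul (hCf x (subset_closure hx)) ?_ (abs_nonneg _)
        ((norm_nonneg _).trans (hCf x (subset_closure hx)))
      refine (abs_real_inner_le_norm _ _).trans ?_
      rw [hp1, one_mul]
      exact hM x hx
    · obtain ⟨y, hy⟩ := hne
      rw [hg, indicator_of_notMem hx, abs_zero]
      exact mul_nonneg ((norm_nonneg _).trans (hCf y (subset_closure hy)))
        ((norm_nonneg _).trans (hM y hy))
  have hCM : 0 ≤ Cf * M := (abs_nonneg _).trans (hgb 0)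
  -- the integral in layers
  have hslice : ∀ ε : ℝ, 0 < ε →
      ∫ x in cell s, f x * (ε⁻¹ * (deriv ramp ((p.2 - inner ℝ p.1 x) / ε) *
        (∏ q ∈ s.erase p, ramp ((q.2 - inner ℝ q.1 x) / ε)) * inner ℝ p.1 (G x))) =
      ∫ z : ℝ × (ℝ ∙ p.1)ᗮ, deriv ramp z.1 * ((∏ q ∈ s.erase p, ramp ((q.2 -
        inner ℝ q.1 (hyperplaneMap p z.2 - (ε * z.1) • p.1)) / ε)) *
          g (hyperplaneMap p z.2 - (ε * z.1) • p.1)) := by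
    intro ε hε
    have h1 : ∫ x in cell s, f x * (ε⁻¹ * (deriv ramp ((p.2 - inner ℝ p.1 x) / ε) *
        (∏ q ∈ s.erase p, ramp ((q.2 - inner ℝ q.1 x) / ε)) * inner ℝ p.1 (G x))) =
        ∫ x, ε⁻¹ * (deriv ramp ((p.2 - inner ℝ p.1 x) / ε) *
        ((∏ q ∈ s.erase p, ramp ((q.2 - inner ℝ q.1 x) / ε)) * g x)) := by
      rw [← integral_indicator (isOpen_cell s).measurableSet]
      congr 1
      ext x
      by_cases hx : x ∈ cell s
      · rw [indicator_of_mem hx, hg, indicator_of_mem hx]; ring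
      · rw [indicator_of_notMem hx, hg, indicator_of_notMem hx]; ring
    rw [h1, integral_const_mul, integral_eq_slices hp1 hε, inv_mul_cancel_left₀ hε.ne']
    congr 1
    ext z
    congr 2
    rw [inner_sub_right, inner_smul_right, real_inner_self_eq_norm_sq, hp1, hyperplaneMap,
      inner_smul_add_orthogonal hp1]
    field_simp
    ring
  -- the limit in layers
  have hlimval : ∫ x in closure (cell s) ∩ hyperplane p ∩ Ω, f x * inner ℝ p.1 (G x) ∂(surf d) =
      ∫ z : ℝ × (ℝ ∙ p.1)ᗮ, deriv ramp z.1 * g₀ (hyperplaneMap p z.2) := by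
    rw [Measure.volume_eq_prod, integral_prod_mul (f := deriv ramp)
      (g := fun y => g₀ (hyperplaneMap p y)), integral_deriv_ramp, one_mul,
      ← setIntegral_hyperplane hp1, hg₀,
      setIntegral_indicator ((isClosed_closure.inter (isClosed_hyperplane p)).measurableSet.inter
        hΩ.measurableSet)]
    congr 2
    ext x; simp; tauto
  rw [hlimval]
  refine Tendsto.congr' (f₁ := fun ε : ℝ => ∫ z : ℝ × (ℝ ∙ p.1)ᗮ, deriv ramp z.1 *
    ((∏ q ∈ s.erase p, ramp ((q.2 - inner ℝ q.1 (hyperplaneMap p z.2 - (ε * z.1) • p.1)) / ε)) *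
          g (hyperplaneMap p z.2 - (ε * z.1) • p.1))) ?_ ?_
  · filter_upwards [self_mem_nhdsWithin] with ε hε using (hslice ε hε).symm
  -- The dominating function exists because `deriv ramp` lives on [1, 2] and, for `ε < 1`, points of
  -- the bounded cell have tangential coordinate of norm at most `R + |p.2| + 2`.
  refine tendsto_integral_filter_of_dominated_convergence
    (fun z => |deriv ramp z.1| * (Metric.closedBall (0 : (ℝ ∙ p.1)ᗮ) (R + |p.2| + 2)).indicator
      (fun _ => Cf * M) z.2) ?_ ?_ ?_ ?_
  · refine Eventually.of_forall fun ε => Measurable.aestronglyMeasurable ?_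
    have hpt : Measurable fun z : ℝ × (ℝ ∙ p.1)ᗮ =>
        hyperplaneMap p z.2 - (ε * z.1) • p.1 := by
      have := (isometry_hyperplaneMap p).continuous
      exact Continuous.measurable (by fun_prop)
    refine (continuous_deriv_ramp.measurable.comp measurable_fst).mul
      (Measurable.mul ?_ (hgmeas.comp hpt))
    refine Finset.measurable_fun_prod _ fun q _ => contDiff_ramp.continuous.measurable.comp ?_
    exact (measurable_const.sub
      ((by fun_prop : Continuous fun x : Space d => inner ℝ q.1 x).measurable.comp hpt)).div_const _
  · filter_upwards [Ioo_mem_nhdsGT one_pos] with ε hε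
    refine Eventually.of_forall fun z => ?_
    rw [norm_mul, Real.norm_eq_abs, Real.norm_eq_abs]
    by_cases hz1 : z.1 ∈ Icc (1 : ℝ) 2
    swap
    · rw [deriv_ramp_of_notMem hz1]; simp
    refine mul_le_mul_of_nonneg_left ?_ (abs_nonneg _)
    by_cases hx : hyperplaneMap p z.2 - (ε * z.1) • p.1 ∈ cell s
    · have hy : z.2 ∈ Metric.closedBall (0 : (ℝ ∙ p.1)ᗮ) (R + |p.2| + 2) := by
        rw [mem_closedBall_zero_iff]
        have h3 : (z.2 : Space d) =
            (hyperplaneMap p z.2 - (ε * z.1) • p.1) - p.2 • p.1 + (ε * z.1) • p.1 := by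
          simp only [hyperplaneMap]; abel
        have h4 : ‖(z.2 : Space d)‖ ≤ R + |p.2| + 2 := by
          rw [h3]
          refine (norm_add_le _ _).trans (add_le_add ((norm_sub_le _ _).trans
            (add_le_add (hR _ hx) ?_)) ?_)
          · rw [norm_smul, hp1, mul_one, Real.norm_eq_abs]
          · rw [norm_smul, hp1, mul_one, Real.norm_eq_abs, abs_of_nonneg
              (mul_nonneg hε.1.le (by linarith [hz1.1]))]
            nlinarith [hε.1, hε.2, hz1.1, hz1.2]
        exact h4
      rw [indicator_of_mem hy, abs_mul]
      refine (mul_le_of_le_one_left (abs_nonneg _) ?_).trans (hgb _)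
      rw [abs_of_nonneg (Finset.prod_nonneg fun _ _ => ramp_nonneg _)]
      exact Finset.prod_le_one (fun _ _ => ramp_nonneg _) fun _ _ => ramp_le_one _
    · have : g (hyperplaneMap p z.2 - (ε * z.1) • p.1) = 0 := indicator_of_notMem hx _
      rw [this, mul_zero, abs_zero]
      exact indicator_nonneg (fun _ _ => hCM) _
  · rw [Measure.volume_eq_prod]
    refine Integrable.mul_prod (f := fun t => |deriv ramp t|) integrable_deriv_ramp.abs
      ((integrable_indicator_iff measurableSet_closedBall).2 ?_)
    exact integrableOn_const (measure_closedBall_lt_top.ne)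
  -- Almost every point of the hyperplane avoids all the others, since distinct hyperplanes meet in
  -- null sets; `-p` cannot occur in `s` because the cell is nonempty.
  · have h1 : ∀ᵐ y : (ℝ ∙ p.1)ᗮ, ∀ q ∈ s, q ≠ p → hyperplaneMap p y ∉ hyperplane q := by
      rw [Filter.eventually_all_finset]
      intro q hq
      by_cases hqp : q = p
      · exact Eventually.of_forall fun y h => absurd hqp h
      have hqp' : q ≠ -p := by
        rintro rfl
        obtain ⟨y, hy⟩ := hne
        have h1 := hy p hp
        have h2 := hy (-p) hq
        simp only [Prod.fst_neg, Prod.snd_neg, inner_neg_left] at h2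
        linarith
      have := surf_hyperplane_inter_eq_zero hp1 (hs q hq) hqp hqp'
      rw [surf_inter_hyperplane hp1 (isClosed_hyperplane q).measurableSet] at this
      filter_upwards [measure_eq_zero_iff_ae_notMem.1 this] with y hy _ using hy
    have h2 : ∀ᵐ y : (ℝ ∙ p.1)ᗮ, hyperplaneMap p y ∈ closure (cell s) → hyperplaneMap p y ∉ Ω →
        f (hyperplaneMap p y) = 0 := by
      rw [ae_restrict_iff' ((isClosed_closure.inter (isClosed_hyperplane p)).measurableSet.diff
        hΩ.measurableSet)] at h0
      have h3 := ae_restrict_of_ae (s := hyperplane p) h0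
      rw [← map_hyperplaneMap hp1, (measurableEmbedding_hyperplaneMap p).ae_map_iff] at h3
      filter_upwards [h3] with y hy hy1 hy2
      refine hy ⟨⟨hy1, ?_⟩, hy2⟩
      rw [← range_hyperplaneMap hp1]; exact mem_range_self y
    rw [Measure.volume_eq_prod]
    filter_upwards [(Measure.quasiMeasurePreserving_snd (μ := (volume : Measure ℝ))
      (ν := (volume : Measure (ℝ ∙ p.1)ᗮ))).ae (h1.and h2)] with z hz
    by_cases hz1 : z.1 ∈ Icc (1 : ℝ) 2
    swap
    · rw [deriv_ramp_of_notMem hz1]; simp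
    refine Tendsto.const_mul _ ?_
    refine tendsto_boundary_layer hs hΩ hG hM hf hp ?_ hz.1 hz.2 (by linarith [hz1.1])
    rw [← range_hyperplaneMap hp1]; exact mem_range_self _

/-- The divergence theorem on a bounded polyhedron `K ⊆ Ω`, for a vector field that is continuous
in `Ω`, bounded on `K` and has a weak divergence, and a smooth factor vanishing on `∂K \ Ω`. -/
theorem integral_cell_divergence {d : ℕ} {s : Finset (Space d × ℝ)}
    (hs : ∀ p ∈ s, ‖p.1‖ = 1) (hb : Bornology.IsBounded (cell s)) (hne : (cell s).Nonempty)
    {Ω : Set (Space d)} (hΩ : IsOpen Ω) (hK : cell s ⊆ Ω) {G : Space d → Space d}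
    (hG : ContinuousOn G Ω) {M : ℝ} (hM : ∀ x ∈ cell s, ‖G x‖ ≤ M) {L : Space d → ℝ}
    (hL : IntegrableOn L (cell s))
    (hdiv : ∀ φ, IsTestFunction (cell s) φ → ∫ x in cell s, (fderiv ℝ φ x (G x) + L x * φ x) = 0)
    {f : Space d → ℝ} (hf : ContDiff ℝ ∞ f)
    (h0 : ∀ p ∈ s, ∀ᵐ x ∂(surf d).restrict ((closure (cell s) ∩ hyperplane p) \ Ω), f x = 0) :
    ∫ x in cell s, (fderiv ℝ f x (G x) + L x * f x) =
      ∑ p ∈ s, ∫ x in closure (cell s) ∩ hyperplane p ∩ Ω, f x * inner ℝ p.1 (G x) ∂(surf d) := by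
  have hKm := (isOpen_cell s).measurableSet
  have hcpt : IsCompact (closure (cell s)) :=
    Metric.isCompact_of_isClosed_isBounded isClosed_closure hb.closure
  have hfin : volume (cell s) < ⊤ := hb.measure_lt_top
  have hGK := hG.mono hK
  have hint : ∀ g : Space d → ℝ, ContinuousOn g (cell s) → ∀ C : ℝ, (∀ x ∈ cell s, |g x| ≤ C) →
      IntegrableOn g (cell s) := fun g hg C hC =>
    IntegrableOn.of_bound hfin (hg.aestronglyMeasurable hKm) C
      ((ae_restrict_iff' hKm).2 (Eventually.of_forall hC))
  obtain ⟨Cf, hCf⟩ := hcpt.exists_bound_of_continuousOn hf.continuous.continuousOn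
  have hf' := hf.continuous_fderiv (by simp)
  obtain ⟨Cd, hCd⟩ := hcpt.exists_bound_of_continuousOn hf'.continuousOn
  have hCf0 : 0 ≤ Cf := by
    obtain ⟨y, hy⟩ := hne
    exact (norm_nonneg _).trans (hCf y (subset_closure hy))
  have hCd0 : 0 ≤ Cd := by
    obtain ⟨y, hy⟩ := hne
    exact (norm_nonneg _).trans (hCd y (subset_closure hy))
  have hfG : IntegrableOn (fun x => fderiv ℝ f x (G x)) (cell s) := by
    refine hint _ (hf'.continuousOn.clm_apply hGK) (Cd * M) fun x hx => ?_
    exact ((fderiv ℝ f x).le_opNorm _).trans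
      (mul_le_mul (hCd x (subset_closure hx)) (hM x hx) (norm_nonneg _) hCd0)
  have hLf : IntegrableOn (fun x => L x * f x) (cell s) :=
    hL.mul_bdd (c := Cf) (hf.continuous.continuousOn.aestronglyMeasurable hKm)
      ((ae_restrict_iff' hKm).2 (Eventually.of_forall fun x hx => hCf x (subset_closure hx)))
  have hF : IntegrableOn (fun x => fderiv ℝ f x (G x) + L x * f x) (cell s) := hfG.add hLf
  -- limit of the volume terms
  have hA : Tendsto (fun ε => ∫ x in cell s, cutoff s ε x * (fderiv ℝ f x (G x) + L x * f x))
      (𝓝[>] 0) (𝓝 (∫ x in cell s, (fderiv ℝ f x (G x) + L x * f x))) := by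
    refine tendsto_integral_filter_of_dominated_convergence
      (fun x => ‖fderiv ℝ f x (G x) + L x * f x‖) ?_ ?_ hF.norm ?_
    · exact Eventually.of_forall fun ε =>
        ((contDiff_cutoff s ε).continuous.aestronglyMeasurable).mul hF.aestronglyMeasurable
    · refine Eventually.of_forall fun ε => Eventually.of_forall fun x => ?_
      rw [norm_mul, Real.norm_eq_abs, abs_of_nonneg (cutoff_nonneg s ε x)]
      exact mul_le_of_le_one_left (norm_nonneg _) (cutoff_le_one s ε x)
    · refine (ae_restrict_iff' hKm).2 (Eventually.of_forall fun x hx => ?_)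
      simpa using (tendsto_cutoff hx).mul_const (fderiv ℝ f x (G x) + L x * f x)
  have hB := tendsto_finsetSum s fun p hp =>
    tendsto_integral_boundary_layer hs hb hne hΩ hK hG hM hf.continuous hp (h0 p hp)
  refine tendsto_nhds_unique (hA.congr' ?_) hB
  filter_upwards [self_mem_nhdsWithin] with ε hε
  have hε' : (0 : ℝ) < ε := hε
  have hterm : ∀ p ∈ s, IntegrableOn (fun x => f x * (ε⁻¹ *
      (deriv ramp ((p.2 - inner ℝ p.1 x) / ε) *
        (∏ q ∈ s.erase p, ramp ((q.2 - inner ℝ q.1 x) / ε)) * inner ℝ p.1 (G x)))) (cell s) := by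
    intro p hp
    have hc : Continuous fun x : Space d => f x * (ε⁻¹ *
      (deriv ramp ((p.2 - inner ℝ p.1 x) / ε) *
        (∏ q ∈ s.erase p, ramp ((q.2 - inner ℝ q.1 x) / ε)))) := by
      have h1 := hf.continuous
      have h2 := continuous_deriv_ramp
      have h3 := contDiff_ramp.continuous
      fun_prop
    obtain ⟨C, hC⟩ := hcpt.exists_bound_of_continuousOn hc.continuousOn
    have := hint (fun x => (f x * (ε⁻¹ * (deriv ramp ((p.2 - inner ℝ p.1 x) / ε) *
        (∏ q ∈ s.erase p, ramp ((q.2 - inner ℝ q.1 x) / ε))))) * inner ℝ p.1 (G x))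
      (hc.continuousOn.mul (continuousOn_const.inner hGK)) (C * M) fun x hx => by
        rw [abs_mul]
        refine mul_le_mul (hC x (subset_closure hx)) ?_ (abs_nonneg _)
          ((norm_nonneg _).trans (hC x (subset_closure hx)))
        refine (abs_real_inner_le_norm _ _).trans ?_
        rw [hs p hp, one_mul]
        exact hM x hx
    refine this.congr_fun (fun x _ => ?_) hKm
    ring
  -- For each fixed `ε`, testing the weak divergence with `f * cutoff s ε` says exactly that the
  -- cut-off volume term equals the sum of the boundary layers.
  have htest := hdiv _ (isTestFunction_mul_cutoff hb hf hε')
  rw [← integral_finsetSum s hterm, ← sub_eq_zero, ← integral_sub _ (integrable_finsetSum s hterm),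
    ← htest]
  · refine setIntegral_congr_fun hKm fun x _ => ?_
    have hfd : fderiv ℝ (fun x => f x * cutoff s ε x) x =
        f x • fderiv ℝ (cutoff s ε) x + cutoff s ε x • fderiv ℝ f x :=
      fderiv_fun_mul (hf.differentiable (by simp) x)
        ((contDiff_cutoff s ε).differentiable (by simp) x)
    simp only [hfd, _root_.add_apply, _root_.smul_apply, smul_eq_mul, fderiv_cutoff]
    rw [← Finset.mul_sum]
    ring
  · exact hF.bdd_mul (c := 1) ((contDiff_cutoff s ε).continuous.aestronglyMeasurable)
      (Eventually.of_forall fun x => by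
        rw [Real.norm_eq_abs, abs_of_nonneg (cutoff_nonneg s ε x)]; exact cutoff_le_one s ε x)

/-- Every open polytope is the intersection of finitely many half-spaces with unit normals. -/
theorem IsOpenPolytope.exists_cell {d : ℕ} {K : Set (Space d)} (hK : IsOpenPolytope K) :
    ∃ s : Finset (Space d × ℝ), (∀ p ∈ s, ‖p.1‖ = 1) ∧ K = cell s := by
  classical
  obtain ⟨⟨x₀, hx₀⟩, -, k, a, b, rfl⟩ := hK
  refine ⟨(Finset.univ.filter fun l => a l ≠ 0).image
    fun l => (‖a l‖⁻¹ • a l, ‖a l‖⁻¹ * b l), ?_, ?_⟩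
  · intro p hp
    simp only [Finset.mem_image, Finset.mem_filter, Finset.mem_univ, true_and] at hp
    obtain ⟨l, hl, rfl⟩ := hp
    rw [norm_smul, norm_inv, norm_norm, inv_mul_cancel₀ (norm_ne_zero_iff.2 hl)]
  · ext x
    simp only [cell, Finset.mem_image, Finset.mem_filter, Finset.mem_univ, true_and, mem_ofPred_eq]
    have key : ∀ l, a l ≠ 0 → (inner ℝ (‖a l‖⁻¹ • a l) x < ‖a l‖⁻¹ * b l ↔ inner ℝ (a l) x < b l) := by
      intro l hl
      rw [real_inner_smul_left]
      exact mul_lt_mul_iff_right₀ (inv_pos.2 (norm_pos_iff.2 hl))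
    constructor
    · rintro hx p ⟨l, hl, rfl⟩
      exact (key l hl).2 (hx l)
    · intro hx l
      -- A zero normal gives the constraint `0 < b l`, which holds because the polytope has a point;
      -- it could be dropped.
      by_cases hl : a l = 0
      · have := hx₀ l
        simpa [hl] using this
      · exact (key l hl).1 (hx _ ⟨l, hl, rfl⟩)

/-! ### Weak derivatives: continuous gradient and bounded Laplacian of ψ -/

theorem IsTestFunction.mono {d : ℕ} {Ω Ω' : Set (Space d)} (h : Ω ⊆ Ω') {φ : Space d → ℝ}
    (hφ : IsTestFunction Ω φ) : IsTestFunction Ω' φ :=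
  ⟨hφ.1, hφ.2.1, hφ.2.2.trans h⟩

theorem IsTestFunction.pd {d : ℕ} {Ω : Set (Space d)} {φ : Space d → ℝ} (hφ : IsTestFunction Ω φ)
    (i : Fin d) : IsTestFunction Ω (pd i φ) := by
  have h1 : tsupport (DriftDiffusion.pd i φ) ⊆ tsupport φ := by
    refine (closure_mono ?_).trans (tsupport_fderiv_subset ℝ (f := φ))
    intro x hx h
    exact hx (by simp [DriftDiffusion.pd, h])
  refine ⟨?_, ?_, h1.trans hφ.2.2⟩
  · exact (hφ.1.fderiv_right (m := ∞) (by simp)).clm_apply contDiff_const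
  · exact hφ.2.1.mono' (subset_closure.trans h1)

theorem fderiv_apply_eq_sum_pd {d : ℕ} (φ : Space d → ℝ) (x v : Space d) :
    fderiv ℝ φ x v = ∑ i, v i * pd i φ x := by
  conv_lhs => rw [← (EuclideanSpace.basisFun (Fin d) ℝ).sum_repr v]
  simp [pd]

theorem setIntegral_mul_test {d : ℕ} {Ω : Set (Space d)} {φ : Space d → ℝ}
    (hφ : IsTestFunction Ω φ) (f : Space d → ℝ) :
    ∫ x in Ω, f x * φ x = ∫ x, f x * φ x := by
  refine setIntegral_eq_integral_of_forall_compl_eq_zero fun x hx => ?_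
  rw [image_eq_zero_of_notMem_tsupport fun h => hx (hφ.2.2 h), mul_zero]

theorem MemLInf.locallyIntegrableOn {d : ℕ} {Ω : Set (Space d)} {u : Space d → ℝ}
    (hu : MemLInf Ω u) : LocallyIntegrableOn u Ω :=
  locallyIntegrableOn_of_locallyIntegrable_restrict (MemLp.locallyIntegrable hu le_top)

theorem integrableOn_mul_test {d : ℕ} {Ω : Set (Space d)} {f φ : Space d → ℝ}
    (hf : LocallyIntegrableOn f Ω) (hφ : IsTestFunction Ω φ) :
    IntegrableOn (fun x => f x * φ x) Ω := by
  have h1 : IntegrableOn f (tsupport φ) := hf.integrableOn_compact_subset hφ.2.2 hφ.2.1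
  obtain ⟨C, hC⟩ := hφ.1.continuous.bounded_above_of_compact_support hφ.2.1
  have h2 : IntegrableOn (fun x => f x * φ x) (tsupport φ) :=
    h1.mul_bdd (c := C) hφ.1.continuous.aestronglyMeasurable (Eventually.of_forall hC)
  rw [integrableOn_iff_integrable_of_support_subset] at h2
  · exact h2.integrableOn
  · intro x hx
    by_contra h
    exact hx (by simp [image_eq_zero_of_notMem_tsupport h])

/-- The fundamental lemma of the calculus of variations. It identifies the chosen gradient and
Laplacian almost everywhere with the bounded derivatives provided by `MemW2Inf`. -/
theorem ae_eq_of_integral_test_eq {d : ℕ} {Ω : Set (Space d)} (hΩ : IsOpen Ω) {f g : Space d → ℝ}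
    (hf : LocallyIntegrableOn f Ω) (hg : LocallyIntegrableOn g Ω)
    (h : ∀ φ, IsTestFunction Ω φ → ∫ x in Ω, f x * φ x = ∫ x in Ω, g x * φ x) :
    ∀ᵐ x ∂(volume.restrict Ω), f x = g x := by
  have := hΩ.ae_eq_zero_of_integral_contDiff_smul_eq_zero (μ := volume) (hf.sub hg) fun φ h1 h2 h3 => by
    have hφ : IsTestFunction Ω φ := ⟨h1, h2, h3⟩
    have h4 := h φ hφ
    rw [← sub_eq_zero, ← integral_sub (integrableOn_mul_test hf hφ) (integrableOn_mul_test hg hφ)] at h4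
    rw [← h4, ← setIntegral_eq_integral_of_forall_compl_eq_zero (s := Ω)]
    · refine integral_congr_ae (Eventually.of_forall fun x => ?_)
      simp only [smul_eq_mul, Pi.sub_apply]
      ring
    · intro x hx
      rw [image_eq_zero_of_notMem_tsupport fun h => hx (h3 h), zero_smul]
  rw [ae_restrict_iff' hΩ.measurableSet]
  filter_upwards [this] with x hx hxΩ
  exact sub_eq_zero.1 (hx hxΩ)

theorem HasWeakPartial.congr_ae {d : ℕ} {Ω : Set (Space d)} {i : Fin d} {u u' g g' : Space d → ℝ}
    (h : HasWeakPartial Ω i u g) (hu : ∀ᵐ x ∂(volume.restrict Ω), u' x = u x)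
    (hg : ∀ᵐ x ∂(volume.restrict Ω), g' x = g x) : HasWeakPartial Ω i u' g' := by
  intro φ hφ
  have h1 : ∫ x in Ω, u' x * pd i φ x = ∫ x in Ω, u x * pd i φ x :=
    integral_congr_ae (by filter_upwards [hu] with x hx using by rw [hx])
  have h2 : ∫ x in Ω, g' x * φ x = ∫ x in Ω, g x * φ x :=
    integral_congr_ae (by filter_upwards [hg] with x hx using by rw [hx])
  rw [h1, h2, h φ hφ]

theorem MemLInf.exists_bound {d : ℕ} {Ω : Set (Space d)} {u : Space d → ℝ} (hu : MemLInf Ω u) :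
    ∃ M : ℝ, 0 ≤ M ∧ ∀ᵐ x ∂(volume.restrict Ω), |u x| ≤ M := by
  refine ⟨(eLpNormEssSup u (volume.restrict Ω)).toReal, ENNReal.toReal_nonneg, ?_⟩
  have hfin : eLpNormEssSup u (volume.restrict Ω) ≠ ⊤ := by
    have := hu.2.ne
    rwa [eLpNorm_exponent_top] at this
  filter_upwards [ae_le_eLpNormEssSup (f := u) (μ := volume.restrict Ω)] with x hx
  have := ENNReal.toReal_mono hfin hx
  simpa using this

/-- Mollification with a bump function supported in a small ball: the gradient of the mollified
function is bounded by the bounds of the weak derivatives. -/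
theorem norm_fderiv_mollify_le {d : ℕ} {Ω : Set (Space d)} (hΩ : IsOpen Ω) {g : Space d → ℝ}
    (hg : MemLInf Ω g) {H : Fin d → Space d → ℝ} (hgH : ∀ j, HasWeakPartial Ω j g (H j)) {M : ℝ}
    (hM : ∀ j, ∀ᵐ x ∂(volume.restrict Ω), |H j x| ≤ M) (φ : ContDiffBump (0 : Space d))
    {x : Space d} (hx : Metric.closedBall x φ.rOut ⊆ Ω) :
    ∃ D : Space d →L[ℝ] ℝ, ‖D‖ ≤ d * M ∧ HasFDerivAt
      (convolution (φ.normed volume) (Ω.indicator g) (ContinuousLinearMap.lsmul ℝ ℝ) volume) D x := by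
  have hli : LocallyIntegrable (Ω.indicator g) :=
    ((memLp_indicator_iff_restrict hΩ.measurableSet).2 hg).locallyIntegrable le_top
  have hφs : ContDiff ℝ ∞ (φ.normed volume) := φ.contDiff_normed
  have hφ1 : ContDiff ℝ 1 (φ.normed volume) := φ.contDiff_normed
  have hφc : HasCompactSupport (φ.normed volume) := φ.hasCompactSupport_normed
  have hD := HasCompactSupport.hasFDerivAt_convolution_left (ContinuousLinearMap.lsmul ℝ ℝ)
    hφc hφ1 hli x
  refine ⟨_, ?_, hD⟩
  -- The translated, reflected kernel is itself a test function in `Ω`. Each partial derivative of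
  -- the mollification is therefore an average of `H j` with nonnegative weight `η` of mass one, and
  -- inherits the bound `M`.
  set η : Space d → ℝ := fun y => φ.normed volume (x - y) with hη
  have hηsm : ContDiff ℝ ∞ η := hφs.comp (contDiff_const.sub contDiff_id)
  have hηs : tsupport η ⊆ Metric.closedBall x φ.rOut := by
    refine closure_minimal (fun y hy => ?_) Metric.isClosed_closedBall
    have : x - y ∈ Function.support (φ.normed volume) := hy
    rw [φ.support_normed_eq, mem_ball_zero_iff] at this
    rw [Metric.mem_closedBall, dist_comm, dist_eq_norm]
    exact this.le
  have hηt : IsTestFunction Ω η :=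
    ⟨hηsm, (isCompact_closedBall x φ.rOut).of_isClosed_subset (isClosed_tsupport _) hηs,
      hηs.trans hx⟩
  have hηint : ∫ y, η y = 1 := by
    rw [hη, integral_sub_left_eq_self (fun y => φ.normed volume y) volume x]
    exact φ.integral_normed
  have hη0 : ∀ y, 0 ≤ η y := fun y => φ.nonneg_normed _
  have hηi : Integrable η := hηsm.continuous.integrable_of_hasCompactSupport hηt.2.1
  have hcoord : ∀ j, |(convolution (fderiv ℝ (φ.normed volume)) (Ω.indicator g)
      ((ContinuousLinearMap.lsmul ℝ ℝ).precompL (Space d)) volume x)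
        (EuclideanSpace.single j 1)| ≤ M := by
    intro j
    have h1 : (convolution (fderiv ℝ (φ.normed volume)) (Ω.indicator g)
      ((ContinuousLinearMap.lsmul ℝ ℝ).precompL (Space d)) volume x)
        (EuclideanSpace.single j 1) = -∫ y in Ω, g y * pd j η y := by
      have hex : Integrable (fun t => (((ContinuousLinearMap.lsmul ℝ ℝ).precompL (Space d))
          (fderiv ℝ (φ.normed volume) (x - t))) (Ω.indicator g t)) := by
        have := (hφc.fderiv ℝ).convolutionExists_left
          ((ContinuousLinearMap.lsmul ℝ ℝ).precompL (Space d))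
          (hφ1.continuous_fderiv one_ne_zero) hli x
        exact this.integrable_swap
      rw [convolution_eq_swap, ContinuousLinearMap.integral_apply hex, ← integral_neg,
        ← integral_indicator hΩ.measurableSet]
      congr 1
      ext y
      have hpd : pd j η y = -fderiv ℝ (φ.normed volume) (x - y) (EuclideanSpace.single j 1) := by
        have h2 : HasFDerivAt η ((fderiv ℝ (φ.normed volume) (x - y)).comp
            (-(ContinuousLinearMap.id ℝ (Space d)))) y :=
          HasFDerivAt.comp y (g := φ.normed volume)
            ((hφ1.differentiable one_ne_zero (x - y)).hasFDerivAt) ((hasFDerivAt_id y).const_sub x)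
        rw [pd, h2.fderiv]
        simp
      by_cases hy : y ∈ Ω
      · rw [indicator_of_mem hy, indicator_of_mem hy, hpd]
        simp [ContinuousLinearMap.precompL_apply, mul_comm]
      · rw [indicator_of_notMem hy, indicator_of_notMem hy]
        simp
    rw [h1, hgH j η hηt, neg_neg]
    calc |∫ y in Ω, H j y * η y| ≤ ∫ y in Ω, M * η y := by
          refine (norm_integral_le_integral_norm (fun y => H j y * η y)).trans
            (integral_mono_of_nonneg (Eventually.of_forall fun _ => norm_nonneg _)
              (hηi.const_mul M).integrableOn ?_)
          filter_upwards [hM j] with y hy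
          rw [norm_mul, Real.norm_eq_abs, Real.norm_eq_abs, abs_of_nonneg (hη0 y)]
          exact mul_le_mul_of_nonneg_right hy (hη0 y)
      _ = M := by
          rw [setIntegral_mul_test hηt (fun _ => M), integral_const_mul, hηint, mul_one]
  have hM0 : 0 ≤ d * M := by
    rcases Nat.eq_zero_or_pos d with h | h
    · subst h; simp
    · exact mul_nonneg (Nat.cast_nonneg _) ((abs_nonneg _).trans (hcoord ⟨0, h⟩))
  refine ContinuousLinearMap.opNorm_le_bound _ hM0 fun v => ?_
  conv_lhs => rw [← (EuclideanSpace.basisFun (Fin d) ℝ).sum_repr v]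
  rw [map_sum]
  calc _ ≤ ∑ j : Fin d, ‖v‖ * M := by
        refine (norm_sum_le _ _).trans (Finset.sum_le_sum fun j _ => ?_)
        rw [map_smul, norm_smul]
        simp only [EuclideanSpace.basisFun_repr, EuclideanSpace.basisFun_apply]
        exact mul_le_mul (PiLp.norm_apply_le v j) (hcoord j) (abs_nonneg _) (norm_nonneg _)
    _ = d * M * ‖v‖ := by
        rw [Finset.sum_const, Finset.card_univ, Fintype.card_fin, nsmul_eq_mul]; ring

/-- Functions with bounded weak derivatives have a continuous representative. -/
theorem exists_continuousOn_ae_eq {d : ℕ} {Ω : Set (Space d)} (hΩ : IsOpen Ω) {g : Space d → ℝ}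
    (hg : MemLInf Ω g) {H : Fin d → Space d → ℝ}
    (hgH : ∀ j, MemLInf Ω (H j) ∧ HasWeakPartial Ω j g (H j)) :
    ∃ g' : Space d → ℝ, ContinuousOn g' Ω ∧ ∀ᵐ x ∂(volume.restrict Ω), g' x = g x := by
  have hli : LocallyIntegrable (Ω.indicator g) :=
    ((memLp_indicator_iff_restrict hΩ.measurableSet).2 hg).locallyIntegrable le_top
  choose B hB0 hB using fun j => (hgH j).1.exists_bound
  set M := ∑ j, B j with hMdef
  have hM0 : 0 ≤ M := Finset.sum_nonneg fun j _ => hB0 j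
  have hM : ∀ j, ∀ᵐ x ∂(volume.restrict Ω), |H j x| ≤ M := fun j => by
    filter_upwards [hB j] with x hx
    exact hx.trans (Finset.single_le_sum (fun j _ => hB0 j) (Finset.mem_univ j))
  let φ : ℕ → ContDiffBump (0 : Space d) := fun n =>
    ⟨1 / (2 * ((n : ℝ) + 1)), 1 / ((n : ℝ) + 1), by positivity, by
      rw [one_div_lt_one_div (by positivity) (by positivity)]
      have : (0 : ℝ) < (n : ℝ) + 1 := by positivity
      linarith⟩
  have hφ0 : Tendsto (fun n => (φ n).rOut) atTop (𝓝 0) := tendsto_one_div_add_atTop_nhds_zero_nat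
  set u : ℕ → Space d → ℝ := fun n =>
    convolution ((φ n).normed volume) (Ω.indicator g) (ContinuousLinearMap.lsmul ℝ ℝ) volume with hu
  -- Almost everywhere convergence of mollifiers requires the outer radius to be at most a fixed
  -- multiple of the inner one; here the ratio is 2.
  have hae : ∀ᵐ x, Tendsto (fun n => u n x) atTop (𝓝 (Ω.indicator g x)) :=
    ContDiffBump.ae_convolution_tendsto_right_of_locallyIntegrable hφ0 (K := 2)
      (Eventually.of_forall fun n => by
        change 1 / ((n : ℝ) + 1) ≤ 2 * (1 / (2 * ((n : ℝ) + 1)))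
        field_simp
        rfl) hli
  set S : Set (Space d) := {x | Tendsto (fun n => u n x) atTop (𝓝 (Ω.indicator g x))} with hS
  have hdense : Dense S := Measure.dense_of_ae hae
  have hloc : ∀ x ∈ Ω, ∃ y, Tendsto (Ω.indicator g) (𝓝[S] x) (𝓝 y) := by
    intro x₀ hx₀
    obtain ⟨ρ, hρ, hball⟩ := Metric.isOpen_iff.1 hΩ x₀ hx₀
    -- On the ball of half radius, mollifications with kernel radius below `ρ / 2` see only `Ω`, so
    -- they share the Lipschitz constant `d * M`; this passes to the limit on the convergence set
    -- `S`.
    have hlip : LipschitzOnWith (Real.toNNReal (d * M)) (Ω.indicator g)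
        (S ∩ Metric.ball x₀ (ρ / 2)) := by
      refine LipschitzOnWith.of_dist_le_mul fun x hx y hy => ?_
      rw [Real.coe_toNNReal _ (mul_nonneg (Nat.cast_nonneg _) hM0), dist_eq_norm, dist_eq_norm]
      refine le_of_tendsto (hx.1.sub hy.1).norm ?_
      filter_upwards [hφ0.eventually (Iio_mem_nhds (half_pos hρ))] with n hn
      have hn' : (φ n).rOut < ρ / 2 := hn
      have hD : ∀ z ∈ Metric.ball x₀ (ρ / 2), ∃ D : Space d →L[ℝ] ℝ, ‖D‖ ≤ d * M ∧
          HasFDerivAt (u n) D z := fun z hz =>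
        norm_fderiv_mollify_le hΩ hg (fun j => (hgH j).2) hM (φ n) fun w hw => hball (by
          rw [Metric.mem_ball] at hz ⊢
          rw [Metric.mem_closedBall] at hw
          linarith [dist_triangle w z x₀])
      choose! D hD1 hD2 using hD
      exact Convex.norm_image_sub_le_of_norm_hasFDerivWithin_le
        (fun z hz => (hD2 z hz).hasFDerivWithinAt) hD1 (convex_ball x₀ (ρ / 2)) hy.2 hx.2
    obtain ⟨G, hG, hGeq⟩ := hlip.extend_real
    refine ⟨G x₀, (hG.continuous.continuousAt.tendsto.mono_left nhdsWithin_le_nhds).congr' ?_⟩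
    filter_upwards [inter_mem_nhdsWithin S (Metric.ball_mem_nhds x₀ (half_pos hρ))] with x hx
      using (hGeq hx).symm
  refine ⟨extendFrom S (Ω.indicator g), continuousOn_extendFrom (fun x _ => hdense x) hloc, ?_⟩
  rw [ae_restrict_iff' hΩ.measurableSet]
  filter_upwards [hae] with x hxS hxΩ
  obtain ⟨y, hy⟩ := hloc x hxΩ
  have h1 : extendFrom S (Ω.indicator g) x = y := extendFrom_eq (hdense x) hy
  have h2 : y = Ω.indicator g x := by
    -- The limit within `S` is taken over neighbourhoods that contain `x` itself, so it must equal
    -- the value at `x`.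
    have hpure : Tendsto (Ω.indicator g) (pure x) (𝓝 y) := hy.mono_left (pure_le_nhdsWithin hxS)
    exact (tendsto_nhds_unique hpure (tendsto_pure_nhds _ _))
  rw [h1, h2, indicator_of_mem hxΩ]

/-- Each first derivative has bounded weak derivatives, hence a continuous representative; so the
definition of `weakGradient` takes its nontrivial branch. -/
theorem MemW2Inf.isContinuousWeakGradient {d : ℕ} {Ω : Set (Space d)} (hΩ : IsOpen Ω)
    {ψ : Space d → ℝ} (hψ : MemW2Inf Ω ψ) :
    IsContinuousWeakGradient Ω ψ (weakGradient Ω ψ) := by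
  have hex : ∃ G, IsContinuousWeakGradient Ω ψ G := by
    obtain ⟨-, g, H, hg, hH⟩ := hψ
    choose G hGc hGae using fun i => exists_continuousOn_ae_eq hΩ (hg i).1 (hH i)
    refine ⟨fun x => WithLp.toLp 2 fun i => G i x, ?_, fun i => ?_⟩
    · exact (PiLp.continuous_toLp 2 _).comp_continuousOn (continuousOn_pi.2 hGc)
    · exact (hg i).2.congr_ae (Eventually.of_forall fun _ => rfl) (hGae i)
  rw [weakGradient, dif_pos hex]
  exact hex.choose_spec

theorem le_of_ae_le_of_continuousOn {d : ℕ} {Ω : Set (Space d)} (hΩ : IsOpen Ω) {f : Space d → ℝ}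
    (hf : ContinuousOn f Ω) {M : ℝ} (h : ∀ᵐ x ∂(volume.restrict Ω), f x ≤ M) :
    ∀ x ∈ Ω, f x ≤ M := by
  intro x hx
  by_contra hlt
  have hopen : IsOpen (Ω ∩ f ⁻¹' Ioi M) := hf.isOpen_inter_preimage hΩ isOpen_Ioi
  refine (hopen.measure_pos volume ⟨x, hx, not_le.1 hlt⟩).ne' ?_
  rw [ae_restrict_iff' hΩ.measurableSet] at h
  refine measure_mono_null ?_ h
  rintro y ⟨hy, hy'⟩ h'
  exact absurd (h' hy) (not_le.2 hy')

/-- Continuity in the open set `Ω` does not prevent blow-up at its boundary. The bound comes from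
the `L^∞` derivatives, and continuity upgrades it from almost every point to every point, which
traces on facets need. -/
theorem MemW2Inf.exists_bound_weakGradient {d : ℕ} {Ω : Set (Space d)} (hΩ : IsOpen Ω)
    {ψ : Space d → ℝ} (hψ : MemW2Inf Ω ψ) : ∃ M, ∀ x ∈ Ω, ‖weakGradient Ω ψ x‖ ≤ M := by
  obtain ⟨hGc, hG⟩ := hψ.isContinuousWeakGradient hΩ
  obtain ⟨-, g, H, hg, hH⟩ := hψ
  have hGic : ∀ i, ContinuousOn (fun x => weakGradient Ω ψ x i) Ω := fun i =>
    (EuclideanSpace.proj (𝕜 := ℝ) i).continuous.comp_continuousOn hGc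
  have hb : ∀ i, ∃ M : ℝ, ∀ x ∈ Ω, ‖weakGradient Ω ψ x i‖ ≤ M := by
    intro i
    obtain ⟨M, -, hM⟩ := (hg i).1.exists_bound
    have hae := ae_eq_of_integral_test_eq hΩ ((hGic i).locallyIntegrableOn hΩ.measurableSet)
      (hg i).1.locallyIntegrableOn fun φ hφ => by
        rw [← neg_inj, ← hG i φ hφ, (hg i).2 φ hφ]
    refine ⟨M, le_of_ae_le_of_continuousOn hΩ (hGic i).norm ?_⟩
    filter_upwards [hae, hM] with x h1 h2
    rw [h1]; exact h2
  choose M hM using hb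
  refine ⟨∑ i, M i, fun x hx => ?_⟩
  have h1 := (EuclideanSpace.basisFun (Fin d) ℝ).sum_repr (weakGradient Ω ψ x)
  rw [← h1]
  refine (norm_sum_le _ _).trans (Finset.sum_le_sum fun i _ => ?_)
  rw [norm_smul]
  simpa using hM i x hx

/-- The trace of the weak Hessian is bounded and serves as Laplacian after two integrations by
parts. -/
theorem MemW2Inf.isWeakLaplacian {d : ℕ} {Ω : Set (Space d)}
    {ψ : Space d → ℝ} (hψ : MemW2Inf Ω ψ) :
    ∃ L, MemLInf Ω L ∧ IsWeakLaplacian Ω ψ L := by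
  obtain ⟨hu, g, H, hg, hH⟩ := hψ
  have hL : MemLInf Ω (fun x => ∑ i, H i i x) := memLp_finsetSum _ fun i _ => (hH i i).1
  refine ⟨_, hL, hL.locallyIntegrableOn, fun φ hφ => ?_⟩
  simp_rw [Finset.sum_mul, Finset.mul_sum]
  rw [integral_finsetSum _ fun i _ => integrableOn_mul_test (hH i i).1.locallyIntegrableOn hφ,
    integral_finsetSum _ fun i _ =>
      integrableOn_mul_test hu.locallyIntegrableOn ((hφ.pd i).pd i)]
  refine Finset.sum_congr rfl fun i _ => ?_
  rw [(hg i).2 _ (hφ.pd i), (hH i i).2 _ hφ, neg_neg]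

theorem MemW2Inf.isWeakLaplacian_weakLaplacian {d : ℕ} {Ω : Set (Space d)} {ψ : Space d → ℝ}
    (hψ : MemW2Inf Ω ψ) : IsWeakLaplacian Ω ψ (weakLaplacian Ω ψ) := by
  obtain ⟨L, -, hL⟩ := hψ.isWeakLaplacian
  have hex : ∃ L, IsWeakLaplacian Ω ψ L := ⟨L, hL⟩
  rw [weakLaplacian, dif_pos hex]
  exact hex.choose_spec

theorem MemW2Inf.memLInf_weakLaplacian {d : ℕ} {Ω : Set (Space d)} (hΩ : IsOpen Ω)
    {ψ : Space d → ℝ} (hψ : MemW2Inf Ω ψ) : MemLInf Ω (weakLaplacian Ω ψ) := by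
  obtain ⟨L, hL1, hL2⟩ := hψ.isWeakLaplacian
  have hw := hψ.isWeakLaplacian_weakLaplacian
  have hae := ae_eq_of_integral_test_eq hΩ hL2.1 hw.1 fun φ hφ => by rw [hL2.2 φ hφ, hw.2 φ hφ]
  exact (memLp_congr_ae hae).1 hL1

/-- The weak Laplacian is the weak divergence of the weak gradient. -/
theorem MemW2Inf.integral_weakGradient_add {d : ℕ} {Ω : Set (Space d)} (hΩ : IsOpen Ω)
    {ψ : Space d → ℝ} (hψ : MemW2Inf Ω ψ) {φ : Space d → ℝ} (hφ : IsTestFunction Ω φ) :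
    ∫ x in Ω, (fderiv ℝ φ x (weakGradient Ω ψ x) + weakLaplacian Ω ψ x * φ x) = 0 := by
  obtain ⟨hGc, hG⟩ := hψ.isContinuousWeakGradient hΩ
  have hGi : ∀ i, LocallyIntegrableOn (fun x => weakGradient Ω ψ x i) Ω := fun i =>
    ((EuclideanSpace.proj (𝕜 := ℝ) i).continuous.comp_continuousOn hGc).locallyIntegrableOn
      hΩ.measurableSet
  have hw := hψ.isWeakLaplacian_weakLaplacian
  simp_rw [fderiv_apply_eq_sum_pd]
  rw [integral_add (integrable_finsetSum _ fun i _ => integrableOn_mul_test (hGi i) (hφ.pd i))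
    (integrableOn_mul_test hw.1 hφ),
    integral_finsetSum _ fun i _ => integrableOn_mul_test (hGi i) (hφ.pd i), hw.2 φ hφ]
  simp_rw [Finset.mul_sum]
  rw [integral_finsetSum _ fun i _ =>
      integrableOn_mul_test hψ.1.locallyIntegrableOn ((hφ.pd i).pd i), ← Finset.sum_add_distrib]
  refine Finset.sum_eq_zero fun i _ => ?_
  rw [hG i _ (hφ.pd i), add_neg_cancel]

/-! ### Mesh geometry: separating hyperplanes, normals and facets -/

theorem halfspace_inter_neg_eq_empty {d : ℕ} (p : Space d × ℝ) :
    halfspace p ∩ halfspace (-p) = ∅ := by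
  ext x
  simp only [halfspace, mem_inter_iff, mem_ofPred_eq, Prod.fst_neg, Prod.snd_neg, inner_neg_left,
    mem_empty_iff_false, iff_false, not_and, not_lt]
  intro h
  linarith

/-- The hyperplane `p`, with unit normal pointing from `A` to `B`, separates `A` from `B`. -/
structure Separates {d : ℕ} (p : Space d × ℝ) (A B : Set (Space d)) : Prop where
  norm_eq : ‖p.1‖ = 1
  left : A ⊆ halfspace p
  right : B ⊆ halfspace (-p)

theorem Separates.closure_inter_subset {d : ℕ} {p : Space d × ℝ} {A B : Set (Space d)}
    (h : Separates p A B) : closure A ∩ closure B ⊆ hyperplane p := by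
  rintro x ⟨hA, hB⟩
  have h1 : IsClosed {x : Space d | inner ℝ p.1 x ≤ p.2} := isClosed_le (by fun_prop) continuous_const
  have h2 : IsClosed {x : Space d | p.2 ≤ inner ℝ p.1 x} := isClosed_le continuous_const (by fun_prop)
  refine le_antisymm (closure_minimal (fun y hy => (h.left hy).le) h1 hA)
    (closure_minimal (fun y hy => ?_) h2 hB)
  have := h.right hy
  simp only [halfspace, mem_ofPred_eq, Prod.fst_neg, Prod.snd_neg, inner_neg_left] at this
  change p.2 ≤ inner ℝ p.1 y
  linarith

/-- Together with `eq_of_subset_halfspace`, this replaces combinatorial facts about faces: a set of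
positive surface measure determines its hyperplane, and a nonempty set on one side determines the
orientation. -/
theorem eq_or_eq_neg_of_surf_pos {d : ℕ} {p q : Space d × ℝ} (hp : ‖p.1‖ = 1) (hq : ‖q.1‖ = 1)
    {S : Set (Space d)} (hSp : S ⊆ hyperplane p) (hSq : S ⊆ hyperplane q) (hS : surf d S ≠ 0) :
    q = p ∨ q = -p := by
  by_contra! h
  exact hS (measure_mono_null (subset_inter hSq hSp) (surf_hyperplane_inter_eq_zero hp hq h.1 h.2))

theorem eq_of_subset_halfspace {d : ℕ} {p q : Space d × ℝ} (h : q = p ∨ q = -p)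
    {A : Set (Space d)} (hA : A.Nonempty) (hAp : A ⊆ halfspace p) (hAq : A ⊆ halfspace q) :
    q = p := by
  rcases h with h | h
  · exact h
  · subst h
    have := hA.mono (subset_inter hAp hAq)
    rw [halfspace_inter_neg_eq_empty] at this
    exact absurd this (by simp)

namespace Mesh

variable {d m : ℕ} {Ω : Set (Space d)} (T : Mesh d Ω m)

theorem isOpen_K (i : Fin m) : IsOpen (T.K i) := by
  obtain ⟨s, -, hs⟩ := (T.polytope i).exists_cell
  rw [hs]; exact isOpen_cell s

theorem convex_K (i : Fin m) : Convex ℝ (T.K i) := by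
  obtain ⟨s, -, hs⟩ := (T.polytope i).exists_cell
  rw [hs]; exact convex_cell s

theorem isCompact_closure_K (i : Fin m) : IsCompact (closure (T.K i)) :=
  Metric.isCompact_of_isClosed_isBounded isClosed_closure (T.polytope i).2.1.closure

theorem isBounded (T : Mesh d Ω m) : Bornology.IsBounded Ω := by
  refine Bornology.IsBounded.subset ?_ (subset_closure (s := Ω))
  rw [T.cover]
  exact Bornology.isBounded_iUnion.2 fun i => (T.polytope i).2.1.closure

/-- Hahn–Banach for two disjoint open convex sets provides a separating functional; its normalised
Riesz vector is a candidate for the normal. -/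
theorem normal_spec {i j : Fin m} (hij : i ≠ j) : ‖T.normal i j‖ = 1 ∧
    ∀ x ∈ T.K i, ∀ y ∈ T.K j, inner ℝ (T.normal i j) x < inner ℝ (T.normal i j) y := by
  have hex : ∃ n : Space d, ‖n‖ = 1 ∧ ∀ x ∈ T.K i, ∀ y ∈ T.K j, inner ℝ n x < inner ℝ n y := by
    obtain ⟨f, u, hf, hu⟩ := geometric_hahn_banach_open_open (T.convex_K i) (T.isOpen_K i)
      (T.convex_K j) (T.isOpen_K j) (T.disjoint i j hij)
    set a := (InnerProductSpace.toDual ℝ (Space d)).symm f with ha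
    have hfa : ∀ x, f x = inner ℝ a x := fun x => by simp [ha]
    have ha0 : 0 < ‖a‖ := by
      rw [norm_pos_iff]
      intro h0
      obtain ⟨x, hx⟩ := (T.polytope i).1
      obtain ⟨y, hy⟩ := (T.polytope j).1
      have h1 := hf x hx
      have h2 := hu y hy
      rw [hfa, h0, inner_zero_left] at h1 h2
      linarith
    refine ⟨‖a‖⁻¹ • a, ?_, fun x hx y hy => ?_⟩
    · rw [norm_smul, norm_inv, norm_norm, inv_mul_cancel₀ ha0.ne']
    · rw [real_inner_smul_left, real_inner_smul_left, ← hfa, ← hfa]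
      exact mul_lt_mul_of_pos_left ((hf x hx).trans (hu y hy)) (inv_pos.2 ha0)
  rw [normal, dif_pos hex]
  exact hex.choose_spec

/-- The offset is the supremum of the normal coordinate over the first element. Openness allows a
small move along the normal in both elements, which makes the inequalities strict. -/
theorem exists_separates {i j : Fin m} (hij : i ≠ j) :
    ∃ b : ℝ, Separates (T.normal i j, b) (T.K i) (T.K j) := by
  obtain ⟨hn, hsep⟩ := T.normal_spec hij
  set n := T.normal i j
  obtain ⟨x₀, hx₀⟩ := (T.polytope i).1
  obtain ⟨y₀, hy₀⟩ := (T.polytope j).1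
  have hbdd : BddAbove ((fun x => inner ℝ n x) '' T.K i) :=
    ⟨inner ℝ n y₀, by rintro _ ⟨x, hx, rfl⟩; exact (hsep x hx y₀ hy₀).le⟩
  have hmove : ∀ (k : Fin m) (x : Space d), x ∈ T.K k → ∃ t > (0 : ℝ), x + t • n ∈ T.K k ∧
      x - t • n ∈ T.K k := by
    intro k x hx
    obtain ⟨ε, hε, hball⟩ := Metric.isOpen_iff.1 (T.isOpen_K k) x hx
    have hs : ‖(ε / 2) • n‖ < ε := by
      rw [norm_smul, hn, mul_one, Real.norm_eq_abs, abs_of_pos (half_pos hε)]; linarith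
    exact ⟨ε / 2, half_pos hε, hball (by simpa using hs),
      hball (by simpa [dist_eq_norm] using hs)⟩
  refine ⟨sSup ((fun x => inner ℝ n x) '' T.K i), hn, fun x hx => ?_, fun y hy => ?_⟩
  · obtain ⟨t, ht, hxt, -⟩ := hmove i x hx
    have h1 := le_csSup hbdd (mem_image_of_mem _ hxt)
    simp only [inner_add_right, inner_smul_right, real_inner_self_eq_norm_sq, hn] at h1
    change inner ℝ n x < _
    linarith
  · obtain ⟨t, ht, -, hyt⟩ := hmove j y hy
    have h1 : sSup ((fun x => inner ℝ n x) '' T.K i) ≤ inner ℝ n (y - t • n) :=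
      csSup_le ⟨_, mem_image_of_mem _ hx₀⟩ (by
        rintro _ ⟨x, hx, rfl⟩; exact (hsep x hx _ hyt).le)
    simp only [inner_sub_right, inner_smul_right, real_inner_self_eq_norm_sq, hn] at h1
    change inner ℝ (-n) y < -_
    rw [inner_neg_left]
    linarith

theorem facet_comm (i j : Fin m) : T.facet i j = T.facet j i := by
  rw [facet, facet, inter_comm (closure (T.K i))]

theorem measurableSet_facet (hΩ : IsOpen Ω) (i j : Fin m) : MeasurableSet (T.facet i j) :=
  (isClosed_closure.inter isClosed_closure).measurableSet.inter hΩ.measurableSet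

theorem facet_subset_closure (i j : Fin m) : T.facet i j ⊆ closure (T.K i) := fun _ hx => hx.1.1

theorem surf_facet_lt_top {i j : Fin m} (hij : i ≠ j) : surf d (T.facet i j) < ⊤ := by
  obtain ⟨b, hb⟩ := T.exists_separates hij
  exact surf_lt_top_of_subset_hyperplane hb.norm_eq
    (inter_subset_left.trans hb.closure_inter_subset)
    ((T.isCompact_closure_K i).isBounded.subset (T.facet_subset_closure i j))

/-- The normals of a facet seen from its two sides are opposite. -/
theorem normal_symm {i j : Fin m} (hij : i ≠ j) (h : surf d (T.facet i j) ≠ 0) :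
    T.normal j i = -T.normal i j := by
  obtain ⟨b, hb⟩ := T.exists_separates hij
  obtain ⟨c, hc⟩ := T.exists_separates hij.symm
  have h1 : T.facet i j ⊆ hyperplane (T.normal j i, c) := by
    rw [facet_comm]; exact inter_subset_left.trans hc.closure_inter_subset
  have hn : ‖(-(T.normal i j, b)).1‖ = 1 := by simpa using hb.norm_eq
  rcases eq_or_eq_neg_of_surf_pos hb.norm_eq hc.norm_eq
    (inter_subset_left.trans hb.closure_inter_subset) h1 h with h2 | h2
  · have := eq_of_subset_halfspace (p := -(T.normal i j, b)) (q := (T.normal j i, c))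
      (by rw [neg_neg]; exact Or.inr h2) (T.polytope j).1 hb.right hc.left
    exact congrArg Prod.fst this
  · exact congrArg Prod.fst h2

/-- Two facets of an element meet in a set of surface measure zero. -/
theorem aedisjoint_facet {i j k : Fin m} (hij : i ≠ j) (hik : i ≠ k) (hjk : j ≠ k) :
    AEDisjoint (surf d) (T.facet i j) (T.facet i k) := by
  by_contra h
  have h : surf d (T.facet i j ∩ T.facet i k) ≠ 0 := h
  -- If the overlap had positive measure, the three pairwise separating hyperplanes would coincide
  -- up to orientation. With `K i` on one side, `K j` and `K k` would both lie on the other, yet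
  -- they are separated by the same hyperplane.
  obtain ⟨b, hp⟩ := T.exists_separates hij
  obtain ⟨c, hq⟩ := T.exists_separates hik
  obtain ⟨e, hr⟩ := T.exists_separates hjk
  have h1 : T.facet i j ∩ T.facet i k ⊆ hyperplane (T.normal i j, b) :=
    fun x hx => hp.closure_inter_subset hx.1.1
  have h2 : T.facet i j ∩ T.facet i k ⊆ hyperplane (T.normal i k, c) :=
    fun x hx => hq.closure_inter_subset hx.2.1
  have h3 : T.facet i j ∩ T.facet i k ⊆ hyperplane (T.normal j k, e) :=
    fun x hx => hr.closure_inter_subset ⟨hx.1.1.2, hx.2.1.2⟩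
  have hqp := eq_of_subset_halfspace (eq_or_eq_neg_of_surf_pos hp.norm_eq hq.norm_eq h1 h2 h)
    (T.polytope i).1 hp.left hq.left
  have hrp := eq_of_subset_halfspace (p := -(T.normal i j, b)) (by
      rw [neg_neg]
      exact (eq_or_eq_neg_of_surf_pos hp.norm_eq hr.norm_eq h1 h3 h).symm)
    (T.polytope j).1 hp.right hr.left
  have h4 := hq.right
  have h5 := hr.right
  rw [hqp] at h4
  rw [hrp, neg_neg] at h5
  have := (T.polytope k).1.mono (subset_inter h5 h4)
  rw [halfspace_inter_neg_eq_empty] at this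
  exact absurd this (by simp)

/-- An open element is disjoint from the closure of another one, so a point of the facet violates a
strict inequality of `K i` while satisfying its closed version. -/
theorem facet_subset_iUnion {i j : Fin m} (hij : i ≠ j) {s : Finset (Space d × ℝ)}
    (hs : T.K i = cell s) :
    T.facet i j ⊆ ⋃ p ∈ s, closure (T.K i) ∩ hyperplane p ∩ Ω := by
  rintro x ⟨⟨hxi, hxj⟩, hxΩ⟩
  have hnot : x ∉ cell s := by
    rw [← hs]
    intro hx
    exact ((T.disjoint i j hij).closure_right (T.isOpen_K i)).le_bot ⟨hx, hxj⟩
  simp only [cell, mem_ofPred_eq, not_forall, not_lt] at hnot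
  obtain ⟨p, hp, hle⟩ := hnot
  simp only [mem_iUnion]
  exact ⟨p, hp, ⟨hxi, le_antisymm (inner_le_of_mem_closure_cell (hs ▸ hxi) hp) hle⟩, hxΩ⟩

/-- A small step outwards from a face leaves `closure (T.K i)` but stays in `Ω`, so it lands in the
closure of another element. The finite union of these closures is closed and contains the limit
point. Hanging nodes are covered: a face may be shared with several neighbours. -/
theorem subset_iUnion_facet (hΩ : IsOpen Ω) {i : Fin m} {s : Finset (Space d × ℝ)}
    (hs1 : ∀ p ∈ s, ‖p.1‖ = 1) (hs : T.K i = cell s) {p : Space d × ℝ} (hp : p ∈ s) :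
    closure (T.K i) ∩ hyperplane p ∩ Ω ⊆ ⋃ j ∈ Finset.univ.erase i, T.facet i j := by
  rintro x ⟨⟨hxi, hxp⟩, hxΩ⟩
  have hlim : Tendsto (fun t : ℝ => x + t • p.1) (𝓝[>] 0) (𝓝 x) := by
    have : Continuous (fun t : ℝ => x + t • p.1) := by fun_prop
    have h := (this.tendsto 0).mono_left (nhdsWithin_le_nhds (s := Ioi 0))
    simpa using h
  have hev : ∀ᶠ t in 𝓝[>] (0 : ℝ), x + t • p.1 ∈ ⋃ j ∈ Finset.univ.erase i, closure (T.K j) := by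
    filter_upwards [hlim.eventually (hΩ.mem_nhds hxΩ), self_mem_nhdsWithin] with t ht ht0
    have h1 : x + t • p.1 ∈ ⋃ j, closure (T.K j) := T.cover ▸ subset_closure ht
    obtain ⟨j, hj⟩ := mem_iUnion.1 h1
    simp only [mem_iUnion]
    refine ⟨j, Finset.mem_erase.2 ⟨?_, Finset.mem_univ j⟩, hj⟩
    rintro rfl
    have h2 := inner_le_of_mem_closure_cell (hs ▸ hj) hp
    rw [inner_add_right, inner_smul_right, real_inner_self_eq_norm_sq, hs1 p hp,
      show inner ℝ p.1 x = p.2 from hxp] at h2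
    have : (0 : ℝ) < t := ht0
    linarith
  have hcl : IsClosed (⋃ j ∈ Finset.univ.erase i, closure (T.K j)) :=
    isClosed_biUnion_finset fun j _ => isClosed_closure
  have hx := hcl.mem_of_tendsto hlim hev
  simp only [mem_iUnion] at hx ⊢
  obtain ⟨j, hj, hxj⟩ := hx
  exact ⟨j, hj, ⟨hxi, hxj⟩, hxΩ⟩

theorem frontier_subset {i : Fin m} {s : Finset (Space d × ℝ)} (hΩ : IsOpen Ω)
    (hs : T.K i = cell s) {p : Space d × ℝ} (hp : p ∈ s) :
    (closure (T.K i) ∩ hyperplane p) \ Ω ⊆ frontier (T.K i) ∩ frontier Ω := by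
  rintro x ⟨⟨hxi, hxp⟩, hxΩ⟩
  constructor
  · refine ⟨hxi, ?_⟩
    rw [(T.isOpen_K i).interior_eq, hs]
    intro h
    exact (h p hp).ne hxp
  · refine ⟨closure_mono (T.subset i) hxi, ?_⟩
    rwa [hΩ.interior_eq]

theorem ne_neg_of_mem {i : Fin m} {s : Finset (Space d × ℝ)} (hs : T.K i = cell s)
    {p q : Space d × ℝ} (hp : p ∈ s) (hq : q ∈ s) : q ≠ -p := by
  rintro rfl
  obtain ⟨x, hx⟩ := (T.polytope i).1
  rw [hs] at hx
  have : x ∈ halfspace p ∩ halfspace (-p) := ⟨hx p hp, hx _ hq⟩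
  rw [halfspace_inter_neg_eq_empty] at this
  exact this

theorem aedisjoint_face {i : Fin m} {s : Finset (Space d × ℝ)} (hs1 : ∀ p ∈ s, ‖p.1‖ = 1)
    (hs : T.K i = cell s) {p q : Space d × ℝ} (hp : p ∈ s) (hq : q ∈ s) (hpq : p ≠ q)
    (A B : Set (Space d)) : AEDisjoint (surf d) (A ∩ hyperplane p ∩ B) (A ∩ hyperplane q ∩ B) :=
  measure_mono_null
    (show (A ∩ hyperplane p ∩ B) ∩ (A ∩ hyperplane q ∩ B) ⊆ hyperplane p ∩ hyperplane q from
      fun _ hx => ⟨hx.1.1.2, hx.2.1.2⟩)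
    (surf_hyperplane_inter_eq_zero (hs1 q hq) (hs1 p hp) hpq (T.ne_neg_of_mem hs hq hp))

end Mesh

/-! ### The divergence theorem on mesh elements -/

/-- An integral splits along a cover by almost disjoint sets. -/
theorem setIntegral_eq_sum_inter {X ι : Type*} [MeasurableSpace X] {μ : Measure X} (t : Finset ι)
    {A : Set X} {B : ι → Set X} (hA : MeasurableSet A) (hB : ∀ k ∈ t, MeasurableSet (B k))
    (hcov : A ⊆ ⋃ k ∈ t, B k) (hdis : ∀ k ∈ t, ∀ l ∈ t, k ≠ l → AEDisjoint μ (B k) (B l))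
    {f : X → ℝ} (hf : IntegrableOn f A μ) :
    ∫ x in A, f x ∂μ = ∑ k ∈ t, ∫ x in A ∩ B k, f x ∂μ := by
  have hAeq : A = ⋃ k : t, A ∩ B k := by
    rw [← inter_iUnion, eq_comm, inter_eq_left]
    intro x hx
    have := hcov hx
    simp only [mem_iUnion] at this ⊢
    obtain ⟨k, hk, hxk⟩ := this
    exact ⟨⟨k, hk⟩, hxk⟩
  have h := integral_iUnion_ae (μ := μ) (f := f) (s := fun k : t => A ∩ B k)
    (fun k => (hA.inter (hB k k.2)).nullMeasurableSet)
    (fun k l hkl => (hdis k k.2 l l.2 (fun h => hkl (Subtype.ext h))).mono inter_subset_right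
      inter_subset_right) (by rwa [← hAeq])
  rw [← hAeq, tsum_fintype] at h
  rw [h, ← Finset.sum_coe_sort t fun k => ∫ x in A ∩ B k, f x ∂μ]

theorem integrableOn_of_continuousOn_of_bound {X : Type*} [TopologicalSpace X] [MeasurableSpace X]
    [BorelSpace X] [SecondCountableTopology X] {μ : Measure X} {A : Set X} (hA : MeasurableSet A)
    (hμ : μ A < ⊤) {f : X → ℝ} (hf : ContinuousOn f A) {C : ℝ} (hC : ∀ x ∈ A, |f x| ≤ C) :
    IntegrableOn f A μ :=
  IntegrableOn.of_bound hμ (hf.aestronglyMeasurable hA) C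
    ((ae_restrict_iff' hA).2 (Eventually.of_forall hC))

namespace Mesh

variable {d m : ℕ} {Ω : Set (Space d)} (T : Mesh d Ω m)

/-- The integral over the part of the boundary of an element inside `Ω`, as a sum over the
bounding hyperplanes and as a sum over the interior facets. -/
theorem sum_face_eq_sum_facet (hΩ : IsOpen Ω) {i : Fin m} {s : Finset (Space d × ℝ)}
    (hs1 : ∀ p ∈ s, ‖p.1‖ = 1) (hs : T.K i = cell s) {G : Space d → Space d}
    (hG : ContinuousOn G Ω) {M : ℝ} (hM : ∀ x ∈ Ω, ‖G x‖ ≤ M) {f : Space d → ℝ}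
    (hf : Continuous f) :
    ∑ p ∈ s, ∫ x in closure (T.K i) ∩ hyperplane p ∩ Ω, f x * inner ℝ p.1 (G x) ∂(surf d) =
      ∑ j ∈ Finset.univ.erase i, ∫ x in T.facet i j,
        f x * inner ℝ (T.normal i j) (G x) ∂(surf d) := by
  obtain ⟨C, hC⟩ := (T.isCompact_closure_K i).exists_bound_of_continuousOn hf.continuousOn
  have hmeas : ∀ p, MeasurableSet (closure (T.K i) ∩ hyperplane p ∩ Ω) := fun p =>
    (isClosed_closure.inter (isClosed_hyperplane p)).measurableSet.inter hΩ.measurableSet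
  have hint : ∀ (A : Set (Space d)) (n : Space d), MeasurableSet A → surf d A < ⊤ → A ⊆ Ω →
      A ⊆ closure (T.K i) → ‖n‖ = 1 →
      IntegrableOn (fun x => f x * inner ℝ n (G x)) A (surf d) := by
    intro A n hA hfin hAΩ hAK hn
    refine integrableOn_of_continuousOn_of_bound hA hfin
      (hf.continuousOn.mul (continuousOn_const.inner (hG.mono hAΩ))) (C := C * M) fun x hx => ?_
    rw [abs_mul]
    refine mul_le_mul (hC x (hAK hx)) ?_ (abs_nonneg _) ((norm_nonneg _).trans (hC x (hAK hx)))
    refine (abs_real_inner_le_norm _ _).trans ?_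
    rw [hn, one_mul]
    exact hM x (hAΩ hx)
  have h1 : ∀ p ∈ s, ∫ x in closure (T.K i) ∩ hyperplane p ∩ Ω, f x * inner ℝ p.1 (G x) ∂(surf d) =
      ∑ j ∈ Finset.univ.erase i, ∫ x in closure (T.K i) ∩ hyperplane p ∩ Ω ∩ T.facet i j,
        f x * inner ℝ p.1 (G x) ∂(surf d) := by
    intro p hp
    refine setIntegral_eq_sum_inter _ (hmeas p) (fun j _ => T.measurableSet_facet hΩ i j)
      (T.subset_iUnion_facet hΩ hs1 hs hp) (fun j hj k hk hjk => T.aedisjoint_facet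
        (Finset.ne_of_mem_erase hj).symm (Finset.ne_of_mem_erase hk).symm hjk)
      (hint _ _ (hmeas p) ?_ inter_subset_right (fun x hx => hx.1.1) (hs1 p hp))
    exact surf_lt_top_of_subset_hyperplane (hs1 p hp) (fun x hx => hx.1.2)
      ((T.isCompact_closure_K i).isBounded.subset fun x hx => hx.1.1)
  have h2 : ∀ j ∈ Finset.univ.erase i, ∫ x in T.facet i j,
        f x * inner ℝ (T.normal i j) (G x) ∂(surf d) =
      ∑ p ∈ s, ∫ x in T.facet i j ∩ (closure (T.K i) ∩ hyperplane p ∩ Ω),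
        f x * inner ℝ (T.normal i j) (G x) ∂(surf d) := by
    intro j hj
    have hij := (Finset.ne_of_mem_erase hj).symm
    exact setIntegral_eq_sum_inter _ (T.measurableSet_facet hΩ i j) (fun p _ => hmeas p)
      (T.facet_subset_iUnion hij hs) (fun p hp q hq hpq => T.aedisjoint_face hs1 hs hp hq hpq _ _)
      (hint _ _ (T.measurableSet_facet hΩ i j) (T.surf_facet_lt_top hij) inter_subset_right
        (T.facet_subset_closure i j) (T.normal_spec hij).1)
  rw [Finset.sum_congr rfl h1, Finset.sum_congr rfl h2, Finset.sum_comm]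
  refine Finset.sum_congr rfl fun j hj => Finset.sum_congr rfl fun p hp => ?_
  rw [inter_comm (T.facet i j)]
  -- On an overlap of positive measure the face and the facet span the same hyperplane, and `K i`
  -- lies on the same side of both, so the normals agree; null overlaps contribute nothing.
  by_cases h0 : surf d (closure (T.K i) ∩ hyperplane p ∩ Ω ∩ T.facet i j) = 0
  · rw [Measure.restrict_eq_zero.2 h0, integral_zero_measure, integral_zero_measure]
  · obtain ⟨b, hb⟩ := T.exists_separates (Finset.ne_of_mem_erase hj).symm
    have hor := eq_or_eq_neg_of_surf_pos hb.norm_eq (hs1 p hp)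
      (fun x hx => hb.closure_inter_subset hx.2.1) (fun x hx => hx.1.1.2) h0
    have heq := eq_of_subset_halfspace hor (T.polytope i).1 hb.left (hs ▸ fun x hx => hx p hp)
    rw [heq]

/-- The divergence theorem on one element of a mesh. -/
theorem integral_element_divergence (hΩ : IsOpen Ω) (i : Fin m) {G : Space d → Space d}
    (hG : ContinuousOn G Ω) {M : ℝ} (hM : ∀ x ∈ Ω, ‖G x‖ ≤ M) {L : Space d → ℝ}
    (hL : IntegrableOn L Ω)
    (hdiv : ∀ φ, IsTestFunction Ω φ → ∫ x in Ω, (fderiv ℝ φ x (G x) + L x * φ x) = 0)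
    {f : Space d → ℝ} (hf : ContDiff ℝ ∞ f)
    (h0 : ∀ᵐ x ∂(surf d).restrict (frontier (T.K i) ∩ frontier Ω), f x = 0) :
    ∫ x in T.K i, (fderiv ℝ f x (G x) + L x * f x) =
      ∑ j ∈ Finset.univ.erase i, ∫ x in T.facet i j,
        f x * inner ℝ (T.normal i j) (G x) ∂(surf d) := by
  obtain ⟨s, hs1, hs⟩ := (T.polytope i).exists_cell
  have hKΩ := T.subset i
  rw [← T.sum_face_eq_sum_facet hΩ hs1 hs hG hM hf.continuous]
  have hdivK : ∀ φ, IsTestFunction (T.K i) φ →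
      ∫ x in T.K i, (fderiv ℝ φ x (G x) + L x * φ x) = 0 := by
    intro φ hφ
    rw [← hdiv φ (hφ.mono hKΩ)]
    refine (setIntegral_eq_of_subset_of_forall_sdiff_eq_zero hΩ.measurableSet hKΩ ?_).symm
    rintro x ⟨-, hx⟩
    have hx' : x ∉ tsupport φ := fun h => hx (hφ.2.2 h)
    rw [image_eq_zero_of_notMem_tsupport hx',
      image_eq_zero_of_notMem_tsupport fun h => hx' (tsupport_fderiv_subset ℝ h)]
    simp
  have hb := (T.polytope i).2.1
  have hne := (T.polytope i).1
  have hLK := hL.mono_set hKΩ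
  have h0' : ∀ p ∈ s, ∀ᵐ x ∂(surf d).restrict ((closure (T.K i) ∩ hyperplane p) \ Ω), f x = 0 :=
    fun p hp => ae_restrict_of_ae_restrict_of_subset (T.frontier_subset hΩ hs hp) h0
  rw [hs] at hdivK hb hne hLK hKΩ h0' ⊢
  exact integral_cell_divergence hs1 hb hne hΩ hKΩ hG (fun x hx => hM x (hKΩ hx)) hLK hdivK hf h0'

theorem sum_erase_eq_sum_pairs (c : Fin m → Fin m → ℝ) :
    ∑ i, ∑ j ∈ Finset.univ.erase i, c i j = ∑ e ∈ pairs m, (c e.1 e.2 + c e.2 e.1) := by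
  have h1 : ∀ i, ∑ j ∈ Finset.univ.erase i, c i j =
      (∑ j, if i < j then c i j else 0) + ∑ j, if j < i then c i j else 0 := by
    intro i
    rw [← Finset.sum_add_distrib, ← Finset.sum_erase Finset.univ (a := i) (by simp)]
    refine Finset.sum_congr rfl fun j hj => ?_
    have hne := Finset.ne_of_mem_erase hj
    rcases lt_or_gt_of_ne hne with h | h
    · simp [h, h.not_gt]
    · simp [h, h.not_gt]
  rw [Finset.sum_congr rfl fun i _ => h1 i, Finset.sum_add_distrib, pairs, Finset.sum_filter,
    ← Finset.univ_product_univ, Finset.sum_product]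
  rw [Finset.sum_comm (f := fun i j => if j < i then c i j else 0), ← Finset.sum_add_distrib]
  refine Finset.sum_congr rfl fun i _ => ?_
  rw [← Finset.sum_add_distrib]
  refine Finset.sum_congr rfl fun j _ => ?_
  split_ifs <;> simp

end Mesh

/-! ### Polynomials and inverse estimates -/

theorem hasFDerivAt_pval {d : ℕ} (q : MvPolynomial (Fin d) ℝ) (x : Space d) :
    HasFDerivAt (pval q) (innerSL ℝ (pgrad q x)) x := by
  have hpg : ∀ (q : MvPolynomial (Fin d) ℝ) (v : Space d), innerSL ℝ (pgrad q x) v =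
      ∑ i, v i * pval (MvPolynomial.pderiv i q) x := by
    intro q v
    simp [pgrad, PiLp.inner_apply]
  induction q using MvPolynomial.induction_on with
  | C a =>
    have h1 : pval (MvPolynomial.C a : MvPolynomial (Fin d) ℝ) = fun _ => a := by
      ext y; simp [pval]
    rw [h1]
    refine (hasFDerivAt_const a x).congr_fderiv ?_
    ext v
    rw [hpg]
    simp [pval]
  | add p q hp hq =>
    have h1 : pval (p + q) = fun y => pval p y + pval q y := by ext y; simp [pval]
    rw [h1]
    refine (hp.add hq).congr_fderiv ?_
    ext v
    rw [_root_.add_apply, hpg, hpg, hpg, ← Finset.sum_add_distrib]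
    refine Finset.sum_congr rfl fun i _ => ?_
    simp [pval]; ring
  | mul_X p i hp =>
    have h1 : pval (p * MvPolynomial.X i) = fun y => pval p y * y i := by ext y; simp [pval]
    rw [h1]
    refine (hp.mul (EuclideanSpace.proj (𝕜 := ℝ) i).hasFDerivAt).congr_fderiv ?_
    ext v
    simp only [_root_.add_apply, _root_.smul_apply, hpg, smul_eq_mul, Derivation.leibniz,
      MvPolynomial.pderiv_X]
    have h2 : ∀ j, v j * pval (p * (Pi.single j 1 : Fin d → MvPolynomial (Fin d) ℝ) i +
        MvPolynomial.X i * MvPolynomial.pderiv j p) x =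
        (if j = i then pval p x * v j else 0) + x i * (v j * pval (MvPolynomial.pderiv j p) x) := by
      intro j
      by_cases h : j = i
      · subst h; simp [pval]; ring
      · simp [pval, h, Ne.symm h]; ring
    rw [Finset.sum_congr rfl fun j _ => h2 j, Finset.sum_add_distrib, ← Finset.mul_sum]
    simp

theorem contDiff_pval {d : ℕ} (q : MvPolynomial (Fin d) ℝ) : ContDiff ℝ ∞ (pval q) := by
  induction q using MvPolynomial.induction_on with
  | C a =>
    have h1 : pval (MvPolynomial.C a : MvPolynomial (Fin d) ℝ) = fun _ => a := by
      ext y; simp [pval]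
    rw [h1]; exact contDiff_const
  | add p q hp hq =>
    have h1 : pval (p + q) = fun y => pval p y + pval q y := by ext y; simp [pval]
    rw [h1]; exact hp.add hq
  | mul_X p i hp =>
    have h1 : pval (p * MvPolynomial.X i) = fun y => pval p y * y i := by ext y; simp [pval]
    rw [h1]; exact hp.mul (EuclideanSpace.proj (𝕜 := ℝ) i).contDiff

theorem continuous_pval {d : ℕ} (q : MvPolynomial (Fin d) ℝ) : Continuous (pval q) :=
  (contDiff_pval q).continuous

theorem continuous_pgrad {d : ℕ} (q : MvPolynomial (Fin d) ℝ) : Continuous (pgrad q) :=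
  (PiLp.continuous_toLp 2 _).comp (continuous_pi fun _ => continuous_pval _)

theorem norm_pgrad_sq {d : ℕ} (q : MvPolynomial (Fin d) ℝ) (x : Space d) :
    ‖pgrad q x‖ ^ 2 = ∑ i, pval (MvPolynomial.pderiv i q) x ^ 2 := by
  rw [EuclideanSpace.norm_sq_eq]
  simp [pgrad]

theorem totalDegree_pderiv_le {σ : Type*} (i : σ) (q : MvPolynomial σ ℝ) :
    (MvPolynomial.pderiv i q).totalDegree ≤ q.totalDegree := by
  conv_lhs => rw [q.as_sum, map_sum]
  refine MvPolynomial.totalDegree_finsetSum_le fun s hs => ?_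
  rw [MvPolynomial.pderiv_monomial]
  refine (MvPolynomial.totalDegree_monomial_le _ _).trans (le_trans ?_
    (MvPolynomial.le_totalDegree hs))
  exact Finsupp.degree_mono (tsub_le_self : s - Finsupp.single i 1 ≤ s)

theorem totalDegree_bind₁_le {σ : Type*} {g : σ → MvPolynomial σ ℝ}
    (hg : ∀ i, (g i).totalDegree ≤ 1) (q : MvPolynomial σ ℝ) :
    (MvPolynomial.bind₁ g q).totalDegree ≤ q.totalDegree := by
  conv_lhs => rw [q.as_sum, map_sum]
  refine MvPolynomial.totalDegree_finsetSum_le fun s hs => ?_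
  rw [MvPolynomial.bind₁_monomial]
  refine (MvPolynomial.totalDegree_mul _ _).trans ?_
  rw [MvPolynomial.totalDegree_C, zero_add]
  refine (MvPolynomial.totalDegree_finsetProd _ _).trans (le_trans ?_
    (MvPolynomial.le_totalDegree hs))
  refine Finset.sum_le_sum fun i _ => (MvPolynomial.totalDegree_pow _ _).trans ?_
  simpa using Nat.mul_le_mul_left (s i) (hg i)

theorem exists_affine_subst {d : ℕ} (q : MvPolynomial (Fin d) ℝ) (c : Space d) (r : ℝ) :
    ∃ q' : MvPolynomial (Fin d) ℝ, q'.totalDegree ≤ q.totalDegree ∧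
      ∀ y, pval q' y = pval q (c + r • y) := by
  refine ⟨MvPolynomial.bind₁ (fun i => MvPolynomial.C (c i) + MvPolynomial.C r * MvPolynomial.X i) q,
    totalDegree_bind₁_le (fun i => ?_) q, fun y => ?_⟩
  · refine (MvPolynomial.totalDegree_add _ _).trans (max_le (by simp) ?_)
    refine (MvPolynomial.totalDegree_mul _ _).trans ?_
    simp
  · rw [pval, pval, MvPolynomial.eval, MvPolynomial.eval₂Hom_bind₁]
    congr 2
    ext i
    simp

/-- A ball contains a product of infinite sets, on which a polynomial is determined. This makes the
`L²` product on the unit ball definite below. -/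
theorem eq_zero_of_pval_eq_zero {d : ℕ} {q : MvPolynomial (Fin d) ℝ} {c : Space d} {r : ℝ}
    (hr : 0 < r) (h : ∀ x ∈ Metric.ball c r, pval q x = 0) : q = 0 := by
  have hnhds : Metric.ball c r ∈ 𝓝 c := Metric.ball_mem_nhds c hr
  have hcont : Continuous fun y : Fin d → ℝ => (WithLp.toLp 2 y : Space d) :=
    PiLp.continuous_toLp 2 _
  have hnhds' : (fun y : Fin d → ℝ => (WithLp.toLp 2 y : Space d)) ⁻¹' Metric.ball c r ∈
      𝓝 (fun i => c i) := hcont.continuousAt hnhds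
  obtain ⟨ε, hε, hball⟩ := Metric.mem_nhds_iff.1 hnhds'
  refine MvPolynomial.funext_set (fun i => Metric.ball (c i) ε) (fun i => ?_) fun x hx => ?_
  · exact infinite_of_mem_nhds (c i) (Metric.ball_mem_nhds _ hε)
  · have h1 : x ∈ Metric.ball (fun i => c i) ε := by
      rw [Metric.mem_ball, dist_pi_lt_iff hε]
      intro i
      exact hx i (mem_univ i)
    simpa [pval] using h _ (hball h1)

/-- On a finite-dimensional space, a linear map is bounded in terms of any inner product. -/
theorem exists_norm_sq_le_core {V F : Type*} [AddCommGroup V] [Module ℝ V] [FiniteDimensional ℝ V]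
    [NormedAddCommGroup F] [NormedSpace ℝ F] (c : InnerProductSpace.Core ℝ V) (T : V →ₗ[ℝ] F) :
    ∃ C > (0 : ℝ), ∀ v, ‖T v‖ ^ 2 ≤ C * c.inner v v := by
  let _ : NormedAddCommGroup V := c.toNormedAddCommGroup
  let _ : InnerProductSpace ℝ V := InnerProductSpace.ofCore c.toCore
  let T' := LinearMap.toContinuousLinearMap T
  refine ⟨‖T'‖ ^ 2 + 1, by positivity, fun v => ?_⟩
  have h1 : ‖T v‖ ≤ ‖T'‖ * ‖v‖ := T'.le_opNorm v
  have h2 : c.inner v v = ‖v‖ ^ 2 := real_inner_self_eq_norm_sq v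
  rw [h2]
  calc ‖T v‖ ^ 2 ≤ (‖T'‖ * ‖v‖) ^ 2 := by gcongr
    _ ≤ (‖T'‖ ^ 2 + 1) * ‖v‖ ^ 2 := by nlinarith [sq_nonneg ‖v‖]

theorem integrableOn_ball_of_continuous {d : ℕ} {f : Space d → ℝ} (hf : Continuous f) (c : Space d)
    (r : ℝ) : IntegrableOn f (Metric.ball c r) :=
  (hf.continuousOn.integrableOn_compact (isCompact_closedBall c r)).mono_set
    Metric.ball_subset_closedBall

/-- Polynomials of bounded degree form a finite-dimensional space, on which the supremum over the
ball of radius `R` is controlled by the `L²` norm on the unit ball. -/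
theorem exists_sq_le_integral_unit_ball (d p : ℕ) (R : ℝ) :
    ∃ C > (0 : ℝ), ∀ q : MvPolynomial (Fin d) ℝ, q.totalDegree ≤ p →
      ∀ x ∈ Metric.closedBall (0 : Space d) R,
        pval q x ^ 2 ≤ C * ∫ y in Metric.ball (0 : Space d) 1, pval q y ^ 2 := by
  let V := MvPolynomial.restrictTotalDegree (Fin d) ℝ p
  let core : InnerProductSpace.Core ℝ V :=
    { inner := fun u v => ∫ y in Metric.ball (0 : Space d) 1, pval u.1 y * pval v.1 y
      conj_inner_symm := fun u v => by simp [mul_comm]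
      re_inner_nonneg := fun u => integral_nonneg fun y => mul_self_nonneg _
      add_left := fun u v w => by
        rw [← integral_add]
        · refine integral_congr_ae (Eventually.of_forall fun y => ?_)
          simp [pval, add_mul]
        · exact integrableOn_ball_of_continuous ((continuous_pval _).mul (continuous_pval _)) _ _
        · exact integrableOn_ball_of_continuous ((continuous_pval _).mul (continuous_pval _)) _ _
      smul_left := fun u v r => by
        simp only [conj_trivial]
        rw [← integral_const_mul]
        refine integral_congr_ae (Eventually.of_forall fun y => ?_)
        simp [pval, mul_assoc, MvPolynomial.smul_eval]
      definite := fun u hu => by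
        have hu : ∫ y in Metric.ball (0 : Space d) 1, pval u.1 y * pval u.1 y = 0 := hu
        have hc : Continuous fun y => pval u.1 y * pval u.1 y :=
          (continuous_pval _).mul (continuous_pval _)
        rw [setIntegral_eq_zero_iff_of_nonneg_ae (Eventually.of_forall fun y => mul_self_nonneg _)
          (integrableOn_ball_of_continuous hc _ _)] at hu
        have h1 := Measure.eqOn_open_of_ae_eq hu Metric.isOpen_ball hc.continuousOn continuousOn_const
        exact Subtype.ext (eq_zero_of_pval_eq_zero one_pos fun x hx => mul_self_eq_zero.1 (h1 hx)) }
  have : CompactSpace (Metric.closedBall (0 : Space d) R) :=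
    isCompact_iff_compactSpace.1 (isCompact_closedBall _ _)
  let T : V →ₗ[ℝ] C(Metric.closedBall (0 : Space d) R, ℝ) :=
    { toFun := fun u => ⟨fun x => pval u.1 x, (continuous_pval _).comp continuous_subtype_val⟩
      map_add' := fun u v => by ext x; simp [pval]
      map_smul' := fun r u => by ext x; simp [pval, MvPolynomial.smul_eval] }
  obtain ⟨C, hC, h⟩ := exists_norm_sq_le_core core T
  refine ⟨C, hC, fun q hq x hx => ?_⟩
  have h1 := h ⟨q, (MvPolynomial.mem_restrictTotalDegree _ _ _).2 hq⟩
  have h2 := (T ⟨q, (MvPolynomial.mem_restrictTotalDegree _ _ _).2 hq⟩).norm_coe_le_norm ⟨x, hx⟩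
  have h3 : |pval q x| ≤ ‖T ⟨q, (MvPolynomial.mem_restrictTotalDegree _ _ _).2 hq⟩‖ := h2
  calc pval q x ^ 2 = |pval q x| ^ 2 := (sq_abs _).symm
    _ ≤ ‖T ⟨q, (MvPolynomial.mem_restrictTotalDegree _ _ _).2 hq⟩‖ ^ 2 := by gcongr
    _ ≤ _ := h1
    _ = _ := by
        congr 1
        refine integral_congr_ae (Eventually.of_forall fun y => ?_)
        exact (sq _).symm

theorem setIntegral_ball_eq {d : ℕ} (f : Space d → ℝ) (c : Space d) {r : ℝ} (hr : 0 < r) :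
    ∫ y in Metric.ball (0 : Space d) 1, f (c + r • y) = (r ^ d)⁻¹ * ∫ x in Metric.ball c r, f x := by
  rw [Measure.setIntegral_comp_smul_of_pos volume (fun y => f (c + y)) _ hr, smul_unitBall hr.ne',
    finrank_euclideanSpace_fin, smul_eq_mul, Real.norm_eq_abs, abs_of_pos hr]
  congr 1
  have h := (measurePreserving_add_left (volume : Measure (Space d)) c).setIntegral_preimage_emb
    (measurableEmbedding_addLeft c) f (Metric.ball c r)
  rw [← h]
  congr 2
  ext y
  simp

/-- A scaled inverse estimate: on concentric balls, the supremum of a polynomial is bounded by its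
mean square. -/
theorem exists_sq_le_integral_ball (d p : ℕ) (R : ℝ) :
    ∃ C > (0 : ℝ), ∀ q : MvPolynomial (Fin d) ℝ, q.totalDegree ≤ p → ∀ (c : Space d) (r : ℝ),
      0 < r → ∀ x ∈ Metric.closedBall c (R * r),
        pval q x ^ 2 ≤ C * ((r ^ d)⁻¹ * ∫ y in Metric.ball c r, pval q y ^ 2) := by
  obtain ⟨C, hC, h⟩ := exists_sq_le_integral_unit_ball d p R
  refine ⟨C, hC, fun q hq c r hr x hx => ?_⟩
  obtain ⟨q', hq', heq⟩ := exists_affine_subst q c r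
  have hx' : r⁻¹ • (x - c) ∈ Metric.closedBall (0 : Space d) R := by
    rw [mem_closedBall_zero_iff, norm_smul, norm_inv, Real.norm_eq_abs, abs_of_pos hr,
      inv_mul_le_iff₀ hr, ← dist_eq_norm, mul_comm]
    exact hx
  have h1 := h q' (hq'.trans hq) _ hx'
  simp only [heq] at h1
  rw [setIntegral_ball_eq (fun x => pval q x ^ 2) c hr, smul_inv_smul₀ hr.ne', add_sub_cancel] at h1
  exact h1

/-! ### Surface area bound and discrete trace inequality -/

/-- The surface area of a bounded polyhedron containing a ball is controlled by its volume. -/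
theorem mul_sum_surf_face_le {d : ℕ} {s : Finset (Space d × ℝ)} (hs : ∀ p ∈ s, ‖p.1‖ = 1)
    (hb : Bornology.IsBounded (cell s)) {c : Space d} {r : ℝ} (hr : 0 < r)
    (hball : Metric.ball c r ⊆ cell s) :
    r * ∑ p ∈ s, (surf d).real (closure (cell s) ∩ hyperplane p) ≤ d * volume.real (cell s) := by
  have hKm := (isOpen_cell s).measurableSet
  obtain ⟨R, hR⟩ := hb.exists_norm_le
  have hdiv : ∀ φ, IsTestFunction (cell s) φ →
      ∫ x in cell s, (fderiv ℝ φ x (x - c) + (d : ℝ) * φ x) = 0 := by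
    intro φ hφ
    have hφi : Integrable φ := hφ.1.continuous.integrable_of_hasCompactSupport hφ.2.1
    have hx : ∀ i : Fin d, Integrable fun x : Space d => (x i - c i) * pd i φ x := by
      intro i
      refine Continuous.integrable_of_hasCompactSupport ?_ (hφ.pd i).2.1.mul_left
      have := (hφ.pd i).1.continuous
      fun_prop
    have hx' : ∀ i : Fin d, Integrable fun x : Space d => (x i - c i) * φ x := by
      intro i
      refine Continuous.integrable_of_hasCompactSupport ?_ hφ.2.1.mul_left
      have := hφ.1.continuous
      fun_prop
    have hcoord : ∀ i : Fin d, ∫ x : Space d, (x i - c i) * pd i φ x = -∫ x, φ x := by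
      intro i
      have hd : ∀ x : Space d, HasFDerivAt (fun x : Space d => x i - c i)
          (EuclideanSpace.proj (𝕜 := ℝ) i) x := fun x =>
        (EuclideanSpace.proj (𝕜 := ℝ) i).hasFDerivAt.sub_const (c i)
      have hd1 : ∀ x : Space d, fderiv ℝ (fun x : Space d => x i - c i) x
          (EuclideanSpace.single i 1) = 1 := fun x => by rw [(hd x).fderiv]; simp
      have := integral_mul_fderiv_eq_neg_fderiv_mul_of_integrable (μ := volume)
        (f := fun x : Space d => x i - c i) (g := φ) (v := EuclideanSpace.single i 1)
        (by simpa only [hd1, one_mul] using hφi) (hx i) (hx' i)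
        (fun x _ => (hd x).differentiableAt) (fun x _ => hφ.1.differentiable (by simp) x)
      simpa only [hd1, one_mul, pd] using this
    rw [setIntegral_eq_integral_of_forall_compl_eq_zero]
    · simp_rw [fderiv_apply_eq_sum_pd, PiLp.sub_apply]
      rw [integral_add (integrable_finsetSum _ fun i _ => hx i) (hφi.const_mul _),
        integral_finsetSum _ fun i _ => hx i, integral_const_mul, Finset.sum_congr rfl
          fun i _ => hcoord i]
      simp
    · intro x hx
      have hx' : x ∉ tsupport φ := fun h => hx (hφ.2.2 h)
      rw [image_eq_zero_of_notMem_tsupport hx',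
        image_eq_zero_of_notMem_tsupport fun h => hx' (tsupport_fderiv_subset ℝ h)]
      simp
  -- The field x - c has divergence `d`, and `f = 1`. Taking the whole space for `Ω` keeps every
  -- face and makes the boundary condition vacuous.
  have hmain := integral_cell_divergence hs hb ⟨c, hball (Metric.mem_ball_self hr)⟩ isOpen_univ
    (subset_univ _) (G := fun x => x - c) (by fun_prop) (M := R + ‖c‖)
    (fun x hx => (norm_sub_le _ _).trans (by linarith [hR x hx])) (L := fun _ => (d : ℝ))
    (integrableOn_const hb.measure_lt_top.ne) hdiv (f := fun _ => 1) contDiff_const (fun p _ => by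
      rw [sdiff_univ, Measure.restrict_empty]; simp)
  have hl : ∫ x in cell s, (fderiv ℝ (fun _ : Space d => (1 : ℝ)) x (x - c) + (d : ℝ) * 1) =
      d * volume.real (cell s) := by
    simp [mul_comm]
  rw [← hl, hmain, Finset.mul_sum]
  refine Finset.sum_le_sum fun p hp => ?_
  -- On a face the flux of x - c is the constant distance of `c` from its hyperplane, at least `r`
  -- because the ball lies inside the cell.
  have hdist : r ≤ p.2 - inner ℝ p.1 c := by
    refine le_of_forall_lt fun t ht => ?_
    rcases lt_or_ge t 0 with h | h
    · have := hball (Metric.mem_ball_self hr) p hp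
      linarith
    · have h1 : c + t • p.1 ∈ Metric.ball c r := by
        rw [mem_ball_iff_norm, add_sub_cancel_left, norm_smul, hs p hp, mul_one, Real.norm_eq_abs,
          abs_of_nonneg h]
        exact ht
      have h2 := hball h1 p hp
      rw [inner_add_right, inner_smul_right, real_inner_self_eq_norm_sq, hs p hp] at h2
      linarith
  have hFm : MeasurableSet (closure (cell s) ∩ hyperplane p) :=
    (isClosed_closure.inter (isClosed_hyperplane p)).measurableSet
  have hFfin : surf d (closure (cell s) ∩ hyperplane p) < ⊤ :=
    surf_lt_top_of_subset_hyperplane (hs p hp) inter_subset_right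
      (hb.closure.subset inter_subset_left)
  have hconst : ∫ x in closure (cell s) ∩ hyperplane p ∩ univ, 1 * inner ℝ p.1 (x - c) ∂(surf d) =
      ∫ x in closure (cell s) ∩ hyperplane p, (p.2 - inner ℝ p.1 c) ∂(surf d) := by
    rw [inter_univ]
    refine setIntegral_congr_fun hFm fun x hx => ?_
    simp only [one_mul, inner_sub_right]
    rw [show inner ℝ p.1 x = p.2 from hx.2]
  rw [hconst, setIntegral_const, smul_eq_mul, mul_comm]
  exact mul_le_mul_of_nonneg_left hdist measureReal_nonneg

namespace Mesh

variable {d m : ℕ} {Ω : Set (Space d)} (T : Mesh d Ω m)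

/-- The facets are almost disjoint and contained in the union of the faces, so their total area is
at most that of the faces. -/
theorem mul_sum_surf_facet_le (hΩ : IsOpen Ω) (i : Fin m) {c : Space d} {r : ℝ} (hr : 0 < r)
    (hball : Metric.ball c r ⊆ T.K i) :
    r * ∑ j ∈ Finset.univ.erase i, (surf d).real (T.facet i j) ≤ d * volume.real (T.K i) := by
  obtain ⟨s, hs1, hs⟩ := (T.polytope i).exists_cell
  have hb := (T.polytope i).2.1
  have h1 : r * ∑ p ∈ s, (surf d).real (closure (T.K i) ∩ hyperplane p) ≤
      d * volume.real (T.K i) := by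
    rw [hs] at hball hb ⊢
    exact mul_sum_surf_face_le hs1 hb hr hball
  refine le_trans (mul_le_mul_of_nonneg_left ?_ hr.le) h1
  have hfin : ∀ p ∈ s, surf d (closure (T.K i) ∩ hyperplane p) ≠ ⊤ := fun p hp =>
    (surf_lt_top_of_subset_hyperplane (hs1 p hp) inter_subset_right
      (hb.closure.subset inter_subset_left)).ne
  have h2 : ∑ j ∈ Finset.univ.erase i, surf d (T.facet i j) ≤
      ∑ p ∈ s, surf d (closure (T.K i) ∩ hyperplane p) := by
    rw [← measure_biUnion_finset₀ (fun j hj k hk hjk => T.aedisjoint_facet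
      (Finset.ne_of_mem_erase hj).symm (Finset.ne_of_mem_erase hk).symm hjk)
      (fun j _ => (T.measurableSet_facet hΩ i j).nullMeasurableSet)]
    refine (measure_mono (iUnion₂_subset fun j hj => ?_)).trans (measure_biUnion_finset_le _ _)
    refine (T.facet_subset_iUnion (Finset.ne_of_mem_erase hj).symm hs).trans
      (iUnion₂_mono fun p _ => inter_subset_left)
  simp only [Measure.real]
  rw [← ENNReal.toReal_sum fun j hj => (T.surf_facet_lt_top (Finset.ne_of_mem_erase hj).symm).ne,
    ← ENNReal.toReal_sum hfin]
  exact ENNReal.toReal_mono (ENNReal.sum_ne_top.2 hfin) h2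

end Mesh

theorem Mesh.integrableOn_facet {d m : ℕ} {Ω : Set (Space d)} (T : Mesh d Ω m) (hΩ : IsOpen Ω)
    {i j : Fin m} (hij : i ≠ j) {f : Space d → ℝ} (hf : Continuous f) :
    IntegrableOn f (T.facet i j) (surf d) := by
  obtain ⟨C, hC⟩ := (T.isCompact_closure_K i).exists_bound_of_continuousOn hf.continuousOn
  exact integrableOn_of_continuousOn_of_bound (T.measurableSet_facet hΩ i j)
    (T.surf_facet_lt_top hij) hf.continuousOn fun x hx => hC x (T.facet_subset_closure i j hx)

theorem Mesh.integrableOn_K {d m : ℕ} {Ω : Set (Space d)} (T : Mesh d Ω m) (i : Fin m)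
    {f : Space d → ℝ} (hf : Continuous f) : IntegrableOn f (T.K i) :=
  (hf.continuousOn.integrableOn_compact (T.isCompact_closure_K i)).mono_set subset_closure

/-- The discrete trace inequality. -/
theorem exists_trace_inequality (d p : ℕ) (κ : ℝ) :
    ∃ C > (0 : ℝ), ∀ (Ω : Set (Space d)) (_ : IsOpen Ω) (m : ℕ) (T : Mesh d Ω m) (i : Fin m)
      (c : Space d) (r : ℝ) (_ : 0 < r) (_ : Metric.ball c r ⊆ T.K i) (_ : T.h i ≤ κ * r)
      (q : MvPolynomial (Fin d) ℝ) (_ : q.totalDegree ≤ p),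
      r * ∑ j ∈ Finset.univ.erase i, ∫ x in T.facet i j, pval q x ^ 2 ∂(surf d) ≤
        C * ∫ x in T.K i, pval q x ^ 2 := by
  obtain ⟨C, hC, h⟩ := exists_sq_le_integral_ball d p κ
  set B₁ := (volume : Measure (Space d)).real (Metric.ball 0 1)
  have hB₁ : 0 ≤ B₁ := measureReal_nonneg
  -- `C` is the inverse estimate on the inscribed ball and the other factor comes from area ≤ d|K|/r
  -- with `K` inside a ball of radius `κ * r`; the powers of `r` cancel. The absolute value and the
  -- added 1 make the constant positive before `κ ≥ 0` is known.
  refine ⟨C * (d * (|κ| ^ d * B₁)) + 1, by positivity, ?_⟩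
  intro Ω hΩ m T i c r hr hball hκ q hq
  have hc2 : Continuous fun x => pval q x ^ 2 := (continuous_pval q).pow 2
  have hcK : c ∈ T.K i := hball (Metric.mem_ball_self hr)
  have hKball : closure (T.K i) ⊆ Metric.closedBall c (κ * r) := by
    refine closure_minimal (fun x hx => ?_) Metric.isClosed_closedBall
    exact (Metric.dist_le_diam_of_mem (T.polytope i).2.1 hx hcK).trans hκ
  have hκr : 0 ≤ κ * r := Metric.diam_nonneg.trans hκ
  have hκ0 : 0 ≤ κ := nonneg_of_mul_nonneg_left hκr hr
  set I := ∫ x in T.K i, pval q x ^ 2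
  have hI : ∫ y in Metric.ball c r, pval q y ^ 2 ≤ I :=
    setIntegral_mono_set (T.integrableOn_K i hc2) (Eventually.of_forall fun x => sq_nonneg _)
      hball.eventuallyLE
  have hI0 : 0 ≤ I := integral_nonneg fun x => sq_nonneg _
  have hS : ∀ x ∈ closure (T.K i), pval q x ^ 2 ≤ C * ((r ^ d)⁻¹ * I) := fun x hx =>
    (h q hq c r hr x (hKball hx)).trans (by gcongr)
  have hfac : ∀ j ∈ Finset.univ.erase i, ∫ x in T.facet i j, pval q x ^ 2 ∂(surf d) ≤
      C * ((r ^ d)⁻¹ * I) * (surf d).real (T.facet i j) := by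
    intro j hj
    have hij := (Finset.ne_of_mem_erase hj).symm
    have := setIntegral_mono_on (T.integrableOn_facet hΩ hij hc2)
      (integrableOn_const (C := C * ((r ^ d)⁻¹ * I)) (T.surf_facet_lt_top hij).ne)
      (T.measurableSet_facet hΩ i j) fun x hx => hS x (T.facet_subset_closure i j hx)
    rwa [setIntegral_const, smul_eq_mul, mul_comm] at this
  have hvol : volume.real (T.K i) ≤ (κ * r) ^ d * B₁ := by
    have h1 := Measure.addHaar_real_closedBall (volume : Measure (Space d)) c hκr
    rw [finrank_euclideanSpace_fin] at h1
    rw [← h1]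
    exact measureReal_mono (subset_closure.trans hKball) measure_closedBall_lt_top.ne
  calc r * ∑ j ∈ Finset.univ.erase i, ∫ x in T.facet i j, pval q x ^ 2 ∂(surf d)
      ≤ r * ∑ j ∈ Finset.univ.erase i, C * ((r ^ d)⁻¹ * I) * (surf d).real (T.facet i j) :=
        mul_le_mul_of_nonneg_left (Finset.sum_le_sum hfac) hr.le
    _ = C * ((r ^ d)⁻¹ * I) * (r * ∑ j ∈ Finset.univ.erase i, (surf d).real (T.facet i j)) := by
        rw [← Finset.mul_sum]; ring
    _ ≤ C * ((r ^ d)⁻¹ * I) * (d * ((κ * r) ^ d * B₁)) := by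
        refine mul_le_mul_of_nonneg_left ((T.mul_sum_surf_facet_le hΩ i hr hball).trans ?_) ?_
        · exact mul_le_mul_of_nonneg_left hvol (Nat.cast_nonneg d)
        · positivity
    _ = C * (d * (|κ| ^ d * B₁)) * I := by
        rw [abs_of_nonneg hκ0, mul_pow]
        have : r ^ d ≠ 0 := (pow_pos hr d).ne'
        field_simp
    _ ≤ _ := by
        rw [add_mul, one_mul]
        linarith

/-! ### Coercivity of the interior penalty form -/

section Coercivity

variable {d m : ℕ} {Ω : Set (Space d)} (T : Mesh d Ω m)

theorem continuous_jump (w : PwPoly d m) (e : Fin m × Fin m) : Continuous (jump T w e) :=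
  ((continuous_pval _).smul continuous_const).add ((continuous_pval _).smul continuous_const)

theorem continuous_avgGrad (w : PwPoly d m) (e : Fin m × Fin m) : Continuous (avgGrad w e) :=
  ((continuous_pgrad (w e.1)).add (continuous_pgrad (w e.2))).const_smul (1 / 2 : ℝ)

theorem continuous_avg (w : PwPoly d m) (e : Fin m × Fin m) : Continuous (avg w e) :=
  ((continuous_pval _).add (continuous_pval _)).const_mul _

theorem continuous_ujump (w : PwPoly d m) (e : Fin m × Fin m) : Continuous (ujump w e) :=
  (continuous_pval _).sub (continuous_pval _)

theorem norm_avgGrad_sq_le (w : PwPoly d m) (e : Fin m × Fin m) (x : Space d) :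
    ‖avgGrad w e x‖ ^ 2 ≤ 1 / 2 * (‖pgrad (w e.1) x‖ ^ 2 + ‖pgrad (w e.2) x‖ ^ 2) := by
  rw [avgGrad, norm_smul, mul_pow]
  have h1 := parallelogram_law_with_norm ℝ (pgrad (w e.1) x) (pgrad (w e.2) x)
  have h2 : ‖(1 / 2 : ℝ)‖ ^ 2 = 1 / 4 := by norm_num
  rw [h2]
  nlinarith [sq_nonneg ‖pgrad (w e.1) x - pgrad (w e.2) x‖]

/-- Young's inequality for the consistency terms on a facet. -/
theorem sip_integrand_le {s : ℝ} (hs : 0 < s) (w : PwPoly d m) (e : Fin m × Fin m) (x : Space d) :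
    inner ℝ (jump T w e x) (avgGrad w e x) + inner ℝ (jump T w e x) (avgGrad w e x) -
        s * inner ℝ (jump T w e x) (jump T w e x) ≤
      -(1 / 2) * (s * ‖jump T w e x‖ ^ 2) +
        s⁻¹ * (‖pgrad (w e.1) x‖ ^ 2 + ‖pgrad (w e.2) x‖ ^ 2) := by
  have h1 := real_inner_le_norm (jump T w e x) (avgGrad w e x)
  have h2 := norm_avgGrad_sq_le w e x
  rw [real_inner_self_eq_norm_sq]
  set J := ‖jump T w e x‖
  set A := ‖avgGrad w e x‖
  set g := ‖pgrad (w e.1) x‖ ^ 2 + ‖pgrad (w e.2) x‖ ^ 2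
  -- The weights keep exactly half of the penalty; the remaining `2 * A ^ 2` matches the factor 1/2
  -- in `norm_avgGrad_sq_le`.
  have h3 : 2 * (J * A) ≤ 1 / 2 * (s * J ^ 2) + s⁻¹ * (2 * A ^ 2) := by
    have h4 : 1 / 2 * (s * J ^ 2) + s⁻¹ * (2 * A ^ 2) - 2 * (J * A) =
        1 / 2 * s * (J - 2 * s⁻¹ * A) ^ 2 := by
      field_simp
      ring
    have h5 : 0 ≤ 1 / 2 * s * (J - 2 * s⁻¹ * A) ^ 2 := by positivity
    linarith
  have h4 : s⁻¹ * (2 * A ^ 2) ≤ s⁻¹ * g :=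
    mul_le_mul_of_nonneg_left (by linarith) (inv_pos.2 hs).le
  linarith

theorem Mesh.h_pos (hd : 1 ≤ d) (i : Fin m) : 0 < T.h i := by
  obtain ⟨c, hc⟩ := (T.polytope i).1
  obtain ⟨ε, hε, hball⟩ := Metric.isOpen_iff.1 (T.isOpen_K i) c hc
  have hn : ‖(ε / 2) • (EuclideanSpace.single (⟨0, hd⟩ : Fin d) (1 : ℝ) : Space d)‖ = ε / 2 := by
    rw [norm_smul, PiLp.norm_single, norm_one, mul_one, Real.norm_eq_abs,
      abs_of_pos (half_pos hε)]
  have h1 : c + (ε / 2) • (EuclideanSpace.single (⟨0, hd⟩ : Fin d) (1 : ℝ) : Space d) ∈ T.K i :=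
    hball (by rw [mem_ball_iff_norm, add_sub_cancel_left, hn]; linarith)
  have h2 := Metric.dist_le_diam_of_mem (T.polytope i).2.1 h1 hc
  rw [dist_eq_norm, add_sub_cancel_left, hn] at h2
  exact (half_pos hε).trans_le h2

theorem Mesh.IsFacetSize.pos {T : Mesh d Ω m} {hE : Fin m → Fin m → ℝ} (h : T.IsFacetSize hE)
    (hd : 1 ≤ d) (i j : Fin m) : 0 < hE i j :=
  (lt_min (T.h_pos hd i) (T.h_pos hd j)).trans_le (h i j).1

/-- The discrete trace inequality for gradients of polynomials. -/
theorem exists_trace_inequality_grad (d p : ℕ) (κ : ℝ) :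
    ∃ C > (0 : ℝ), ∀ (Ω : Set (Space d)) (_ : IsOpen Ω) (m : ℕ) (T : Mesh d Ω m) (i : Fin m)
      (c : Space d) (r : ℝ) (_ : 0 < r) (_ : Metric.ball c r ⊆ T.K i) (_ : T.h i ≤ κ * r)
      (q : MvPolynomial (Fin d) ℝ) (_ : q.totalDegree ≤ p),
      r * ∑ j ∈ Finset.univ.erase i, ∫ x in T.facet i j, ‖pgrad q x‖ ^ 2 ∂(surf d) ≤
        C * ∫ x in T.K i, ‖pgrad q x‖ ^ 2 := by
  obtain ⟨C, hC, h⟩ := exists_trace_inequality d p κ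
  refine ⟨C, hC, ?_⟩
  intro Ω hΩ m T i c r hr hball hκ q hq
  have hc : ∀ k, Continuous fun x : Space d => pval (MvPolynomial.pderiv k q) x ^ 2 := fun k =>
    (continuous_pval _).pow 2
  simp_rw [norm_pgrad_sq]
  rw [integral_finsetSum _ fun k _ => T.integrableOn_K i (hc k),
    Finset.sum_congr rfl fun j hj => integral_finsetSum (μ := (surf d).restrict (T.facet i j)) _
      fun k _ => T.integrableOn_facet hΩ (Finset.ne_of_mem_erase hj).symm (hc k), Finset.sum_comm,
    Finset.mul_sum, Finset.mul_sum]
  exact Finset.sum_le_sum fun k _ => h Ω hΩ m T i c r hr hball hκ _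
    ((totalDegree_pderiv_le k q).trans hq)

/-- Coercivity of the symmetric interior penalty form. -/
theorem exists_coercivity (d p : ℕ) (hd : 1 ≤ d) (κ : ℝ) :
    ∃ σhat > (0 : ℝ), ∀ (Ω : Set (Space d)) (_ : IsOpen Ω) (m : ℕ) (T : Mesh d Ω m)
      (_ : T.ShapeRegular κ) (hE : Fin m → Fin m → ℝ) (_ : T.IsFacetSize hE) (σ : ℝ)
      (_ : σhat ≤ σ), ∀ w ∈ dgSpace T p,
        1 / 2 * sipNormSq T hE σ w ≤ aForm T hE σ w w := by
  -- `κ` is an arbitrary real number; `A ≥ 1` also covers the comparison of an element's diameter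
  -- with itself.
  set A := max 1 |κ| with hA
  have hA1 : 1 ≤ A := le_max_left _ _
  have hκA : κ ≤ A := (le_abs_self κ).trans (le_max_right _ _)
  obtain ⟨C, hC, htrace⟩ := exists_trace_inequality_grad d p A
  -- One factor `A` compares the facet size with the diameter of either neighbour, the other
  -- compares that diameter with the inner radius, and `C` is the trace constant. The factor 2
  -- leaves half of the volume term.
  refine ⟨2 * (A * A * C) + 1, by positivity, ?_⟩
  intro Ω hΩ m T hreg hE hhE σ hσ w hw
  have hσ0 : 0 < σ := lt_of_lt_of_le (by positivity) hσ
  have hEpos := hhE.pos hd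
  choose c r hr hball hhr using hreg.1
  have hhr' : ∀ i, T.h i ≤ A * r i := fun i =>
    (hhr i).trans (mul_le_mul_of_nonneg_right hκA (hr i).le)
  set g : Fin m → Space d → ℝ := fun i x => ‖pgrad (w i) x‖ ^ 2 with hg
  have hgc : ∀ i, Continuous (g i) := fun i => (continuous_pgrad _).norm.pow 2
  have hg0 : ∀ i x, 0 ≤ g i x := fun i x => sq_nonneg _
  set V := ∑ i, ∫ x in T.K i, g i x with hV
  set cc : Fin m → Fin m → ℝ := fun i j => A * A * r i * ∫ x in T.facet i j, g i x ∂(surf d)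
  have hne : ∀ e ∈ Mesh.pairs m, e.1 ≠ e.2 := fun e he => by
    rw [Mesh.pairs, Finset.mem_filter] at he
    exact he.2.ne
  -- facet sizes are comparable to the inner radii
  have hsize : ∀ i j, i ≠ j → hE i j * ∫ x in T.facet i j, g i x ∂(surf d) ≤ cc i j ∧
      hE i j * ∫ x in T.facet i j, g j x ∂(surf d) ≤ cc j i := by
    intro i j hij
    -- Shape regularity compares diameters only across facets of positive measure; on the others
    -- both integrals vanish.
    by_cases h0 : surf d (T.facet i j) = 0
    · have h0' : surf d (T.facet j i) = 0 := by rw [T.facet_comm]; exact h0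
      simp only [cc, Measure.restrict_eq_zero.2 h0, Measure.restrict_eq_zero.2 h0',
        integral_zero_measure, mul_zero, le_refl, and_self]
    · have hpos : 0 < surf d (T.facet i j) := pos_iff_ne_zero.2 h0
      have hpos' : 0 < surf d (T.facet j i) := by rw [T.facet_comm]; exact hpos
      have h1 := hreg.2 i j hij hpos
      have h2 := hreg.2 j i hij.symm hpos'
      have hi := T.h_pos hd i
      have hj := T.h_pos hd j
      have hmax := (hhE i j).2
      have h3 : hE i j ≤ A * A * r i := by
        refine hmax.trans (le_trans (max_le ?_ ?_)
          (show A * T.h i ≤ A * A * r i by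
            rw [mul_assoc]; exact mul_le_mul_of_nonneg_left (hhr' i) (by linarith)))
        · exact le_mul_of_one_le_left hi.le hA1
        · exact h2.trans (mul_le_mul_of_nonneg_right hκA hi.le)
      have h4 : hE i j ≤ A * A * r j := by
        refine hmax.trans (le_trans (max_le ?_ ?_)
          (show A * T.h j ≤ A * A * r j by
            rw [mul_assoc]; exact mul_le_mul_of_nonneg_left (hhr' j) (by linarith)))
        · exact h1.trans (mul_le_mul_of_nonneg_right hκA hj.le)
        · exact le_mul_of_one_le_left hj.le hA1
      refine ⟨mul_le_mul_of_nonneg_right h3 (integral_nonneg fun x => hg0 _ _), ?_⟩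
      simp only [cc]
      rw [T.facet_comm j i]
      exact mul_le_mul_of_nonneg_right h4 (integral_nonneg fun x => hg0 _ _)
  have hcc : ∑ e ∈ Mesh.pairs m, (cc e.1 e.2 + cc e.2 e.1) ≤ A * A * C * V := by
    rw [← Mesh.sum_erase_eq_sum_pairs, hV, Finset.mul_sum]
    refine Finset.sum_le_sum fun i _ => ?_
    have := htrace Ω hΩ m T i (c i) (r i) (hr i) (hball i) (hhr' i) (w i) (hw i).1
    calc ∑ j ∈ Finset.univ.erase i, cc i j
        = A * A * (r i * ∑ j ∈ Finset.univ.erase i, ∫ x in T.facet i j, g i x ∂(surf d)) := by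
          simp only [cc]; rw [← Finset.mul_sum]; ring
      _ ≤ A * A * (C * ∫ x in T.K i, g i x) :=
          mul_le_mul_of_nonneg_left this (by positivity)
      _ = _ := by ring
  have hfacet : ∀ e ∈ Mesh.pairs m,
      ∫ x in T.facet e.1 e.2, (inner ℝ (jump T w e x) (avgGrad w e x) +
        inner ℝ (jump T w e x) (avgGrad w e x) -
        σ / hE e.1 e.2 * inner ℝ (jump T w e x) (jump T w e x)) ∂(surf d) ≤
      -(1 / 2) * (∫ x in T.facet e.1 e.2, σ / hE e.1 e.2 * ‖jump T w e x‖ ^ 2 ∂(surf d)) +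
        σ⁻¹ * (cc e.1 e.2 + cc e.2 e.1) := by
    intro e he
    have hij := hne e he
    have hs : 0 < σ / hE e.1 e.2 := div_pos hσ0 (hEpos _ _)
    have hJ := continuous_jump T w e
    have hAv := continuous_avgGrad w e
    have hi1 : IntegrableOn (fun x => σ / hE e.1 e.2 * ‖jump T w e x‖ ^ 2) (T.facet e.1 e.2)
        (surf d) := T.integrableOn_facet hΩ hij ((hJ.norm.pow 2).const_mul _)
    have hi2 : ∀ k, IntegrableOn (g k) (T.facet e.1 e.2) (surf d) := fun k =>
      T.integrableOn_facet hΩ hij (hgc k)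
    have hi3 : IntegrableOn (fun x => (σ / hE e.1 e.2)⁻¹ * (g e.1 x + g e.2 x)) (T.facet e.1 e.2)
        (surf d) := ((hi2 e.1).add (hi2 e.2)).const_mul _
    calc _ ≤ ∫ x in T.facet e.1 e.2, (-(1 / 2) * (σ / hE e.1 e.2 * ‖jump T w e x‖ ^ 2) +
            (σ / hE e.1 e.2)⁻¹ * (g e.1 x + g e.2 x)) ∂(surf d) := by
          refine setIntegral_mono (T.integrableOn_facet hΩ hij
            (((hJ.inner hAv).add (hJ.inner hAv)).sub ((hJ.inner hJ).const_mul _)))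
            ((hi1.const_mul _).add (((hi2 _).add (hi2 _)).const_mul _))
            fun x => sip_integrand_le T hs w e x
      _ = -(1 / 2) * (∫ x in T.facet e.1 e.2, σ / hE e.1 e.2 * ‖jump T w e x‖ ^ 2 ∂(surf d)) +
            σ⁻¹ * (hE e.1 e.2 * (∫ x in T.facet e.1 e.2, g e.1 x ∂(surf d)) +
              hE e.1 e.2 * ∫ x in T.facet e.1 e.2, g e.2 x ∂(surf d)) := by
          rw [integral_add (hi1.const_mul _) hi3,
            integral_const_mul, integral_const_mul, integral_const_mul, integral_add (hi2 _) (hi2 _), inv_div]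
          ring
      _ ≤ _ := by
          have := hsize e.1 e.2 hij
          have hσi : 0 ≤ σ⁻¹ := (inv_pos.2 hσ0).le
          have := mul_le_mul_of_nonneg_left (add_le_add this.1 this.2) hσi
          linarith
  have hsum := Finset.sum_le_sum hfacet
  rw [Finset.sum_add_distrib, ← Finset.mul_sum, ← Finset.mul_sum] at hsum
  have hV0 : 0 ≤ V := Finset.sum_nonneg fun i _ => integral_nonneg fun x => hg0 _ _
  have hsmall : σ⁻¹ * ∑ e ∈ Mesh.pairs m, (cc e.1 e.2 + cc e.2 e.1) ≤ 1 / 2 * V := by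
    rw [inv_mul_le_iff₀ hσ0]
    refine hcc.trans ?_
    nlinarith [mul_le_mul_of_nonneg_right hσ hV0]
  have hVeq : ∑ i, ∫ x in T.K i, inner ℝ (pgrad (w i) x) (pgrad (w i) x) = V := by
    simp only [real_inner_self_eq_norm_sq, hV, hg]
  rw [aForm, sipNormSq, hVeq, intFacets, intFacets]
  linarith

end Coercivity

/-! ### Energy identity for the upwind form -/

section Upwind

variable {d m : ℕ} {Ω : Set (Space d)} (T : Mesh d Ω m)

theorem integrableOn_facet_gradNormal (hΩ : IsOpen Ω) {ψ : Space d → ℝ} (hψ : MemW2Inf Ω ψ)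
    {e : Fin m × Fin m} (he : e.1 ≠ e.2) {f : Space d → ℝ} (hf : Continuous f) :
    IntegrableOn (fun x => f x * gradNormal T ψ e x) (T.facet e.1 e.2) (surf d) := by
  obtain ⟨M, hM⟩ := hψ.exists_bound_weakGradient hΩ
  obtain ⟨C, hC⟩ := (T.isCompact_closure_K e.1).exists_bound_of_continuousOn hf.continuousOn
  have hG := (hψ.isContinuousWeakGradient hΩ).1
  refine integrableOn_of_continuousOn_of_bound (T.measurableSet_facet hΩ _ _)
    (T.surf_facet_lt_top he) (C := C * M)
    (hf.continuousOn.mul ((hG.mono inter_subset_right).inner continuousOn_const)) fun x hx => ?_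
  have hx' := T.facet_subset_closure _ _ hx
  rw [abs_mul]
  refine mul_le_mul (hC x hx') ?_ (abs_nonneg _) ((norm_nonneg _).trans (hC x hx'))
  refine (abs_real_inner_le_norm _ _).trans ?_
  rw [(T.normal_spec he).1, mul_one]
  exact hM x hx.2

/-- The energy identity for the upwind form. -/
theorem bForm_self (hΩ : IsOpen Ω) {p : ℕ} {μ : ℝ} {ψ : Space d → ℝ} (hψ : MemW2Inf Ω ψ)
    {w : PwPoly d m} (hw : w ∈ dgSpace T p) :
    bForm T μ ψ w w = ∑ i, (-(1 / 2) * ∫ x in T.K i, pval (w i) x ^ 2 * weakLaplacian Ω ψ x) +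
      μ / 2 * upwindNormSq T ψ w := by
  obtain ⟨M, hM⟩ := hψ.exists_bound_weakGradient hΩ
  have hG := (hψ.isContinuousWeakGradient hΩ).1
  have hL : IntegrableOn (weakLaplacian Ω ψ) Ω := by
    have : IsFiniteMeasure (volume.restrict Ω) := ⟨by
      rw [Measure.restrict_apply_univ]; exact T.isBounded.measure_lt_top⟩
    exact MemLp.integrable le_top (hψ.memLInf_weakLaplacian hΩ)
  set f : Fin m → Space d → ℝ := fun i x => 1 / 2 * pval (w i) x ^ 2 with hf
  have hfs : ∀ i, ContDiff ℝ ∞ (f i) := fun i => contDiff_const.mul ((contDiff_pval _).pow 2)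
  have hfd : ∀ i x v, fderiv ℝ (f i) x v = pval (w i) x * inner ℝ (pgrad (w i) x) v := by
    intro i x v
    have h1 := ((hasFDerivAt_pval (w i) x).pow 2).const_mul (1 / 2 : ℝ)
    have h2 : HasFDerivAt (f i) _ x := h1
    rw [h2.fderiv]
    simp only [_root_.smul_apply, innerSL_apply_apply, smul_eq_mul, nsmul_eq_mul]
    norm_num
    ring
  have hterm : ∀ i, ∫ x in T.K i, inner ℝ (pval (w i) x • weakGradient Ω ψ x) (pgrad (w i) x) =
      -(1 / 2) * (∫ x in T.K i, pval (w i) x ^ 2 * weakLaplacian Ω ψ x) +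
      ∑ j ∈ Finset.univ.erase i, ∫ x in T.facet i j,
        f i x * inner ℝ (T.normal i j) (weakGradient Ω ψ x) ∂(surf d) := by
    intro i
    have hKm := (T.isOpen_K i).measurableSet
    have hdiv := T.integral_element_divergence hΩ i hG hM hL
      (fun φ hφ => hψ.integral_weakGradient_add hΩ hφ) (hfs i) (by
        filter_upwards [(hw i).2] with x hx
        simp [hf, hx])
    obtain ⟨C, hC⟩ := (T.isCompact_closure_K i).exists_bound_of_continuousOn
      (hfs i).continuous.continuousOn
    have hI2 : IntegrableOn (fun x => weakLaplacian Ω ψ x * f i x) (T.K i) :=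
      (hL.mono_set (T.subset i)).mul_bdd (c := C)
        ((hfs i).continuous.aestronglyMeasurable)
        ((ae_restrict_iff' hKm).2 (Eventually.of_forall fun x hx => hC x (subset_closure hx)))
    obtain ⟨D, hD⟩ := (T.isCompact_closure_K i).exists_bound_of_continuousOn
      ((hfs i).continuous_fderiv (by simp)).continuousOn
    have hI1 : IntegrableOn (fun x => fderiv ℝ (f i) x (weakGradient Ω ψ x)) (T.K i) := by
      refine integrableOn_of_continuousOn_of_bound hKm (T.polytope i).2.1.measure_lt_top
        (((hfs i).continuous_fderiv (by simp)).continuousOn.clm_apply (hG.mono (T.subset i)))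
        (C := D * M) fun x hx => ?_
      exact ((fderiv ℝ (f i) x).le_opNorm _).trans (mul_le_mul (hD x (subset_closure hx))
        (hM x (T.subset i hx)) (norm_nonneg _) ((norm_nonneg _).trans (hD x (subset_closure hx))))
    rw [← hdiv, integral_add hI1 hI2, ← integral_const_mul]
    have h1 : ∫ x in T.K i, inner ℝ (pval (w i) x • weakGradient Ω ψ x) (pgrad (w i) x) =
        ∫ x in T.K i, fderiv ℝ (f i) x (weakGradient Ω ψ x) := by
      refine integral_congr_ae (Eventually.of_forall fun x => ?_)
      simp only [hfd, real_inner_smul_left]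
      rw [real_inner_comm]
    have h2 : ∫ x in T.K i, weakLaplacian Ω ψ x * f i x =
        -∫ x in T.K i, -(1 / 2) * (pval (w i) x ^ 2 * weakLaplacian Ω ψ x) := by
      rw [← integral_neg]
      refine integral_congr_ae (Eventually.of_forall fun x => ?_)
      simp only [hf]
      ring
    rw [h1, h2]
    ring
  have hne : ∀ e ∈ Mesh.pairs m, e.1 ≠ e.2 := fun e he => by
    rw [Mesh.pairs, Finset.mem_filter] at he
    exact he.2.ne
  have hfacet : ∀ e ∈ Mesh.pairs m,
      (∫ x in T.facet e.1 e.2, f e.1 x * inner ℝ (T.normal e.1 e.2) (weakGradient Ω ψ x) ∂(surf d)) +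
        (∫ x in T.facet e.2 e.1, f e.2 x * inner ℝ (T.normal e.2 e.1) (weakGradient Ω ψ x)
          ∂(surf d)) -
      ∫ x in T.facet e.1 e.2, (gradNormal T ψ e x * avg w e x * ujump w e x -
        μ / 2 * |gradNormal T ψ e x| * ujump w e x * ujump w e x) ∂(surf d) =
      μ / 2 * ∫ x in T.facet e.1 e.2, (Real.sqrt |gradNormal T ψ e x| * ujump w e x) ^ 2
        ∂(surf d) := by
    intro e he
    have hij := hne e he
    rw [T.facet_comm e.2 e.1]
    -- Opposite normals are guaranteed only on facets of positive measure.
    by_cases h0 : surf d (T.facet e.1 e.2) = 0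
    · simp [Measure.restrict_eq_zero.2 h0]
    rw [T.normal_symm hij h0]
    have hi := fun {f : Space d → ℝ} (hf : Continuous f) =>
      integrableOn_facet_gradNormal T hΩ hψ hij hf
    have hI1 := hi (hfs e.1).continuous
    have hI2 := hi (hfs e.2).continuous
    have hI3 : IntegrableOn (fun x => avg w e x * ujump w e x * gradNormal T ψ e x)
        (T.facet e.1 e.2) (surf d) := hi ((continuous_avg w e).mul (continuous_ujump w e))
    have hI4 : IntegrableOn (fun x => (Real.sqrt |gradNormal T ψ e x| * ujump w e x) ^ 2)
        (T.facet e.1 e.2) (surf d) := by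
      refine (hi ((continuous_ujump w e).pow 2)).abs.congr (Eventually.of_forall fun x => ?_)
      simp only
      rw [mul_pow, Real.sq_sqrt (abs_nonneg _), abs_mul, Pi.pow_apply,
        abs_of_nonneg (sq_nonneg _), mul_comm]
    have e1 : ∫ x in T.facet e.1 e.2, f e.1 x * inner ℝ (T.normal e.1 e.2) (weakGradient Ω ψ x)
        ∂(surf d) = ∫ x in T.facet e.1 e.2, f e.1 x * gradNormal T ψ e x ∂(surf d) :=
      integral_congr_ae (Eventually.of_forall fun x => by
        simp only [gradNormal]; rw [real_inner_comm])
    have e2 : ∫ x in T.facet e.1 e.2, f e.2 x * inner ℝ (-T.normal e.1 e.2) (weakGradient Ω ψ x)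
        ∂(surf d) = -∫ x in T.facet e.1 e.2, f e.2 x * gradNormal T ψ e x ∂(surf d) := by
      rw [← integral_neg]
      refine integral_congr_ae (Eventually.of_forall fun x => ?_)
      simp only [gradNormal]
      rw [inner_neg_left, real_inner_comm, mul_neg]
    have e3 : ∫ x in T.facet e.1 e.2, (gradNormal T ψ e x * avg w e x * ujump w e x -
        μ / 2 * |gradNormal T ψ e x| * ujump w e x * ujump w e x) ∂(surf d) =
        (∫ x in T.facet e.1 e.2, avg w e x * ujump w e x * gradNormal T ψ e x ∂(surf d)) -
        μ / 2 * ∫ x in T.facet e.1 e.2, (Real.sqrt |gradNormal T ψ e x| * ujump w e x) ^ 2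
          ∂(surf d) := by
      rw [← integral_const_mul, ← integral_sub hI3 (hI4.const_mul _)]
      refine integral_congr_ae (Eventually.of_forall fun x => ?_)
      simp only
      rw [mul_pow, Real.sq_sqrt (abs_nonneg _)]
      ring
    -- The cancellation: average times jump is the jump of w²/2, so the centred flux equals the sum
    -- of the two boundary terms.
    have e4 : ∫ x in T.facet e.1 e.2, avg w e x * ujump w e x * gradNormal T ψ e x ∂(surf d) =
        (∫ x in T.facet e.1 e.2, f e.1 x * gradNormal T ψ e x ∂(surf d)) -
          ∫ x in T.facet e.1 e.2, f e.2 x * gradNormal T ψ e x ∂(surf d) := by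
      rw [← integral_sub hI1 hI2]
      refine integral_congr_ae (Eventually.of_forall fun x => ?_)
      simp only [hf, avg, ujump]
      ring
    rw [e1, e2, e3, e4]
    ring
  rw [bForm, intFacets, upwindNormSq, intFacets, Finset.sum_congr rfl fun i _ => hterm i,
    Finset.sum_add_distrib, Mesh.sum_erase_eq_sum_pairs, add_sub_assoc, ← Finset.sum_sub_distrib,
    Finset.sum_congr rfl hfacet, Finset.mul_sum]

end Upwind

/-! ### The energy inequality for one time step -/

section Stability

variable {d m : ℕ} {Ω : Set (Space d)} (T : Mesh d Ω m)

theorem pval_neg (q : MvPolynomial (Fin d) ℝ) (x : Space d) : pval (-q) x = -pval q x := by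
  simp [pval]

theorem pgrad_neg (q : MvPolynomial (Fin d) ℝ) (x : Space d) : pgrad (-q) x = -pgrad q x := by
  ext i
  simp [pgrad, pval]

theorem toFun_neg (v : PwPoly d m) (x : Space d) : toFun T (-v) x = -toFun T v x := by
  rw [toFun, toFun, ← Finset.sum_neg_distrib]
  refine Finset.sum_congr rfl fun i _ => ?_
  by_cases hx : x ∈ T.K i
  · simp [hx, pval_neg]
  · simp [hx]

theorem ip_neg_right (w v : PwPoly d m) : ip T w (-v) = -ip T w v := by
  simp only [ip, toFun_neg, mul_neg, integral_neg]

theorem jump_neg (v : PwPoly d m) (e : Fin m × Fin m) (x : Space d) :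
    jump T (-v) e x = -jump T v e x := by
  simp only [jump, Pi.neg_apply, pval_neg, neg_smul, neg_add]

theorem avgGrad_neg (v : PwPoly d m) (e : Fin m × Fin m) (x : Space d) :
    avgGrad (-v) e x = -avgGrad v e x := by
  simp only [avgGrad, Pi.neg_apply, pgrad_neg, ← neg_add, smul_neg]

theorem ujump_neg (v : PwPoly d m) (e : Fin m × Fin m) (x : Space d) :
    ujump (-v) e x = -ujump v e x := by
  simp only [ujump, Pi.neg_apply, pval_neg]
  ring

theorem intFacets_neg (F : Fin m × Fin m → Space d → ℝ) :
    intFacets T (fun e x => -F e x) = -intFacets T F := by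
  simp only [intFacets, integral_neg, Finset.sum_neg_distrib]

theorem aForm_neg_right (hE : Fin m → Fin m → ℝ) (σ : ℝ) (w v : PwPoly d m) :
    aForm T hE σ w (-v) = -aForm T hE σ w v := by
  have h1 : ∀ i, ∫ x in T.K i, inner ℝ (pgrad (w i) x) (pgrad ((-v) i) x) =
      -∫ x in T.K i, inner ℝ (pgrad (w i) x) (pgrad (v i) x) := fun i => by
    simp only [Pi.neg_apply, pgrad_neg, inner_neg_right, integral_neg]
  rw [aForm, aForm, Finset.sum_congr rfl fun i _ => h1 i, Finset.sum_neg_distrib, neg_sub',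
    ← intFacets_neg]
  congr 2
  ext e x
  simp only [jump_neg, avgGrad_neg, inner_neg_left, inner_neg_right]
  ring

theorem bForm_neg_right (μ : ℝ) (ψ : Space d → ℝ) (w v : PwPoly d m) :
    bForm T μ ψ w (-v) = -bForm T μ ψ w v := by
  have h1 : ∀ i, ∫ x in T.K i, inner ℝ (pval (w i) x • weakGradient Ω ψ x) (pgrad ((-v) i) x) =
      -∫ x in T.K i, inner ℝ (pval (w i) x • weakGradient Ω ψ x) (pgrad (v i) x) := fun i => by
    simp only [Pi.neg_apply, pgrad_neg, inner_neg_right, integral_neg]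
  rw [bForm, bForm, Finset.sum_congr rfl fun i _ => h1 i, Finset.sum_neg_distrib, neg_sub',
    ← intFacets_neg]
  congr 2
  ext e x
  simp only [ujump_neg]
  ring

/-- With `v = 0` the increment is `-u n`, so oddness in the second argument is all the linearity
that is needed. Unlike additivity, it requires no integrability. -/
theorem AForm_neg_right (hE : Fin m → Fin m → ℝ) (σ μ τ : ℝ) (ψ : Space d → ℝ) (w v : PwPoly d m) :
    AForm T hE σ μ τ ψ w (-v) = -AForm T hE σ μ τ ψ w v := by
  rw [AForm, AForm, ip_neg_right, aForm_neg_right, bForm_neg_right]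
  ring

theorem integrableOn_toFun_mul (w v : PwPoly d m) :
    IntegrableOn (fun x => toFun T w x * toFun T v x) Ω := by
  have hb : ∀ w : PwPoly d m, Measurable (toFun T w) ∧ ∃ C, ∀ x, |toFun T w x| ≤ C := by
    intro w
    choose C hC using fun i => (T.isCompact_closure_K i).exists_bound_of_continuousOn
      (continuous_pval (w i)).continuousOn
    refine ⟨Finset.measurable_fun_sum _ fun i _ =>
      (continuous_pval (w i)).measurable.indicator (T.isOpen_K i).measurableSet, ∑ i, |C i|,
      fun x => (Finset.abs_sum_le_sum_abs _ _).trans (Finset.sum_le_sum fun i _ => ?_)⟩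
    by_cases hx : x ∈ T.K i
    · rw [indicator_of_mem hx]
      exact (hC i x (subset_closure hx)).trans (le_abs_self _)
    · rw [indicator_of_notMem hx, abs_zero]
      exact abs_nonneg _
  obtain ⟨hw, C, hC⟩ := hb w
  obtain ⟨hv, D, hD⟩ := hb v
  refine IntegrableOn.of_bound T.isBounded.measure_lt_top (hw.mul hv).aestronglyMeasurable (C * D)
    (Eventually.of_forall fun x => ?_)
  rw [norm_mul]
  exact mul_le_mul (hC x) (hD x) (abs_nonneg _) ((abs_nonneg _).trans (hC x))

theorem normSq_eq_ip (w : PwPoly d m) : normSq T w = ip T w w := by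
  simp only [normSq, ip, sq]

theorem ip_le (w v : PwPoly d m) :
    ip T w v ≤ 1 / 2 * normSq T w + 1 / 2 * normSq T v := by
  have hww := integrableOn_toFun_mul T w w
  have hvv := integrableOn_toFun_mul T v v
  rw [normSq_eq_ip, normSq_eq_ip, ip, ip, ip, ← integral_const_mul, ← integral_const_mul,
    ← integral_add (hww.const_mul _) (hvv.const_mul _)]
  refine integral_mono (integrableOn_toFun_mul T w v) ((hww.const_mul _).add (hvv.const_mul _))
    fun x => ?_
  simp only
  nlinarith [sq_nonneg (toFun T w x - toFun T v x)]

theorem intFacets_nonneg {F : Fin m × Fin m → Space d → ℝ} (h : ∀ e x, 0 ≤ F e x) :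
    0 ≤ intFacets T F :=
  Finset.sum_nonneg fun e _ => integral_nonneg fun x => h e x

theorem sipNormSq_nonneg {hE : Fin m → Fin m → ℝ} (hhE : T.IsFacetSize hE) {σ : ℝ} (hσ : 0 ≤ σ)
    (w : PwPoly d m) : 0 ≤ sipNormSq T hE σ w := by
  refine add_nonneg (Finset.sum_nonneg fun i _ => integral_nonneg fun x => sq_nonneg _)
    (intFacets_nonneg T fun e x => mul_nonneg (div_nonneg hσ ?_) (sq_nonneg _))
  exact (le_min Metric.diam_nonneg Metric.diam_nonneg).trans (hhE e.1 e.2).1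

theorem upwindNormSq_nonneg (ψ : Space d → ℝ) (w : PwPoly d m) : 0 ≤ upwindNormSq T ψ w :=
  intFacets_nonneg T fun _ _ => sq_nonneg _

/-- One step of the constrained scheme, tested with `v = 0`. -/
theorem IsConstrainedSolution.energy_le {T : Mesh d Ω m} {p : ℕ} {hE : Fin m → Fin m → ℝ}
    {σ μ τ : ℝ} {ψ : Space d → ℝ} {nodes : Fin m → Finset (Space d)} {M : ℝ} {N : ℕ}
    {u : ℕ → PwPoly d m} (hu : IsConstrainedSolution T p hE σ μ τ ψ nodes M N u)
    (hM : 0 ≤ M) {n : ℕ} (h1 : 1 ≤ n) (hn : n ≤ N) :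
    1 / 2 * normSq T (u n) + τ * (aForm T hE σ (u n) (u n) + bForm T μ ψ (u n) (u n)) ≤
      1 / 2 * normSq T (u (n - 1)) := by
  have h0 : (0 : PwPoly d m) ∈ dgSpacePos T p nodes M :=
    ⟨fun i => ⟨by simp, Eventually.of_forall fun x => by simp [pval]⟩,
      fun i z _ => by simpa [pval] using hM⟩
  have h2 := (hu.2 n h1 hn).2 0 h0
  rw [zero_sub, AForm_neg_right, ip_neg_right, AForm, ← normSq_eq_ip] at h2
  have h3 := ip_le T (u (n - 1)) (u n)
  linarith

end Stability

end DriftDiffusion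

/-! ### Discrete stability -/

theorem mainTheorem2 (d p : ℕ) (hd1 : 1 ≤ d) (hd3 : d ≤ 3) (κ : ℝ) :
    ∃ σhat > (0 : ℝ), ∃ Csip > (0 : ℝ),
      ∀ (Ω : Set (DriftDiffusion.Space d)) (_ : IsOpen Ω) (m : ℕ)
        (T : DriftDiffusion.Mesh d Ω m) (_ : T.ShapeRegular κ)
        (hE : Fin m → Fin m → ℝ) (_ : T.IsFacetSize hE) (σ : ℝ) (_ : σhat ≤ σ),
        (∀ w ∈ DriftDiffusion.dgSpace T p,
          DriftDiffusion.aForm T hE σ w w ≥ Csip * DriftDiffusion.sipNormSq T hE σ w) ∧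
        ∀ (μ τ : ℝ) (_ : 0 < μ) (_ : 0 < τ)
          (ψ : DriftDiffusion.Space d → ℝ) (_ : DriftDiffusion.MemW2Inf Ω ψ)
          (u₀ : DriftDiffusion.Space d → ℝ) (_ : DriftDiffusion.MemLInf Ω u₀)
          (_ : ∀ᵐ x ∂(volume.restrict Ω), 0 ≤ u₀ x)
          (nodes : Fin m → Finset (DriftDiffusion.Space d))
          (_ : DriftDiffusion.IsNodeFamily T p nodes)
          (N : ℕ) (u : ℕ → DriftDiffusion.PwPoly d m)
          (_ : DriftDiffusion.IsConstrainedSolution T p hE σ μ τ ψ nodes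
            (DriftDiffusion.normLInf Ω u₀) N u),
          (∀ n, 1 ≤ n → n ≤ N →
            1 / 2 * DriftDiffusion.normSq T (u n) ≤
              1 / 2 * DriftDiffusion.normSq T (u (n - 1))
                - τ * Csip * DriftDiffusion.sipNormSq T hE σ (u n)
                - τ * μ / 2 * DriftDiffusion.upwindNormSq T ψ (u n)
                - τ * ∑ i, (-(1 / 2) * ∫ x in T.K i,
                    (DriftDiffusion.pval (u n i) x) ^ 2 * DriftDiffusion.weakLaplacian Ω ψ x)) ∧
          ((∀ᵐ x ∂(volume.restrict Ω), DriftDiffusion.weakLaplacian Ω ψ x ≤ 0) →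
            AntitoneOn (fun n => DriftDiffusion.normSq T (u n)) (Set.Iic N)) := by
  obtain ⟨σhat, hσhat, hcoer⟩ := DriftDiffusion.exists_coercivity d p hd1 κ
  refine ⟨σhat, hσhat, 1 / 2, by norm_num, ?_⟩
  intro Ω hΩ m T hreg hE hhE σ hσ
  have hσ0 : 0 ≤ σ := hσhat.le.trans hσ
  have hc := hcoer Ω hΩ m T hreg hE hhE σ hσ
  refine ⟨hc, ?_⟩
  intro μ τ hμ hτ ψ hψ u₀ hu₀ hu₀nonneg nodes hnodes N u hu
  have hstep : ∀ n, 1 ≤ n → n ≤ N →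
      1 / 2 * DriftDiffusion.normSq T (u n) ≤
        1 / 2 * DriftDiffusion.normSq T (u (n - 1))
          - τ * (1 / 2) * DriftDiffusion.sipNormSq T hE σ (u n)
          - τ * μ / 2 * DriftDiffusion.upwindNormSq T ψ (u n)
          - τ * ∑ i, (-(1 / 2) * ∫ x in T.K i,
              (DriftDiffusion.pval (u n i) x) ^ 2 * DriftDiffusion.weakLaplacian Ω ψ x) := by
    intro n h1 hn
    have hmem := (hu.2 n h1 hn).1.1
    -- `normLInf` is a `toReal`, hence nonnegative, which makes the zero function admissible.
    have h2 := hu.energy_le ENNReal.toReal_nonneg h1 hn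
    rw [DriftDiffusion.bForm_self T hΩ hψ hmem] at h2
    have h3 := mul_le_mul_of_nonneg_left (hc (u n) hmem) hτ.le
    linarith
  refine ⟨hstep, fun hΔ => ?_⟩
  have hmono : ∀ n, 1 ≤ n → n ≤ N →
      DriftDiffusion.normSq T (u n) ≤ DriftDiffusion.normSq T (u (n - 1)) := by
    intro n h1 hn
    have h2 := hstep n h1 hn
    have h3 := mul_nonneg hτ.le (DriftDiffusion.sipNormSq_nonneg T hhE hσ0 (u n))
    have h4 := mul_nonneg (mul_nonneg hτ.le hμ.le) (DriftDiffusion.upwindNormSq_nonneg T ψ (u n))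
    have h5 : 0 ≤ ∑ i, (-(1 / 2) * ∫ x in T.K i,
        (DriftDiffusion.pval (u n i) x) ^ 2 * DriftDiffusion.weakLaplacian Ω ψ x) := by
      refine Finset.sum_nonneg fun i _ => mul_nonneg_of_nonpos_of_nonpos (by norm_num) ?_
      refine integral_nonpos_of_ae ?_
      filter_upwards [ae_restrict_of_ae_restrict_of_subset (T.subset i) hΔ] with x hx
      exact mul_nonpos_of_nonneg_of_nonpos (sq_nonneg _) hx
    have h6 := mul_nonneg hτ.le h5
    linarith
  intro a _ b hb hab
  induction b, hab using Nat.le_induction with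
  | base => exact le_rfl
  | succ k hk ih =>
    have hkN : k + 1 ≤ N := hb
    exact (hmono (k + 1) (by omega) hkN).trans (ih (show k ≤ N by omega))
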